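/- Let $n\ge 1$, $p\in(1,\infty)$, and equip $\mathbb R^{n+1}=\mathbb R^n\times\mathbb R\ni(x,t)$ with Lebesgue measure and the parabolic distance $d((x,t),(y,s))=\max(|x-y|,|t-s|^{1/p})$. A cylinder is a ball $P=B_d(c,r)$ with $r=r(P)>0$; $\lambda P=B_d(c,\lambda r)$; $P^{\pm,a}=P\pm a r^p$ (translation in time), $P^\pm=P^{\pm,3}$; $\widetilde P^{a}=\operatorname{conv}(P^{+,a}\cup P^{-,a})$ and $\lambda\widetilde P^a:=\widetilde{(\lambda P)}^a$. For $A=(A_1,A_2,A_3)\in[2,\infty)^3$ and an open set $\Omega\subset\mathbb R^{n+1}$, $k_{\Omega,A}(P,Q)\in[1,\infty]$ is the least $N$ for which there are cylinders $P=Q_1,\dots,Q_N=Q$ with $A_3\widetilde{Q_j}^3\subset\Omega$ for all $j$ and, for all $j<N$, $A_1^{-1}\le |Q_{j+1}|/|Q_j|\le A_1$ and $|Q_j^+\cap Q_{j+1}^-|\ge A_2^{-1}|Q_j\cup Q_{j+1}|$ ($k_{\Omega,A}(P,Q)=\infty$ if there are none). Write $\Omega_t^{+}=\{(x,s)\in\Omega: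 s>t\}$, $\Omega_t^{-}=\{(x,s)\in\Omega: s<t\}$. $\Omega$ is $t$-FIT connected with central cylinder $R_*$ if $R_*\subset\Omega_t^-$ and for every $z\in\Omega_t^+$ there are a cylinder $Q\subset\Omega$ and some $A\in[2,\infty)^3$ (both may depend on $z$) with $z\in Q^+\subset\Omega_t^+$ and $k_{\Omega,A}(R_*,Q)<\infty$. It is a $(t,A)$-FIT Hölder domain with central cylinder $R_*$ if moreover there is $K>0$ with $$\inf_{z\in Q^+,\ Q\subset\Omega_t^+}k_{\Omega,A}(R_*,Q)\le K\log_2\bigl(1+1/\operatorname{dist}_d(z,(\Omega_t^+)^c)\bigr)\qquad\text{for all } z\in\Omega_t^+ .$$ $\mathrm{PBMO}^+(U)$, for $U$ open, is the class of locally integrable $f$ on $U$ with $$\|f\|_{\mathrm{PBMO}^+(U)}=\sup_{\widetilde P^3\subset U}\ \inf_{c\in\mathbb R}\Bigl(\frac1{|P^+|}\int_{P^+}(f-c)_+ +\frac1{|P^-|}\int_{P^-}(f-c)_-\Bigr)<\infty .$$ **Statement.** Let $A\in[2,\infty)^3$ with $A_2>2$. There is $\lambda_0=\lambda_0(n,p,A)\in(0,1]$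 such that the following holds. Let $\Omega\subset\mathbb R^{n+1}$ be open, $t_0\in\mathbb R$, $\varepsilon,D_0,\eta>0$. Suppose that $\Omega$ is $(t_0-\varepsilon)$-FIT connected with central cylinder $R_*$, and that every $f\in\mathrm{PBMO}^+(\Omega_{t_0-\varepsilon}^+)$ of non-zero norm satisfies $$\inf_{a\in\mathbb R}\int_{\Omega_{t_0}^+}\exp\Bigl(\eta\,(f(z)-a)_+/\|f\|_{\mathrm{PBMO}^+(\Omega_{t_0-\varepsilon}^+)}\Bigr)\,dz\le D_0 .$$ 1. For every $\lambda\in(0,\lambda_0]$, $\Omega$ is a $(t_0,A)$-FIT Hölder domain with central cylinder $R=\lambda R_*$, the cylinder concentric with $R_*$; and there is a constant $D>0$ with $$\inf_{z\in Q^+,\ Q\subset\Omega_{t_0}^+}k_{\Omega,A}(R,Q)\le D\log\Bigl(\frac1{\operatorname{dist}_d(z,(\Omega_{t_0}^+)^c)}+1\Bigr)\qquad\text{for all } z\in\Omega_{t_0}^+ .$$ 2. If the connecting chains from $R_*$ can be taken with the given parameter $A$ and with arbitrarily small last cylinders (for all $z\in\Omega_{t_0-\varepsilon}^+$ and $\rho>0$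 there is a cylinder $Q$ with $r(Q)<\rho$, $z\in Q^+$ and $k_{\Omega,A}(R_*,Q)<\infty$), then the same conclusions hold with $R=R_*$ itself. Here $D$ may depend on all the data, including $\Omega$ and the central cylinder. -/

import Mathlib

open MeasureTheory Set
open scoped ENNReal

namespace FIT

noncomputable section

/-- Space time `ℝⁿ × ℝ`; the last coordinate is time. -/
abbrev SpaceTime (n : ℕ) : Type := EuclideanSpace ℝ (Fin n) × ℝ

/-- The parabolic distance `max (|x - y|, |t - s|^{1/p})`. -/
def pdist {n : ℕ} (p : ℝ) (z w : SpaceTime n) : ℝ :=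
  max ‖z.1 - w.1‖ (|z.2 - w.2| ^ (1 / p))

/-- The parabolic distance from a point to a (nonempty) set. -/
def pinfDist {n : ℕ} (p : ℝ) (z : SpaceTime n) (S : Set (SpaceTime n)) : ℝ :=
  sInf (pdist p z '' S)

/-- A parabolic cylinder, recorded by its center and its positive radius. -/
structure Cylinder (n : ℕ) where
  center : SpaceTime n
  radius : ℝ
  radius_pos : 0 < radius

namespace Cylinder

variable {n : ℕ}

/-- The point set of a parabolic cylinder: an open ball of the parabolic distance. -/
def toSet (p : ℝ) (P : Cylinder n) : Set (SpaceTime n) :=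
  {z | pdist p z P.center < P.radius}

/-- The cylinder `l P` with the same center and the radius multiplied by `l`. -/
def dilate (P : Cylinder n) (l : ℝ) (hl : 0 < l) : Cylinder n where
  center := P.center
  radius := l * P.radius
  radius_pos := mul_pos hl P.radius_pos

/-- The temporal translation `P + a r(P)^p`. For `a > 0`, the cylinders `P^{+,a}` and `P^{-,a}`
are `P.lag p a` and `P.lag p (-a)`; the cylinders `P^+` and `P^-` have `a = 3`. -/
def lag (p : ℝ) (P : Cylinder n) (a : ℝ) : Cylinder n where
  center := (P.center.1, P.center.2 + a * P.radius ^ p)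
  radius := P.radius
  radius_pos := P.radius_pos

/-- The convex hull of `P^{+,a} ∪ P^{-,a}`. -/
def hull (p : ℝ) (P : Cylinder n) (a : ℝ) : Set (SpaceTime n) :=
  convexHull ℝ ((P.lag p a).toSet p ∪ (P.lag p (-a)).toSet p)

end Cylinder

/-- A triple of parameters `(A₁, A₂, A₃) ∈ [2, ∞)³`. -/
structure Param where
  A₁ : ℝ
  A₂ : ℝ
  A₃ : ℝ
  two_le_A₁ : 2 ≤ A₁
  two_le_A₂ : 2 ≤ A₂
  two_le_A₃ : 2 ≤ A₃

theorem Param.A₃_pos (A : Param) : 0 < A.A₃ := lt_of_lt_of_le two_pos A.two_le_A₃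

/-- Forward-in-time links `(P, Q)`. -/
def IsLink {n : ℕ} (p : ℝ) (A : Param) (P Q : Cylinder n) : Prop :=
  1 / A.A₁ ≤ volume.real (Q.toSet p) / volume.real (P.toSet p) ∧
  volume.real (Q.toSet p) / volume.real (P.toSet p) ≤ A.A₁ ∧
  1 / A.A₂ * volume.real (Q.toSet p ∪ P.toSet p)
    ≤ volume.real ((P.lag p 3).toSet p ∩ (Q.lag p (-3)).toSet p)

/-- The family `𝒞_{Ω,A}(P, Q)` of the FIT chains in `Ω` that connect `P` to `Q`. The dilate of
the hull of `R` by the factor `A₃` is parabolic, that is, it is the hull of the cylinder `A₃ R`. -/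
def chains {n : ℕ} (p : ℝ) (Ω : Set (SpaceTime n)) (A : Param) (P Q : Cylinder n) :
    Set (List (Cylinder n)) :=
  {C | C.IsChain (IsLink p A) ∧ C.head? = some P ∧ C.getLast? = some Q ∧
    ∀ R ∈ C, (R.dilate A.A₃ A.A₃_pos).hull p 3 ⊆ Ω}

/-- The FIT distance `k_{Ω,A}(P, Q)`: the least length of a chain, `∞` if there is none. -/
def fitDist {n : ℕ} (p : ℝ) (Ω : Set (SpaceTime n)) (A : Param) (P Q : Cylinder n) : ℝ≥0∞ :=
  ⨅ C ∈ chains p Ω A P Q, (C.length : ℝ≥0∞)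

/-- The future part `Ω_{t₀}^+`. -/
def future {n : ℕ} (Ω : Set (SpaceTime n)) (t₀ : ℝ) : Set (SpaceTime n) := {z ∈ Ω | t₀ < z.2}

/-- The past part `Ω_{t₀}^-`. -/
def past {n : ℕ} (Ω : Set (SpaceTime n)) (t₀ : ℝ) : Set (SpaceTime n) := {z ∈ Ω | z.2 < t₀}

/-- `Ω` is `t₀`-FIT connected with the central cylinder `R`. The parameter of the chains may
depend on the point `z`. -/
def IsConnectedWith {n : ℕ} (p : ℝ) (Ω : Set (SpaceTime n)) (t₀ : ℝ) (R : Cylinder n) : Prop :=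
  R.toSet p ⊆ past Ω t₀ ∧
  ∀ z ∈ future Ω t₀, ∃ (Q : Cylinder n) (A : Param),
    Q.toSet p ⊆ Ω ∧ z ∈ (Q.lag p 3).toSet p ∧ (Q.lag p 3).toSet p ⊆ future Ω t₀ ∧
    fitDist p Ω A R Q < ∞

/-- The infimum of `k_{Ω,A}(R, Q)` over all cylinders `Q ⊆ Ω_{t₀}^+` with `z ∈ Q^+`. -/
def fitDistTo {n : ℕ} (p : ℝ) (Ω : Set (SpaceTime n)) (t₀ : ℝ) (A : Param) (R : Cylinder n)
    (z : SpaceTime n) : ℝ≥0∞ :=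
  ⨅ (Q : Cylinder n) (_ : z ∈ (Q.lag p 3).toSet p ∧ Q.toSet p ⊆ future Ω t₀), fitDist p Ω A R Q

/-- The open set `Ω` is a `(t₀, A)`-FIT Hölder domain with the central cylinder `R`. -/
def IsHolderWith {n : ℕ} (p : ℝ) (Ω : Set (SpaceTime n)) (t₀ : ℝ) (A : Param)
    (R : Cylinder n) : Prop :=
  IsOpen Ω ∧ IsConnectedWith p Ω t₀ R ∧
  ∃ K : ℝ, 0 < K ∧ ∀ z ∈ future Ω t₀,
    fitDistTo p Ω t₀ A R z
      ≤ ENNReal.ofReal (K * Real.logb 2 (1 + 1 / pinfDist p z (future Ω t₀)ᶜ))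

/-- The norm of `PBMO^+(a, q, θ, Ω)`. Positive and negative parts are taken by `ENNReal.ofReal`,
which vanishes on negative numbers. -/
def pbmoNormGen {n : ℕ} (p a q θ : ℝ) (hθ : 0 < θ) (Ω : Set (SpaceTime n))
    (f : SpaceTime n → ℝ) : ℝ≥0∞ :=
  ⨆ (P : Cylinder n) (_ : (P.dilate θ hθ).hull p a ⊆ Ω), ⨅ c : ℝ,
    ((⨍⁻ z in (P.lag p a).toSet p, ENNReal.ofReal (f z - c) ^ q ∂volume) +
      ⨍⁻ z in (P.lag p (-a)).toSet p, ENNReal.ofReal (c - f z) ^ q ∂volume) ^ (1 / q)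

/-- The norm of `PBMO^+(Ω) = PBMO^+(3, 1, 1, Ω)`. -/
def pbmoNorm {n : ℕ} (p : ℝ) (Ω : Set (SpaceTime n)) (f : SpaceTime n → ℝ) : ℝ≥0∞ :=
  pbmoNormGen p 3 1 1 one_pos Ω f

/-- Membership in `PBMO^+(Ω)`. -/
def MemPBMO {n : ℕ} (p : ℝ) (Ω : Set (SpaceTime n)) (f : SpaceTime n → ℝ) : Prop :=
  LocallyIntegrableOn f Ω volume ∧ pbmoNorm p Ω f < ∞

/-- Forward exponential integrability on `V` for the functions in `PBMO^+(U)` (those of norm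
zero, for which the quotient by the norm has no meaning, are left out). -/
def ExpIntegrability {n : ℕ} (p : ℝ) (U V : Set (SpaceTime n)) (η D₀ : ℝ) : Prop :=
  ∀ f : SpaceTime n → ℝ, MemPBMO p U f → pbmoNorm p U f ≠ 0 →
    ⨅ a : ℝ, ∫⁻ z in V,
      ENNReal.ofReal (Real.exp (η * max (f z - a) 0 / (pbmoNorm p U f).toReal)) ∂volume
        ≤ ENNReal.ofReal D₀

/-- The conclusion: `Ω` is a `(t₀, A)`-FIT Hölder domain with the central cylinder `R`, and the
FIT distance from `R` has logarithmic growth at the complement of `Ω_{t₀}^+`. -/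
def HolderConclusion {n : ℕ} (p : ℝ) (Ω : Set (SpaceTime n)) (t₀ : ℝ) (A : Param)
    (R : Cylinder n) : Prop :=
  IsHolderWith p Ω t₀ A R ∧
  ∃ D : ℝ, 0 < D ∧ ∀ z ∈ future Ω t₀,
    fitDistTo p Ω t₀ A R z
      ≤ ENNReal.ofReal (D * Real.log (1 / pinfDist p z (future Ω t₀)ᶜ + 1))

end

end FIT

/-! The proof tests the exponential integrability on one function: a penalized chain distance `pot`.
With `B = 1 / log (1/θ)`, it is the infimum of `k(R, Q) + B log (ρ / r(Q))` over cylinders `Q` lying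
below `z` at a distance comparable to `r(Q)`, a large dilate of which stays in `U`, the future of
`t₀ - ε`. About `B log (r'/r)` links are needed to change a radius from `r` to `r'` by factors of
`θ`, so with this weight the links spent on growing are paid for by the decrease of the penalty.

For a hull in `U`, a chain ending below `w ∈ P^-` is continued to one ending below `z ∈ P^+`: grow
along a parabolic cone from `w` to the scale of `P`, cross `P` by boundedly many links, then shrink
along a cone towards `z` to the relative depth of `z` in `P`. Hence `pot z ≤ pot w + C + 2 B
logDepth P z` (`Scales.pot_le`). The averages of `logDepth` over `P^+` are bounded
(`lintegral_logDepth_le`), so `pot` satisfies the one-sided oscillation bound of `PBMO^+`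
(`Scales.pbmoNorm_le`).

The hypothesis now makes the exponential of a multiple of `pot` integrable. If `z` has distance `d`
to the complement, take `P` of radius `d/8` with `z` the center of `P^+`. Since `|P^-|` is
comparable to `d^(n+p)`, Chebyshev's inequality yields `w ∈ P^-` with `pot w` at most logarithmic in
`1/d`, and the comparison carries this to `z` (`Scales.pot_le_of_exp`). A last descent of
logarithmic length reaches a cylinder inside the future of `t₀` (`Scales.exists_descent`).

Two preparations are needed. `pot` must be finite although the given chains may have any parameter:
such a chain serves only as a corridor, followed by tiny cylinders linked with the parameter `A`
(`reaches_of_isConnectedWith`). The radii must be bounded by some `ρ` to keep the penalty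
nonnegative: testing with a step function in time shows that the future has finite volume. -/

namespace FIT

variable {n : ℕ} {p : ℝ}

/-! ### Cylinders and hulls as boxes, and their volumes. -/

/-- The open box of spatial radius `a` and temporal radius `b` about `y`. -/
def box (y : SpaceTime n) (a b : ℝ) : Set (SpaceTime n) :=
  Metric.ball y.1 a ×ˢ Metric.ball y.2 b

theorem mem_box {y z : SpaceTime n} {a b : ℝ} :
    z ∈ box y a b ↔ ‖z.1 - y.1‖ < a ∧ |z.2 - y.2| < b := by
  simp [box, Metric.mem_ball, dist_eq_norm]

theorem isOpen_box (y : SpaceTime n) (a b : ℝ) : IsOpen (box y a b) :=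
  Metric.isOpen_ball.prod Metric.isOpen_ball

theorem measurableSet_box (y : SpaceTime n) (a b : ℝ) : MeasurableSet (box y a b) :=
  (isOpen_box y a b).measurableSet

theorem box_subset_box {y c : SpaceTime n} {a b a' b' : ℝ} (h1 : ‖y.1 - c.1‖ + a ≤ a')
    (h2 : |y.2 - c.2| + b ≤ b') : box y a b ⊆ box c a' b' := by
  intro z hz
  rw [mem_box] at hz ⊢
  have e1 := norm_sub_le_norm_sub_add_norm_sub z.1 y.1 c.1
  have e2 := abs_sub_le z.2 y.2 c.2
  exact ⟨by linarith, by linarith⟩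

theorem rpow_one_div_lt_iff (hp : 0 < p) {u r : ℝ} (hu : 0 ≤ u) (hr : 0 < r) :
    u ^ (1 / p) < r ↔ u < r ^ p := by
  rw [← Real.rpow_lt_rpow_iff (Real.rpow_nonneg hu _) hr.le hp, ← Real.rpow_mul hu,
    one_div_mul_cancel hp.ne', Real.rpow_one]

theorem pdist_lt_iff (hp : 0 < p) {z w : SpaceTime n} {r : ℝ} (hr : 0 < r) :
    pdist p z w < r ↔ ‖z.1 - w.1‖ < r ∧ |z.2 - w.2| < r ^ p := by
  rw [pdist, max_lt_iff, rpow_one_div_lt_iff hp (abs_nonneg _) hr]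

theorem Cylinder.toSet_eq (hp : 0 < p) (P : Cylinder n) :
    P.toSet p = box P.center P.radius (P.radius ^ p) := by
  ext z
  rw [mem_box]
  exact pdist_lt_iff hp P.radius_pos

theorem Cylinder.lag_toSet_eq (hp : 0 < p) (P : Cylinder n) (a : ℝ) :
    (P.lag p a).toSet p
      = box (P.center.1, P.center.2 + a * P.radius ^ p) P.radius (P.radius ^ p) :=
  Cylinder.toSet_eq hp _

/-- Convex hulls commute with products, so only the time factor matters. A time within `2ρ` of the
center lies between the midpoints of the two intervals; any other one lies in one of them. -/
theorem Cylinder.hull_eq (hp : 0 < p) (P : Cylinder n) :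
    P.hull p 3 = box P.center P.radius (4 * P.radius ^ p) := by
  have hr := Real.rpow_pos_of_pos P.radius_pos p
  rw [Cylinder.hull, Cylinder.lag_toSet_eq hp, Cylinder.lag_toSet_eq hp]
  unfold box
  simp only
  rw [← Set.prod_union, convexHull_prod, (convex_ball _ _).convexHull_eq]
  congr 1
  set ρ := P.radius ^ p
  set t := P.center.2
  apply Subset.antisymm
  · refine convexHull_min ?_ (convex_ball _ _)
    rintro s (hs | hs) <;> simp only [Metric.mem_ball, Real.dist_eq, abs_lt] at hs ⊢ <;>
      constructor <;> linarith
  · intro s hs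
    simp only [Metric.mem_ball, Real.dist_eq, abs_lt] at hs
    set S := Metric.ball (t + 3 * ρ) ρ ∪ Metric.ball (t + -3 * ρ) ρ
    have hI : ∀ u, |u - (t + 3 * ρ)| < ρ → u ∈ convexHull ℝ S := fun u hu =>
      subset_convexHull ℝ _ (Or.inl (by simpa [Metric.mem_ball, Real.dist_eq] using hu))
    have hI' : ∀ u, |u - (t + -3 * ρ)| < ρ → u ∈ convexHull ℝ S := fun u hu =>
      subset_convexHull ℝ _ (Or.inr (by simpa only [Metric.mem_ball, Real.dist_eq] using hu))
    by_cases h1 : t + 2 * ρ < s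
    · exact hI s (by rw [abs_lt]; constructor <;> linarith)
    by_cases h2 : s < t - 2 * ρ
    · exact hI' s (by rw [abs_lt]; constructor <;> linarith)
    push Not at h1 h2
    have e1 := hI (t + 3 * ρ) (by simpa using hr)
    have e2 := hI' (t + -3 * ρ) (by simpa using hr)
    have := (convex_convexHull ℝ S).ordConnected.out e2 e1
    exact this ⟨by linarith, by linarith⟩

theorem Cylinder.dilate_hull_eq (hp : 0 < p) (P : Cylinder n) (l : ℝ) (hl : 0 < l) :
    (P.dilate l hl).hull p 3 = box P.center (l * P.radius) (4 * (l ^ p * P.radius ^ p)) := by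
  rw [Cylinder.hull_eq hp]
  simp only [Cylinder.dilate]
  rw [Real.mul_rpow hl.le P.radius_pos.le]

/-- The volume of the unit ball. -/
noncomputable def unitVol (n : ℕ) : ℝ := volume.real (Metric.ball (0 : EuclideanSpace ℝ (Fin n)) 1)

theorem unitVol_pos (n : ℕ) : 0 < unitVol n :=
  ENNReal.toReal_pos (Metric.measure_ball_pos _ _ one_pos).ne' measure_ball_lt_top.ne

theorem volume_ball_eq (x : EuclideanSpace ℝ (Fin n)) {a : ℝ} (ha : 0 < a) :
    volume (Metric.ball x a) = ENNReal.ofReal (a ^ n * unitVol n) := by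
  rw [Measure.addHaar_ball_of_pos _ _ ha, ENNReal.ofReal_mul (by positivity), unitVol,
    ofReal_measureReal measure_ball_lt_top.ne]
  simp

theorem volume_box (y : SpaceTime n) {a : ℝ} (b : ℝ) (ha : 0 < a) :
    volume (box y a b) = ENNReal.ofReal (a ^ n * unitVol n * (2 * b)) := by
  have := unitVol_pos n
  rw [box, Measure.volume_eq_prod, Measure.prod_prod, volume_ball_eq _ ha, Real.volume_ball,
    ← ENNReal.ofReal_mul (by positivity)]

theorem volumeReal_box (y : SpaceTime n) {a b : ℝ} (ha : 0 < a) (hb : 0 ≤ b) :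
    volume.real (box y a b) = a ^ n * unitVol n * (2 * b) := by
  have := unitVol_pos n
  rw [Measure.real, volume_box y b ha, ENNReal.toReal_ofReal (by positivity)]

/-! ### Links between nearby cylinders, and the length of chains. -/

/-- Numbers `κ` such that cylinders whose radii have a ratio in `[κ, 1]` may be linked, with a
tolerance `1 - κ` for their relative position. -/
structure Slack (n : ℕ) (p : ℝ) (A : Param) (κ : ℝ) : Prop where
  pos : 0 < κ
  lt_one : κ < 1
  two_div_le : 2 / A.A₂ ≤ κ ^ n * κ ^ p
  half_le : 1 / 2 ≤ κ ^ n * κ ^ p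

/-- Both lower bounds are strict at `κ = 1` and persist nearby by continuity. This is where `A₂ > 2`
enters: two disjoint cylinders of equal size with `P^+ = Q^-` already have overlap ratio `1/2`, and
the excess of `A₂` over `2` leaves a tolerance. -/
theorem exists_slack (n : ℕ) (p : ℝ) (A : Param) (hA : 2 < A.A₂) : ∃ κ, Slack n p A κ := by
  have hc : ContinuousAt (fun κ : ℝ => κ ^ n * κ ^ p) 1 :=
    (continuousAt_id.pow n).mul (Real.continuousAt_rpow_const _ _ (Or.inl one_ne_zero))
  have h1 : max (2 / A.A₂) (1 / 2) < (fun κ : ℝ => κ ^ n * κ ^ p) 1 := by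
    simp only [one_pow, Real.one_rpow, mul_one]
    refine max_lt ?_ (by norm_num)
    rw [div_lt_one (by linarith)]; exact hA
  have h2 := (hc.eventually (lt_mem_nhds h1)).filter_mono (nhdsWithin_le_nhds (s := Iio 1))
  have h3 : ∀ᶠ κ : ℝ in nhdsWithin 1 (Iio 1), κ ∈ Ioo (0 : ℝ) 1 :=
    Ioo_mem_nhdsLT one_pos
  obtain ⟨κ, hκ, hκ'⟩ := (h2.and h3).exists
  exact ⟨κ, hκ'.1, hκ'.2, (le_max_left _ _).trans hκ.le, (le_max_right _ _).trans hκ.le⟩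

theorem Slack.rpow_le {A : Param} {κ : ℝ} (h : Slack n p A κ) (hp : 1 ≤ p) : κ ^ p ≤ κ := by
  simpa using Real.rpow_le_rpow_of_exponent_ge h.pos h.lt_one.le hp

/-- Nearby cylinders of comparable size, one of which lies in the appropriate future of the
other one, are linked. -/
theorem isLink_of_near (hp : 1 ≤ p) {A : Param} {κ : ℝ} (hκ : Slack n p A κ) {P Q : Cylinder n}
    {m : ℝ} (hPm : P.radius ≤ m) (hQm : Q.radius ≤ m) (hP : κ * m ≤ P.radius)
    (hQ : κ * m ≤ Q.radius) (hx : ‖Q.center.1 - P.center.1‖ ≤ (1 - κ) * m)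
    (ht : |Q.center.2 - P.center.2 - 3 * (P.radius ^ p + Q.radius ^ p)| ≤ (1 - κ) * m ^ p)
    (hm : m = P.radius ∨ m = Q.radius) :
    IsLink p A P Q := by
  have hp0 : 0 < p := by linarith
  have hκ0 := hκ.pos
  have hm0 : 0 < m := P.radius_pos.trans_le hPm
  have hmp : 0 < m ^ p := Real.rpow_pos_of_pos hm0 p
  have hω := unitVol_pos n
  have hPp : κ ^ p * m ^ p ≤ P.radius ^ p := by
    rw [← Real.mul_rpow hκ0.le hm0.le]; exact Real.rpow_le_rpow (by positivity) hP hp0.le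
  have hQp : κ ^ p * m ^ p ≤ Q.radius ^ p := by
    rw [← Real.mul_rpow hκ0.le hm0.le]; exact Real.rpow_le_rpow (by positivity) hQ hp0.le
  have hPpm : P.radius ^ p ≤ m ^ p := Real.rpow_le_rpow P.radius_pos.le hPm hp0.le
  have hQpm : Q.radius ^ p ≤ m ^ p := Real.rpow_le_rpow Q.radius_pos.le hQm hp0.le
  have hκp := hκ.rpow_le hp
  have hP0 := P.radius_pos
  have hQ0 := Q.radius_pos
  have hPp0 := Real.rpow_pos_of_pos hP0 p
  have hQp0 := Real.rpow_pos_of_pos hQ0 p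
  have hκp0 := Real.rpow_pos_of_pos hκ0 p
  set M := m ^ n * unitVol n * (2 * m ^ p) with hM
  have hM0 : 0 < M := by positivity
  have bnd : ∀ r : ℝ, κ * m ≤ r → r ≤ m →
      κ ^ n * κ ^ p * M ≤ r ^ n * unitVol n * (2 * r ^ p) ∧
        r ^ n * unitVol n * (2 * r ^ p) ≤ M := by
    intro r h1 h2
    have hr : 0 < r := lt_of_lt_of_le (by positivity) h1
    have e1 : κ ^ n * m ^ n ≤ r ^ n := by
      rw [← mul_pow]; exact pow_le_pow_left₀ (by positivity) h1 n
    have e2 : κ ^ p * m ^ p ≤ r ^ p := by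
      rw [← Real.mul_rpow hκ0.le hm0.le]; exact Real.rpow_le_rpow (by positivity) h1 hp0.le
    constructor
    · calc κ ^ n * κ ^ p * M = (κ ^ n * m ^ n) * unitVol n * (2 * (κ ^ p * m ^ p)) := by
            rw [hM]; ring
        _ ≤ _ := by gcongr
    · rw [hM]; gcongr
  rw [IsLink, Cylinder.toSet_eq hp0, Cylinder.toSet_eq hp0, Cylinder.lag_toSet_eq hp0,
    Cylinder.lag_toSet_eq hp0]
  obtain ⟨p1, p2⟩ := bnd _ hP hPm
  obtain ⟨q1, q2⟩ := bnd _ hQ hQm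
  have vP := volumeReal_box P.center hP0 hPp0.le
  have vQ := volumeReal_box Q.center hQ0 hQp0.le
  rw [← vP] at p1 p2
  rw [← vQ] at q1 q2
  have hhalf := hκ.half_le
  have hA1 := A.two_le_A₁
  have hhM : 1 / 2 * M ≤ κ ^ n * κ ^ p * M := by gcongr
  refine ⟨?_, ?_, ?_⟩
  · calc 1 / A.A₁ ≤ 1 / 2 := by gcongr
      _ ≤ _ := by rw [le_div_iff₀ (by linarith)]; linarith
  · refine le_trans ?_ hA1
    rw [div_le_iff₀ (by linarith)]; linarith
  -- The overlap contains a box of scale `κ m` centered at the center of the translate of the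
  -- smaller cylinder; the offset `1 - κ` and the size `κ` add up to the larger cylinder.
  · obtain ⟨c, hc1, hc2⟩ : ∃ c : SpaceTime n,
        box c (κ * m) (κ ^ p * m ^ p)
          ⊆ box (P.center.1, P.center.2 + 3 * P.radius ^ p) P.radius (P.radius ^ p) ∧
        box c (κ * m) (κ ^ p * m ^ p)
          ⊆ box (Q.center.1, Q.center.2 + -3 * Q.radius ^ p) Q.radius (Q.radius ^ p) := by
      -- Since `p ≥ 1`, the temporal size `κ ^ p` fits next to an offset `1 - κ`.
      have key : κ ^ p * m ^ p ≤ κ * m ^ p := by gcongr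
      rcases hm with hm | hm
      · refine ⟨(Q.center.1, Q.center.2 + -3 * Q.radius ^ p), ?_, ?_⟩
        · refine box_subset_box (by simp only; linarith) ?_
          simp only
          rw [← hm]
          have : |Q.center.2 + -3 * Q.radius ^ p - (P.center.2 + 3 * m ^ p)|
            = |Q.center.2 - P.center.2 - 3 * (P.radius ^ p + Q.radius ^ p)| := by
            rw [← hm]; congr 1; ring
          rw [this]; linarith
        · exact box_subset_box (by simpa using hQ) (by simpa using hQp)
      · refine ⟨(P.center.1, P.center.2 + 3 * P.radius ^ p), ?_, ?_⟩
        · exact box_subset_box (by simpa using hP) (by simpa using hPp)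
        · refine box_subset_box (by simp only; rw [norm_sub_rev]; linarith) ?_
          simp only
          rw [← hm]
          have : |P.center.2 + 3 * P.radius ^ p - (Q.center.2 + -3 * m ^ p)|
            = |Q.center.2 - P.center.2 - 3 * (P.radius ^ p + Q.radius ^ p)| := by
            rw [abs_sub_comm, ← hm]; congr 1; ring
          rw [this]; linarith
    have hsub := subset_inter hc1 hc2
    have hfin : volume (box (P.center.1, P.center.2 + 3 * P.radius ^ p) P.radius (P.radius ^ p) ∩
        box (Q.center.1, Q.center.2 + -3 * Q.radius ^ p) Q.radius (Q.radius ^ p)) ≠ ∞ := by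
      refine ne_top_of_le_ne_top ?_ (measure_mono inter_subset_left)
      rw [volume_box _ _ hP0]; exact ENNReal.ofReal_ne_top
    have h1 := measureReal_mono hsub hfin
    rw [volumeReal_box _ (by positivity) (by positivity)] at h1
    have h2 := measureReal_union_le (μ := volume) (box Q.center Q.radius (Q.radius ^ p))
      (box P.center P.radius (P.radius ^ p))
    have hA2 : 0 < A.A₂ := two_pos.trans_le A.two_le_A₂
    calc _ ≤ 1 / A.A₂ * (M + M) := by gcongr; linarith
      _ = 2 / A.A₂ * M := by ring
      _ ≤ κ ^ n * κ ^ p * M := by gcongr; exact hκ.two_div_le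
      _ = (κ * m) ^ n * unitVol n * (2 * (κ ^ p * m ^ p)) := by rw [hM]; ring
      _ ≤ _ := h1

/-- The dilate of the hull of `Q` that occurs in the definition of chains lies in `Ω`. -/
def Fits (p : ℝ) (Ω : Set (SpaceTime n)) (A : Param) (Q : Cylinder n) : Prop :=
  (Q.dilate A.A₃ A.A₃_pos).hull p 3 ⊆ Ω

theorem fitDist_self_le {Ω : Set (SpaceTime n)} {A : Param} {R : Cylinder n}
    (h : Fits p Ω A R) : fitDist p Ω A R R ≤ 1 := by
  refine (iInf₂_le [R] ?_).trans (by simp)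
  exact ⟨List.isChain_singleton _, rfl, rfl, fun S hS => by rw [List.mem_singleton.1 hS]; exact h⟩

theorem fitDist_le_add_one {Ω : Set (SpaceTime n)} {A : Param} {R Q Q' : Cylinder n}
    (hl : IsLink p A Q Q') (h : Fits p Ω A Q') :
    fitDist p Ω A R Q' ≤ fitDist p Ω A R Q + 1 := by
  rw [fitDist, fitDist, ENNReal.iInf_add]
  refine le_iInf fun C => ?_
  rw [ENNReal.iInf_add]
  refine le_iInf fun hC => ?_
  refine (iInf₂_le (C ++ [Q']) ?_).trans (by simp)
  obtain ⟨h1, h2, h3, h4⟩ := hC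
  refine ⟨?_, ?_, ?_, ?_⟩
  · rw [List.isChain_append]
    refine ⟨h1, List.isChain_singleton _, ?_⟩
    intro x hx y hy
    rw [h3] at hx
    simp only [Option.mem_def, Option.some.injEq, List.head?_cons] at hx hy
    subst hx; subst hy; exact hl
  · simp [h2]
  · simp
  · intro S hS
    rcases List.mem_append.1 hS with hS | hS
    · exact h4 S hS
    · rw [List.mem_singleton.1 hS]; exact h

theorem fitDist_le_add_nat {Ω : Set (SpaceTime n)} {A : Param} {R : Cylinder n}
    (q : ℕ → Cylinder n) (m : ℕ) (hl : ∀ i < m, IsLink p A (q i) (q (i + 1)))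
    (h : ∀ i < m, Fits p Ω A (q (i + 1))) :
    fitDist p Ω A R (q m) ≤ fitDist p Ω A R (q 0) + m := by
  induction m with
  | zero => simp
  | succ m ih =>
    refine (fitDist_le_add_one (hl m m.lt_succ_self) (h m m.lt_succ_self)).trans ?_
    have := ih (fun i hi => hl i (hi.trans m.lt_succ_self)) fun i hi => h i (hi.trans m.lt_succ_self)
    push_cast
    rw [← add_assoc]
    gcongr

theorem fits_of_fitDist_lt_top {Ω : Set (SpaceTime n)} {A : Param} {R Q : Cylinder n}
    (h : fitDist p Ω A R Q < ∞) : Fits p Ω A Q := by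
  rw [fitDist, iInf_lt_iff] at h
  obtain ⟨C, h⟩ := h
  rw [iInf_lt_iff] at h
  obtain ⟨hC, -⟩ := h
  exact hC.2.2.2 Q (List.mem_of_getLast? hC.2.2.1)

theorem fits_iff (hp : 0 < p) {Ω : Set (SpaceTime n)} {A : Param} {Q : Cylinder n} :
    Fits p Ω A Q ↔ box Q.center (A.A₃ * Q.radius) (4 * (A.A₃ ^ p * Q.radius ^ p)) ⊆ Ω := by
  rw [Fits, Cylinder.dilate_hull_eq hp]

theorem one_le_rpow_A₃ (hp : 0 ≤ p) (A : Param) : 1 ≤ A.A₃ ^ p :=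
  Real.one_le_rpow (by linarith [A.two_le_A₃]) hp

theorem Fits.hull_subset (hp : 0 < p) {Ω : Set (SpaceTime n)} {A : Param} {Q : Cylinder n}
    (h : Fits p Ω A Q) : Q.hull p 3 ⊆ Ω := by
  rw [fits_iff hp] at h
  rw [Cylinder.hull_eq hp]
  have h1 := one_le_rpow_A₃ hp.le A
  have h2 := Real.rpow_pos_of_pos Q.radius_pos p
  refine Subset.trans (box_subset_box ?_ ?_) h
  · simp only [sub_self, norm_zero, zero_add]
    nlinarith [A.two_le_A₃, Q.radius_pos]
  · simp only [sub_self, abs_zero, zero_add]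
    nlinarith

theorem Cylinder.toSet_subset_hull (hp : 0 < p) (Q : Cylinder n) : Q.toSet p ⊆ Q.hull p 3 := by
  rw [Cylinder.hull_eq hp, Cylinder.toSet_eq hp]
  have h2 := Real.rpow_pos_of_pos Q.radius_pos p
  exact box_subset_box (by simp) (by simp; linarith)

theorem Cylinder.lag_toSet_subset_hull (hp : 0 < p) (Q : Cylinder n) {a : ℝ} (ha : |a| ≤ 3) :
    (Q.lag p a).toSet p ⊆ Q.hull p 3 := by
  rw [Cylinder.hull_eq hp, Cylinder.lag_toSet_eq hp]
  have h2 := Real.rpow_pos_of_pos Q.radius_pos p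
  refine box_subset_box (by simp) ?_
  simp only [add_sub_cancel_left, abs_mul, abs_of_pos h2]
  nlinarith

end FIT

/-! ### Moving cylinders: travel at constant radius, growth and shrinking along cones, choice of
scales. -/

namespace FIT

variable {n : ℕ} {p : ℝ}

theorem Cylinder.ext_of {P Q : Cylinder n} (h1 : P.center = Q.center) (h2 : P.radius = Q.radius) :
    P = Q := by
  cases P; cases Q; simp_all

theorem segment_near {c c' X y : SpaceTime n} {a b : ℝ} (hy : y ∈ segment ℝ c c')
    (h1 : ‖c.1 - X.1‖ ≤ a) (h2 : ‖c'.1 - X.1‖ ≤ a) (h3 : |c.2 - X.2| ≤ b)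
    (h4 : |c'.2 - X.2| ≤ b) : ‖y.1 - X.1‖ ≤ a ∧ |y.2 - X.2| ≤ b := by
  have hc : Convex ℝ (Metric.closedBall X.1 a ×ˢ Metric.closedBall X.2 b) :=
    (convex_closedBall _ _).prod (convex_closedBall _ _)
  have := hc.segment_subset (x := c) (y := c') (by simp [dist_eq_norm, h1, h3])
    (by simp [dist_eq_norm, h2, h4]) hy
  simpa [dist_eq_norm] using this

/-- Moving along a segment by cylinders of a fixed radius. -/
theorem fitDist_travel (hp : 1 ≤ p) {A : Param} {κ : ℝ} (hκ : Slack n p A κ)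
    {Ω : Set (SpaceTime n)} (R : Cylinder n) {s : ℝ} (hs : 0 < s) {c c' : SpaceTime n}
    (hT : 36 * s ^ p ≤ (1 - κ) * (c'.2 - c.2))
    (hX : 6 * ‖c'.1 - c.1‖ * s ^ p ≤ (1 - κ) * (c'.2 - c.2) * s)
    (hfit : ∀ y ∈ segment ℝ c c', box y (A.A₃ * s) (4 * (A.A₃ ^ p * s ^ p)) ⊆ Ω) :
    fitDist p Ω A R ⟨c', s, hs⟩
      ≤ fitDist p Ω A R ⟨c, s, hs⟩ + (⌈(c'.2 - c.2) / (6 * s ^ p)⌉₊ : ℕ) := by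
  have hp0 : 0 < p := by linarith
  have hsp : 0 < s ^ p := Real.rpow_pos_of_pos hs p
  have h0 := hκ.pos
  have h1 := hκ.lt_one
  set T := c'.2 - c.2 with hTdef
  have hTpos : 0 < T := by
    by_contra hcon
    push Not at hcon
    nlinarith
  -- For equal radii, `6 s^p` is the time lag at which `P^+` and `Q^-` occupy the same times.
  -- Rounding to `N` steps changes the lag by at most `6 s^p / N ≤ (1 - κ) s^p`, which is the source
  -- of the factor `36 = 6 * 6` in `hT`.
  set N := ⌈T / (6 * s ^ p)⌉₊ with hN
  have hNpos : 0 < N := Nat.ceil_pos.2 (by positivity)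
  have hNr : (0 : ℝ) < N := by exact_mod_cast hNpos
  have hN1 : T ≤ N * (6 * s ^ p) := by
    rw [← div_le_iff₀ (by positivity)]; exact Nat.le_ceil _
  have hN2 : N * (6 * s ^ p) ≤ T + 6 * s ^ p := by
    have := (Nat.ceil_lt_add_one (a := T / (6 * s ^ p)) (by positivity)).le
    rw [← hN] at this
    calc N * (6 * s ^ p) ≤ (T / (6 * s ^ p) + 1) * (6 * s ^ p) := by gcongr
      _ = _ := by field_simp
  set q : ℕ → Cylinder n := fun i => ⟨c + ((i : ℝ) / N) • (c' - c), s, hs⟩ with hq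
  have q0 : q 0 = ⟨c, s, hs⟩ := by simp [hq]
  have qN : q N = ⟨c', s, hs⟩ := by simp [hq, div_self hNr.ne']
  rw [← q0, ← qN]
  refine fitDist_le_add_nat q N (fun i _ => ?_) fun i hi => ?_
  · have d1 : (q (i + 1)).center.1 - (q i).center.1 = (1 / (N : ℝ)) • (c'.1 - c.1) := by
      simp only [hq, Prod.fst_add, Prod.smul_fst, Prod.fst_sub, add_sub_add_left_eq_sub,
        ← sub_smul]
      congr 1; push_cast; ring
    have d2 : (q (i + 1)).center.2 - (q i).center.2 = T / N := by
      simp only [hq, Prod.snd_add, Prod.smul_snd, Prod.snd_sub, smul_eq_mul, hTdef]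
      push_cast; ring
    refine isLink_of_near hp hκ (m := s) le_rfl le_rfl ?_ ?_ ?_ ?_ (Or.inl rfl)
    · simp only [hq]; nlinarith
    · simp only [hq]; nlinarith
    · rw [d1, norm_smul, Real.norm_of_nonneg (by positivity), one_div, inv_mul_le_iff₀ hNr]
      have : 6 * ‖c'.1 - c.1‖ * s ^ p ≤ (1 - κ) * (N * (6 * s ^ p)) * s :=
        hX.trans (by gcongr)
      have h6 : (6 * s ^ p) * ‖c'.1 - c.1‖ ≤ (6 * s ^ p) * (N * ((1 - κ) * s)) := by linarith
      exact le_of_mul_le_mul_left h6 (by positivity)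
    · rw [d2]
      simp only [hq]
      have e1 : T / N ≤ 6 * s ^ p := by rw [div_le_iff₀ hNr]; linarith
      have e2 : 6 * s ^ p - (1 - κ) * s ^ p ≤ T / N := by
        rw [le_div_iff₀ hNr]
        have hpos : 0 < 6 - (1 - κ) := by linarith
        have : (6 - (1 - κ)) * (N * (6 * s ^ p)) ≤ (6 - (1 - κ)) * (T + 6 * s ^ p) := by gcongr
        nlinarith
      rw [abs_le]; constructor <;> linarith
  · rw [fits_iff hp0]
    refine hfit _ ?_
    rw [segment_eq_image']
    refine ⟨((i + 1 : ℕ) : ℝ) / N, ⟨by positivity, ?_⟩, rfl⟩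
    rw [div_le_one hNr]; exact_mod_cast hi

/-- The cylinder of radius `r` on the parabolic cone with vertex `y`, spatial slope `v` and
temporal opening `g`. -/
noncomputable def cone (p : ℝ) (y : SpaceTime n) (v : EuclideanSpace ℝ (Fin n)) (g r : ℝ) (hr : 0 < r) :
    Cylinder n :=
  ⟨(y.1 + r • v, y.2 + g * r ^ p), r, hr⟩

section Cone

variable {A : Param} {κ θ G : ℝ} {v : EuclideanSpace ℝ (Fin n)} {Ω : Set (SpaceTime n)}

/-- The equation for `G` says that the translates `P^+` and `Q^-` of consecutive cylinders have the
same center in time, at every scale. Only the spatial tolerance is used, for the slope of the cone.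
-/
theorem isLink_cone_shrink (hp : 1 ≤ p) (hκ : Slack n p A κ) (hθ : κ ≤ θ) (hθ1 : θ < 1)
    (hG : G * (1 - θ ^ p) = 3 * (1 + θ ^ p)) (hv : (1 - θ) * ‖v‖ ≤ 1 - κ) (y : SpaceTime n)
    {r r' : ℝ} (hr : 0 < r) (hr' : 0 < r') (h : r' = θ * r) :
    IsLink p A (cone p y v (-G) r hr) (cone p y v (-G) r' hr') := by
  have h0 := hκ.pos
  have hθ0 : 0 < θ := h0.trans_le hθ
  subst h
  have hrp : 0 < r ^ p := Real.rpow_pos_of_pos hr p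
  refine isLink_of_near hp hκ (m := r) le_rfl ?_ ?_ ?_ ?_ ?_ (Or.inl rfl) <;> simp only [cone]
  · nlinarith
  · nlinarith
  · gcongr
  · have : y.1 + (θ * r) • v - (y.1 + r • v) = (-((1 - θ) * r)) • v := by module
    rw [this, norm_smul, norm_neg, Real.norm_of_nonneg (by nlinarith)]
    nlinarith
  · rw [Real.mul_rpow hθ0.le hr.le]
    have : y.2 + -G * (θ ^ p * r ^ p) - (y.2 + -G * r ^ p) - 3 * (r ^ p + θ ^ p * r ^ p) = 0 := by
      linear_combination r ^ p * hG
    rw [this, abs_zero]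
    have := hκ.lt_one
    nlinarith

theorem isLink_cone_grow (hp : 1 ≤ p) (hκ : Slack n p A κ) (hθ : κ ≤ θ) (hθ1 : θ < 1)
    (hG : G * (1 - θ ^ p) = 3 * (1 + θ ^ p)) (hv : (1 - θ) * ‖v‖ ≤ 1 - κ) (y : SpaceTime n)
    {r r' : ℝ} (hr : 0 < r) (hr' : 0 < r') (h : r = θ * r') :
    IsLink p A (cone p y v G r hr) (cone p y v G r' hr') := by
  have h0 := hκ.pos
  have hθ0 : 0 < θ := h0.trans_le hθ
  subst h
  have hrp : 0 < r' ^ p := Real.rpow_pos_of_pos hr' p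
  refine isLink_of_near hp hκ (m := r') ?_ le_rfl ?_ ?_ ?_ ?_ (Or.inr rfl) <;> simp only [cone]
  · nlinarith
  · gcongr
  · nlinarith
  · have : y.1 + r' • v - (y.1 + (θ * r') • v) = ((1 - θ) * r') • v := by module
    rw [this, norm_smul, Real.norm_of_nonneg (by nlinarith)]
    nlinarith
  · rw [Real.mul_rpow hθ0.le hr'.le]
    have : y.2 + G * r' ^ p - (y.2 + G * (θ ^ p * r' ^ p)) - 3 * (θ ^ p * r' ^ p + r' ^ p) = 0 := by
      linear_combination r' ^ p * hG
    rw [this, abs_zero]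
    have := hκ.lt_one
    nlinarith

theorem fitDist_shrink (hp : 1 ≤ p) (hκ : Slack n p A κ) (hθ : κ ≤ θ) (hθ1 : θ < 1)
    (hG : G * (1 - θ ^ p) = 3 * (1 + θ ^ p)) (hv : (1 - θ) * ‖v‖ ≤ 1 - κ) (y : SpaceTime n)
    (R : Cylinder n) {r r' : ℝ} (hr : 0 < r) (hr' : 0 < r') (m : ℕ) (h : r' = θ ^ m * r)
    (hfit : ∀ s (hs : 0 < s), s ≤ r → Fits p Ω A (cone p y v (-G) s hs)) :
    fitDist p Ω A R (cone p y v (-G) r' hr') ≤ fitDist p Ω A R (cone p y v (-G) r hr) + m := by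
  have hθ0 : 0 < θ := hκ.pos.trans_le hθ
  have key := fitDist_le_add_nat (p := p) (Ω := Ω) (A := A) (R := R)
    (fun i => cone p y v (-G) (θ ^ i * r) (by positivity)) m
    (fun i _ => isLink_cone_shrink hp hκ hθ hθ1 hG hv y _ _ (by ring))
    (fun i _ => hfit _ _ (mul_le_of_le_one_left hr.le (pow_le_one₀ hθ0.le hθ1.le)))
  simpa [h] using key

theorem fitDist_grow (hp : 1 ≤ p) (hκ : Slack n p A κ) (hθ : κ ≤ θ) (hθ1 : θ < 1)
    (hG : G * (1 - θ ^ p) = 3 * (1 + θ ^ p)) (hv : (1 - θ) * ‖v‖ ≤ 1 - κ) (y : SpaceTime n)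
    (R : Cylinder n) {r r' : ℝ} (hr : 0 < r) (hr' : 0 < r') (m : ℕ) (h : r = θ ^ m * r')
    (hfit : ∀ s (hs : 0 < s), s ≤ r' → Fits p Ω A (cone p y v G s hs)) :
    fitDist p Ω A R (cone p y v G r' hr') ≤ fitDist p Ω A R (cone p y v G r hr) + m := by
  have hθ0 : 0 < θ := hκ.pos.trans_le hθ
  have key := fitDist_le_add_nat (p := p) (Ω := Ω) (A := A) (R := R)
    (fun i => cone p y v G (θ ^ (m - i) * r') (by positivity)) m
    (fun i hi => isLink_cone_grow hp hκ hθ hθ1 hG hv y _ _ (by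
      rw [show m - i = (m - (i + 1)) + 1 by omega]; ring))
    (fun i _ => hfit _ _ (mul_le_of_le_one_left hr'.le (pow_le_one₀ hθ0.le hθ1.le)))
  simpa [h] using key

end Cone

/-- Geometric constants: `κ` is the tolerance of the links, cylinders grow and shrink by the
factor `θ` along cones of temporal opening `G`, they are small with respect to their
surroundings by the factor `c`, and they may be adjusted inside their dilate by `Λ`, at the cost
of the factor `κ ^ J`. -/
structure Scales (n : ℕ) (p : ℝ) (A : Param) (κ H θ G c Λ : ℝ) (J : ℕ) : Prop where
  one_lt : 1 < p
  slack : Slack n p A κ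
  H_eq : H * (1 - κ ^ p) = 3 * (1 + κ ^ p)
  H_nonneg : 0 ≤ H
  le_θ : κ ≤ θ
  θ_lt_one : θ < 1
  θ_slope : (1 - θ) * A.A₃ ≤ 1 - κ
  G_eq : G * (1 - θ ^ p) = 3 * (1 + θ ^ p)
  H_add_le : H + 3 ≤ G
  A₃_le_G : 4 * A.A₃ ^ p ≤ G
  c_pos : 0 < c
  c_space : A.A₃ * c ≤ 1 / 2
  c_time : (2 * G + 8 * A.A₃ ^ p) * c ^ p ≤ 1
  c_fine : 36 * c ^ p ≤ 1 - κ
  c_speed : 12 * c ^ (p - 1) ≤ 1 - κ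
  le_Λ : 2 * (A.A₃ + 2) ≤ Λ
  le_Λ' : 2 * (G + 2 + 4 * A.A₃ ^ p) ≤ Λ
  σ_le : 16 * κ ^ J ≤ c
  σ_fine : 36 * (κ ^ J) ^ p ≤ 1 - κ
  σ_speed : 6 * (A.A₃ + 2) * (κ ^ J) ^ (p - 1) ≤ 1 - κ
  σ_time : G * (κ ^ J) ^ p ≤ 1

/-- The lower bound shows that the opening tends to infinity as `θ → 1`; the fine cone can thus be
made wider than any prescribed constant. -/
theorem exists_opening (hp : 0 < p) {θ : ℝ} (h0 : 0 < θ) (h1 : θ < 1) :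
    ∃ G, G * (1 - θ ^ p) = 3 * (1 + θ ^ p) ∧ 3 / (1 - θ ^ p) ≤ G := by
  have h2 : θ ^ p < 1 := Real.rpow_lt_one h0.le h1 hp
  have h3 : 0 < θ ^ p := Real.rpow_pos_of_pos h0 p
  refine ⟨3 * (1 + θ ^ p) / (1 - θ ^ p), div_mul_cancel₀ _ (by linarith), ?_⟩
  have : 0 < 1 - θ ^ p := by linarith
  gcongr
  linarith

theorem tendsto_const_mul_rpow_zero (a : ℝ) {q : ℝ} (hq : 0 < q) :
    Filter.Tendsto (fun c : ℝ => a * c ^ q) (nhds 0) (nhds 0) := by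
  have := (Real.continuousAt_rpow_const (0 : ℝ) q (Or.inr hq.le)).tendsto.const_mul a
  simpa [Real.zero_rpow hq.ne'] using this

/-- The constants are chosen in succession: the opening `H` of the coarse ratio `κ`; then `θ` so
close to `1` that steep slopes are allowed and `G` dominates `H` and `A₃^p`; then `c` small; then
`Λ`; finally `J` so large that `κ^J` is small relative to `c`. The speed conditions need `p > 1`, so
that `c^(p-1)` tends to zero with `c`. -/
theorem Slack.exists_scales (hp : 1 < p) {A : Param} {κ : ℝ} (hκ : Slack n p A κ) :
    ∃ H θ G c Λ J, Scales n p A κ H θ G c Λ J := by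
  have hp0 : 0 < p := by linarith
  have h0 := hκ.pos
  have h1 := hκ.lt_one
  have hA3 := A.two_le_A₃
  have hA3p := one_le_rpow_A₃ hp0.le A
  obtain ⟨H, hH, hH'⟩ := exists_opening hp0 h0 h1
  have hH0 : 0 ≤ H := le_trans (div_nonneg (by norm_num)
    (by linarith [Real.rpow_lt_one h0.le h1 hp0])) hH'
  obtain ⟨θ, hθ1, hθ2, hθ3, hθ4⟩ : ∃ θ, κ ≤ θ ∧ θ < 1 ∧ (1 - θ) * A.A₃ ≤ 1 - κ ∧
      (H + 3 + 4 * A.A₃ ^ p) * (1 - θ ^ p) ≤ 3 := by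
    have t1 : Filter.Tendsto (fun θ : ℝ => (1 - θ) * A.A₃) (nhds 1) (nhds 0) := by
      have : Continuous fun θ : ℝ => (1 - θ) * A.A₃ := by fun_prop
      simpa using this.tendsto 1
    have t2 : Filter.Tendsto (fun θ : ℝ => (H + 3 + 4 * A.A₃ ^ p) * (1 - θ ^ p)) (nhds 1)
        (nhds 0) := by
      have := ((Real.continuousAt_rpow_const (1 : ℝ) p (Or.inr hp0.le)).tendsto.const_sub
        1).const_mul (H + 3 + 4 * A.A₃ ^ p)
      simpa using this
    have e1 := (t1.eventually (gt_mem_nhds (show (0 : ℝ) < 1 - κ by linarith))).filter_mono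
      (nhdsWithin_le_nhds (s := Iio 1))
    have e2 := (t2.eventually (gt_mem_nhds (show (0 : ℝ) < 3 by norm_num))).filter_mono
      (nhdsWithin_le_nhds (s := Iio 1))
    have e3 : ∀ᶠ θ : ℝ in nhdsWithin 1 (Iio 1), θ ∈ Ioo κ 1 := Ioo_mem_nhdsLT h1
    obtain ⟨θ, ⟨a, b⟩, d⟩ := ((e1.and e2).and e3).exists
    exact ⟨θ, d.1.le, d.2, a.le, b.le⟩
  obtain ⟨G, hG, hG'⟩ := exists_opening hp0 (h0.trans_le hθ1) hθ2
  have hθp : 0 < 1 - θ ^ p := by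
    linarith [Real.rpow_lt_one (h0.trans_le hθ1).le hθ2 hp0]
  have hG2 : H + 3 + 4 * A.A₃ ^ p ≤ G := by
    refine le_trans ?_ hG'
    rwa [le_div_iff₀ hθp]
  have small : ∀ a q b : ℝ, 0 < q → 0 < b → ∀ᶠ c : ℝ in nhds 0, a * c ^ q < b := fun a q b hq hb =>
    (tendsto_const_mul_rpow_zero a hq).eventually (gt_mem_nhds hb)
  have hk : 0 < 1 - κ := by linarith
  obtain ⟨c, ⟨⟨⟨c1, c2⟩, c3⟩, c4⟩, c5⟩ := ((((small A.A₃ 1 (1 / 2) one_pos (by norm_num)).and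
    (small (2 * G + 8 * A.A₃ ^ p) p 1 hp0 one_pos)).and (small 36 p _ hp0 hk)).and
    (small 12 (p - 1) _ (by linarith) hk)).filter_mono (nhdsWithin_le_nhds (s := Ioi 0)) |>.and
      (self_mem_nhdsWithin (a := (0 : ℝ)) (s := Ioi 0)) |>.exists
  have tJ : Filter.Tendsto (fun J : ℕ => κ ^ J) Filter.atTop (nhds 0) :=
    tendsto_pow_atTop_nhds_zero_of_lt_one h0.le h1
  obtain ⟨J, ⟨⟨d1, d2⟩, d3⟩, d4⟩ := (tJ.eventually ((((small 16 1 c one_pos c5).and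
    (small 36 p _ hp0 hk)).and (small (6 * (A.A₃ + 2)) (p - 1) _ (by linarith) hk)).and
    (small G p 1 hp0 one_pos))).exists
  simp only [Real.rpow_one] at c1 d1
  exact ⟨H, θ, G, c, max (2 * (A.A₃ + 2)) (2 * (G + 2 + 4 * A.A₃ ^ p)), J, hp, hκ, hH, hH0, hθ1,
    hθ2, hθ3, hG, by linarith, by linarith, c5, c1.le, c2.le, c3.le, c4.le, le_max_left _ _,
    le_max_right _ _, d1.le, d2.le, d3.le, d4.le⟩

/-- A cylinder may be replaced by a smaller one in its future, at a bounded cost. -/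
theorem Scales.fitDist_adjust {A : Param} {κ H θ G c Λ : ℝ} {J : ℕ}
    (h : Scales n p A κ H θ G c Λ J) {Ω : Set (SpaceTime n)} (R Q : Cylinder n)
    (hQ : box Q.center (Λ * Q.radius) (Λ * Q.radius ^ p) ⊆ Ω) {c' : SpaceTime n}
    (hx : ‖c'.1 - Q.center.1‖ ≤ (A.A₃ + 2) * Q.radius)
    (ht : |c'.2 - Q.center.2 - G * Q.radius ^ p| ≤ 2 * Q.radius ^ p)
    {s : ℝ} (hs : 0 < s) (hsQ : s = κ ^ J * Q.radius) :
    fitDist p Ω A R ⟨c', s, hs⟩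
      ≤ fitDist p Ω A R Q + (J + ⌈(G + 2) / (6 * (κ ^ J) ^ p)⌉₊ : ℕ) := by
  obtain ⟨x, r, hr⟩ := Q
  simp only at *
  have hp := h.one_lt
  have hp0 : 0 < p := by linarith
  have h0 := h.slack.pos
  have h1 := h.slack.lt_one
  have hA3 := A.two_le_A₃
  have hA3p := one_le_rpow_A₃ hp0.le A
  set σ := κ ^ J with hσ
  have hσ0 : 0 < σ := by positivity
  have hrp : 0 < r ^ p := Real.rpow_pos_of_pos hr p
  have hσp : 0 < σ ^ p := Real.rpow_pos_of_pos hσ0 p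
  have hsp : s ^ p = σ ^ p * r ^ p := by rw [hsQ, Real.mul_rpow hσ0.le hr.le]
  have hHG := h.H_add_le
  have hH0 := h.H_nonneg
  have hσfine := h.σ_fine
  have hΛ1 := h.le_Λ
  have hΛ2 := h.le_Λ'
  have hσ1 : σ ≤ 1 := pow_le_one₀ h0.le h1.le
  have hσp1 : σ ^ p ≤ 1 := Real.rpow_le_one hσ0.le hσ1 hp0.le
  -- `Q` lies on the vertical cone of opening `H` whose vertex is `H r^p` above its center.
  -- Shrinking `J` times along it brings the radius to `s` and advances time by at most `H r^p`.
  have hcone : (⟨x, r, hr⟩ : Cylinder n) = cone p (x.1, x.2 + H * r ^ p) 0 (-H) r hr := by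
    simp [cone]
  have step1 := fitDist_shrink (v := 0) (Ω := Ω) hp.le h.slack le_rfl h1 h.H_eq (by simp [h1.le])
    (x.1, x.2 + H * r ^ p) R hr hs J hsQ (fun u hu hur => by
      have hup : 0 < u ^ p := Real.rpow_pos_of_pos hu p
      have hupr : u ^ p ≤ r ^ p := Real.rpow_le_rpow hu.le hur hp0.le
      rw [fits_iff hp0]
      refine Subset.trans (box_subset_box ?_ ?_) hQ
      · simp only [cone, smul_zero, add_zero, sub_self, norm_zero, zero_add]
        nlinarith
      · simp only [cone]
        have : x.2 + H * r ^ p + -H * u ^ p - x.2 = H * (r ^ p - u ^ p) := by ring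
        rw [this, abs_of_nonneg (mul_nonneg hH0 (by linarith))]
        nlinarith)
  rw [← hcone] at step1
  set b : SpaceTime n := (x.1, x.2 + H * r ^ p + -H * s ^ p) with hb
  have hbc : cone p (x.1, x.2 + H * r ^ p) 0 (-H) s hs = ⟨b, s, hs⟩ := by simp [cone, hb]
  rw [hbc] at step1
  have hb2 : b.2 = x.2 + H * (1 - σ ^ p) * r ^ p := by simp only [hb]; rw [hsp]; ring
  have hb3 : 0 ≤ H * (1 - σ ^ p) * r ^ p := by
    have : 0 ≤ 1 - σ ^ p := by linarith
    positivity
  have hb4 : H * (1 - σ ^ p) * r ^ p ≤ H * r ^ p := by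
    have : H * (1 - σ ^ p) ≤ H := by nlinarith
    gcongr
  rw [abs_le] at ht
  -- The target is at least `(G - 2) r^p` ahead of `Q`; by `H + 3 ≤ G` at least `r^p` of this
  -- remains for the travel at constant radius.
  have hT1 : r ^ p ≤ c'.2 - b.2 := by
    rw [hb2]
    have : (H + 3) * r ^ p ≤ G * r ^ p := by gcongr
    linarith
  have hT2 : c'.2 - b.2 ≤ (G + 2) * r ^ p := by rw [hb2]; linarith
  have step2 := fitDist_travel (Ω := Ω) hp.le h.slack R hs (c := b) (c' := c') (by
      rw [hsp]
      calc 36 * (σ ^ p * r ^ p) = (36 * σ ^ p) * r ^ p := by ring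
        _ ≤ (1 - κ) * (c'.2 - b.2) := by gcongr) (by
      have e : s ^ p = s ^ (p - 1) * s := by
        rw [← Real.rpow_add_one hs.ne']; congr 1; ring
      rw [e, ← mul_assoc]
      refine mul_le_mul_of_nonneg_right ?_ hs.le
      have e2 : s ^ (p - 1) = σ ^ (p - 1) * r ^ (p - 1) := by
        rw [hsQ, Real.mul_rpow hσ0.le hr.le]
      have e3 : r ^ (p - 1) * r = r ^ p := by
        rw [← Real.rpow_add_one hr.ne']; congr 1; ring
      have hr1 : 0 < r ^ (p - 1) := Real.rpow_pos_of_pos hr _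
      have hσ1 : 0 < σ ^ (p - 1) := Real.rpow_pos_of_pos hσ0 _
      calc 6 * ‖c'.1 - b.1‖ * s ^ (p - 1) ≤ 6 * ((A.A₃ + 2) * r) * s ^ (p - 1) := by
            rw [e2]; gcongr
        _ = (6 * (A.A₃ + 2) * σ ^ (p - 1)) * (r ^ (p - 1) * r) := by rw [e2]; ring
        _ ≤ (1 - κ) * (c'.2 - b.2) := by
            rw [e3]; gcongr
            exact h.σ_speed) (fun y hy => by
      have hseg := segment_near (X := x) (a := (A.A₃ + 2) * r) (b := (G + 2) * r ^ p) hy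
        (by simp only [hb, sub_self, norm_zero]; positivity) hx
        (by rw [hb2, add_sub_cancel_left, abs_of_nonneg hb3]; nlinarith)
        (by
          have : (H + 3) * r ^ p ≤ G * r ^ p := by gcongr
          have : 0 ≤ H * r ^ p := by positivity
          rw [abs_le]; constructor <;> linarith)
      refine Subset.trans (box_subset_box (c := x) ?_ ?_) hQ
      · have : s ≤ r := by rw [hsQ]; nlinarith
        nlinarith [hseg.1]
      · have : s ^ p ≤ r ^ p := by rw [hsp]; nlinarith
        have : A.A₃ ^ p * s ^ p ≤ A.A₃ ^ p * r ^ p := by gcongr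
        have : (2 * (G + 2 + 4 * A.A₃ ^ p)) * r ^ p ≤ Λ * r ^ p := by gcongr
        nlinarith [hseg.2])
  refine step2.trans ?_
  push_cast
  rw [← add_assoc]
  refine add_le_add step1 ?_
  norm_cast
  refine Nat.ceil_le_ceil ?_
  rw [hsp]
  calc (c'.2 - b.2) / (6 * (σ ^ p * r ^ p)) ≤ ((G + 2) * r ^ p) / (6 * (σ ^ p * r ^ p)) := by
        gcongr
    _ = _ := by field_simp

end FIT

/-! ### From chains with an arbitrary parameter to chains of tiny cylinders with the parameter `A`.
-/

namespace FIT

variable {n : ℕ} {p : ℝ} {A : Param} {Ω : Set (SpaceTime n)} {R : Cylinder n}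

/-- Arbitrarily small cylinders whose positive translate is centered at `w` are reached by chains
from `R`. -/
def Accessible (p : ℝ) (Ω : Set (SpaceTime n)) (A : Param) (R : Cylinder n)
    (w : SpaceTime n) : Prop :=
  ∀ ρ > 0, ∃ (r : ℝ) (hr : 0 < r), r < ρ ∧
    fitDist p Ω A R ⟨(w.1, w.2 - 3 * r ^ p), r, hr⟩ < ∞

/-- Every point of `U` lies in the positive translate of arbitrarily small cylinders that are
reached by chains from `R`. -/
def Reaches (p : ℝ) (Ω : Set (SpaceTime n)) (A : Param) (R : Cylinder n)
    (U : Set (SpaceTime n)) : Prop :=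
  ∀ z ∈ U, ∀ ρ : ℝ, 0 < ρ → ∃ Q : Cylinder n,
    Q.radius < ρ ∧ z ∈ (Q.lag p 3).toSet p ∧ fitDist p Ω A R Q < ∞

theorem Accessible.exists_cylinder (hp : 0 < p) {z : SpaceTime n} (h : Accessible p Ω A R z)
    {ρ : ℝ} (hρ : 0 < ρ) :
    ∃ Q : Cylinder n, Q.radius < ρ ∧ z ∈ (Q.lag p 3).toSet p ∧ fitDist p Ω A R Q < ∞ := by
  obtain ⟨r, hr, hrρ, hk⟩ := h ρ hρ
  refine ⟨_, hrρ, ?_, hk⟩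
  rw [Cylinder.lag_toSet_eq hp, mem_box]
  simp [hr, Real.rpow_pos_of_pos hr p]

theorem eventually_const_mul_rpow_lt (a : ℝ) {q b : ℝ} (hq : 0 < q) (hb : 0 < b) :
    ∀ᶠ c : ℝ in nhds 0, a * c ^ q < b :=
  (tendsto_const_mul_rpow_zero a hq).eventually (gt_mem_nhds hb)

theorem exists_pos_of_eventually {P : ℝ → Prop} (h : ∀ᶠ c : ℝ in nhds 0, P c) :
    ∃ ρ > 0, ∀ r, 0 < r → r < ρ → P r := by
  obtain ⟨ρ, hρ, h⟩ := Metric.eventually_nhds_iff.1 h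
  exact ⟨ρ, hρ, fun r h1 h2 => h (by simpa [abs_of_pos h1] using h2)⟩

theorem rpow_eq_rpow_sub_one_mul {r : ℝ} (hr : 0 < r) (p : ℝ) : r ^ p = r ^ (p - 1) * r := by
  rw [← Real.rpow_add_one hr.ne']; congr 1; ring

/-- Cylinders of a small fixed radius `r` travel along the segment inside a neighborhood of it. Any
forward slope is admissible: the speed condition has the form `C r^(p-1) < (1 - κ) T`, and `p > 1`.
-/
theorem Accessible.of_segment (hp : 1 < p) {κ : ℝ} (hκ : Slack n p A κ) (hΩ : IsOpen Ω)
    {w w' : SpaceTime n} (h : Accessible p Ω A R w) (hseg : segment ℝ w w' ⊆ Ω)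
    (ht : w.2 < w'.2) : Accessible p Ω A R w' := by
  have hp0 : 0 < p := by linarith
  have hκ1 := hκ.lt_one
  have hcomp : IsCompact (segment ℝ w w') := by
    rw [segment_eq_image']
    exact isCompact_Icc.image (by fun_prop)
  obtain ⟨δ, hδ, hδΩ⟩ := hcomp.exists_thickening_subset_open hΩ hseg
  have hT : 0 < (1 - κ) * (w'.2 - w.2) := mul_pos (by linarith) (by linarith)
  obtain ⟨ρ₀, hρ₀, hsmall⟩ := exists_pos_of_eventually
    (((eventually_const_mul_rpow_lt A.A₃ one_pos hδ).and
    (eventually_const_mul_rpow_lt (4 * A.A₃ ^ p + 3) hp0 hδ)).and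
    ((eventually_const_mul_rpow_lt 36 hp0 hT).and
    (eventually_const_mul_rpow_lt (6 * ‖w'.1 - w.1‖) (sub_pos.2 hp) hT)))
  intro ρ hρ
  obtain ⟨r, hr, hrρ, hk⟩ := h (min ρ ρ₀) (lt_min hρ hρ₀)
  obtain ⟨⟨e1, e2⟩, e3, e4⟩ := hsmall r hr (hrρ.trans_le (min_le_right _ _))
  rw [Real.rpow_one] at e1
  have hrp := Real.rpow_pos_of_pos hr p
  refine ⟨r, hr, hrρ.trans_le (min_le_left _ _), ?_⟩
  refine (fitDist_travel hp.le hκ R hr (c := (w.1, w.2 - 3 * r ^ p))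
    (c' := (w'.1, w'.2 - 3 * r ^ p)) ?_ ?_ ?_).trans_lt
      (ENNReal.add_lt_top.2 ⟨hk, ENNReal.natCast_lt_top _⟩)
  · simp only [sub_sub_sub_cancel_right]; exact e3.le
  · simp only [sub_sub_sub_cancel_right]
    rw [rpow_eq_rpow_sub_one_mul hr p, ← mul_assoc]
    exact mul_le_mul_of_nonneg_right e4.le hr.le
  · intro y hy
    refine Subset.trans ?_ hδΩ
    intro z hz
    rw [mem_box] at hz
    rw [segment_eq_image'] at hy
    obtain ⟨u, hu, rfl⟩ := hy
    refine Metric.mem_thickening_iff.2 ⟨w + u • (w' - w), ?_, ?_⟩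
    · rw [segment_eq_image']; exact ⟨u, hu, rfl⟩
    · simp only [Prod.fst_add, Prod.snd_add, Prod.smul_fst, Prod.smul_snd, Prod.fst_sub,
        Prod.snd_sub, sub_sub_sub_cancel_right, smul_eq_mul] at hz
      rw [Prod.dist_eq, max_lt_iff, dist_eq_norm, Real.dist_eq]
      simp only [Prod.fst_add, Prod.snd_add, Prod.smul_fst, Prod.smul_snd, Prod.fst_sub,
        Prod.snd_sub, smul_eq_mul]
      refine ⟨hz.1.trans e1, ?_⟩
      have h1 := abs_lt.1 hz.2
      rw [abs_lt]
      constructor <;> nlinarith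

/-- The overlap has positive volume, as the union does. -/
theorem IsLink.exists_mem (hp : 0 < p) {P Q : Cylinder n} (h : IsLink p A P Q) :
    ∃ u, u ∈ (P.lag p 3).toSet p ∧ u ∈ (Q.lag p (-3)).toSet p := by
  by_contra hcon
  push Not at hcon
  have hemp : (P.lag p 3).toSet p ∩ (Q.lag p (-3)).toSet p = ∅ :=
    eq_empty_of_forall_notMem fun u hu => hcon u hu.1 hu.2
  have h3 := h.2.2
  rw [hemp, measureReal_empty, Cylinder.toSet_eq hp, Cylinder.toSet_eq hp] at h3
  have hQp := Real.rpow_pos_of_pos Q.radius_pos p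
  have hPp := Real.rpow_pos_of_pos P.radius_pos p
  have hA2 : 0 < A.A₂ := two_pos.trans_le A.two_le_A₂
  have h4 : volume.real (box Q.center Q.radius (Q.radius ^ p)) ≤
      volume.real (box Q.center Q.radius (Q.radius ^ p) ∪
        box P.center P.radius (P.radius ^ p)) := by
    refine measureReal_mono subset_union_left (measure_union_lt_top ?_ ?_).ne
    · rw [volume_box _ _ Q.radius_pos]; exact ENNReal.ofReal_lt_top
    · rw [volume_box _ _ P.radius_pos]; exact ENNReal.ofReal_lt_top
  rw [volumeReal_box _ Q.radius_pos hQp.le] at h4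
  have h5 : 0 < Q.radius ^ n * unitVol n * (2 * Q.radius ^ p) := by
    have := unitVol_pos n
    have := Q.radius_pos
    positivity
  have h6 : 0 < 1 / A.A₂ * volume.real (box Q.center Q.radius (Q.radius ^ p) ∪
        box P.center P.radius (P.radius ^ p)) := by
    have := h5.trans_le h4
    positivity
  linarith

theorem Cylinder.convex_hull (P : Cylinder n) (a : ℝ) : Convex ℝ (P.hull p a) :=
  convex_convexHull ℝ _

/-- The chain with parameter `A'` is used only as a corridor in `Ω`. Inside a hull, which is convex,
accessibility passes along a segment to every point of `P^+`. A point of `P^+ ∩ Q^-` then lies in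
the next hull, below its upper part, and the argument repeats. -/
theorem Accessible.of_chain (hp : 1 < p) {κ : ℝ} (hκ : Slack n p A κ) (hΩ : IsOpen Ω)
    {A' : Param} {Q : Cylinder n} (C : List (Cylinder n)) (P : Cylinder n)
    (hC : (P :: C).IsChain (IsLink p A')) (hQ : (P :: C).getLast? = some Q)
    (hfit : ∀ S ∈ P :: C, Fits p Ω A' S) {w : SpaceTime n} (hw : w ∈ P.hull p 3)
    (hwt : w.2 < P.center.2 + 2 * P.radius ^ p) (hacc : Accessible p Ω A R w)
    {z : SpaceTime n} (hz : z ∈ (Q.lag p 3).toSet p) : Accessible p Ω A R z := by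
  have hp0 : 0 < p := by linarith
  have move : ∀ {P : Cylinder n} {w u : SpaceTime n}, Fits p Ω A' P → w ∈ P.hull p 3 →
      w.2 < P.center.2 + 2 * P.radius ^ p → Accessible p Ω A R w →
      u ∈ (P.lag p 3).toSet p → Accessible p Ω A R u := by
    intro P w u hfit hw hwt hacc hu
    have hu' := P.lag_toSet_subset_hull hp0 (by norm_num) hu
    refine hacc.of_segment hp hκ hΩ
      (((P.convex_hull 3).segment_subset hw hu').trans (hfit.hull_subset hp0)) ?_
    rw [Cylinder.lag_toSet_eq hp0, mem_box] at hu
    have := (abs_lt.1 hu.2).1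
    simp only at this
    linarith
  induction C generalizing P w with
  | nil =>
    simp only [List.getLast?_singleton, Option.some.injEq] at hQ
    subst hQ
    exact move (hfit P (by simp)) hw hwt hacc hz
  | cons P' C ih =>
    rw [List.isChain_cons_cons] at hC
    obtain ⟨u, hu, hu'⟩ := hC.1.exists_mem hp0
    have hau := move (hfit P (by simp)) hw hwt hacc hu
    refine ih P' hC.2 (by simpa using hQ) (fun S hS => hfit S (List.mem_cons_of_mem _ hS))
      (P'.lag_toSet_subset_hull hp0 (by norm_num) hu') ?_ hau
    rw [Cylinder.lag_toSet_eq hp0, mem_box] at hu'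
    have := (abs_lt.1 hu'.2).2
    simp only at this
    have := Real.rpow_pos_of_pos P'.radius_pos p
    linarith

/-- A concentric small cylinder reaches the later points near the center of `R`. -/
theorem accessible_of_dilate (hp : 1 < p) {κ : ℝ} (hκ : Slack n p A κ) {H : ℝ} (hH0 : 0 ≤ H)
    (hH : H * (1 - κ ^ p) = 3 * (1 + κ ^ p)) {l : ℝ} (hl : 0 < l) (hl1 : A.A₃ * l ≤ 1)
    (hl2 : (H + 4 * A.A₃ ^ p) * l ^ p ≤ 1 / 2) (hfit : R.hull p 3 ⊆ Ω) :
    Accessible p Ω A (R.dilate l hl) (R.center.1, R.center.2 + R.radius ^ p) := by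
  have hp0 : 0 < p := by linarith
  have h0 := hκ.pos
  have h1 := hκ.lt_one
  obtain ⟨x, r, hr⟩ := R
  rw [Cylinder.hull_eq hp0] at hfit
  simp only [Cylinder.dilate] at *
  have hrp := Real.rpow_pos_of_pos hr p
  have hlp := Real.rpow_pos_of_pos hl p
  have hA3p := one_le_rpow_A₃ hp0.le A
  have hA3 := A.two_le_A₃
  set R' : Cylinder n := ⟨x, l * r, mul_pos hl hr⟩
  have hR' : R' = cone p (x.1, x.2 + H * (l * r) ^ p) 0 (-H) (l * r) (mul_pos hl hr) := by
    simp [R', cone]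
  have hlr : (l * r) ^ p = l ^ p * r ^ p := Real.mul_rpow hl.le hr.le
  have hHl : H * l ^ p ≤ 1 / 2 := by nlinarith
  have hAl : 4 * A.A₃ ^ p * l ^ p ≤ 1 / 2 := by nlinarith
  have hfits : ∀ s (hs : 0 < s), s ≤ l * r →
      Fits p Ω A (cone p (x.1, x.2 + H * (l * r) ^ p) 0 (-H) s hs) := by
    intro s hs hsl
    have hsp := Real.rpow_pos_of_pos hs p
    have hsp' : s ^ p ≤ l ^ p * r ^ p := by rw [← hlr]; exact Real.rpow_le_rpow hs.le hsl hp0.le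
    rw [fits_iff hp0]
    refine Subset.trans (box_subset_box ?_ ?_) hfit
    · simp only [cone, smul_zero, add_zero, sub_self, norm_zero, zero_add]
      nlinarith
    · simp only [cone]
      have : x.2 + H * (l * r) ^ p + -H * s ^ p - x.2 = H * (l ^ p * r ^ p - s ^ p) := by
        rw [hlr]; ring
      rw [this, abs_of_nonneg (mul_nonneg hH0 (by linarith))]
      have e1 : H * (l ^ p * r ^ p - s ^ p) ≤ H * l ^ p * r ^ p := by nlinarith
      have e2 : 4 * (A.A₃ ^ p * s ^ p) ≤ 4 * A.A₃ ^ p * l ^ p * r ^ p := by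
        calc 4 * (A.A₃ ^ p * s ^ p) ≤ 4 * (A.A₃ ^ p * (l ^ p * r ^ p)) := by gcongr
          _ = _ := by ring
      nlinarith
  have hbase : fitDist p Ω A R' R' ≤ 1 := by
    refine fitDist_self_le ?_
    have := hfits _ (mul_pos hl hr) le_rfl
    rwa [← hR'] at this
  intro ρ hρ
  -- The shrinking cylinders stay in the lower half of the hull of the large cylinder up to time
  -- `x.2 + r^p / 2`, so at least `r^p / 4` of time is left to travel to the target, once `12 s^p <
  -- r^p`.
  obtain ⟨ρ₀, hρ₀, hsmall⟩ := exists_pos_of_eventually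
    ((eventually_const_mul_rpow_lt 12 hp0 hrp).and
    (eventually_const_mul_rpow_lt 36 hp0 (mul_pos (sub_pos.2 h1) (half_pos (half_pos hrp)))))
  obtain ⟨J, hJ⟩ := ((tendsto_pow_atTop_nhds_zero_of_lt_one h0.le h1).mul_const
    (l * r)).eventually (gt_mem_nhds (by rw [zero_mul]; exact lt_min hρ hρ₀)) |>.exists
  have hs : 0 < κ ^ J * (l * r) := by positivity
  set s := κ ^ J * (l * r) with hsdef
  have hslr : s ≤ l * r := mul_le_of_le_one_left (by positivity) (pow_le_one₀ h0.le h1.le)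
  have hsp := Real.rpow_pos_of_pos hs p
  have hsp' : s ^ p ≤ l ^ p * r ^ p := by rw [← hlr]; exact Real.rpow_le_rpow hs.le hslr hp0.le
  obtain ⟨e1, e2⟩ := hsmall s hs (hJ.trans_le (min_le_right _ _))
  have step1 := fitDist_shrink (v := 0) (Ω := Ω) hp.le hκ le_rfl h1 hH (by simp [h1.le])
    (x.1, x.2 + H * (l * r) ^ p) R' (mul_pos hl hr) hs J hsdef hfits
  rw [← hR'] at step1
  set b : SpaceTime n := (x.1, x.2 + H * (l * r) ^ p + -H * s ^ p) with hb
  have hbc : cone p (x.1, x.2 + H * (l * r) ^ p) 0 (-H) s hs = ⟨b, s, hs⟩ := by simp [cone, hb]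
  rw [hbc] at step1
  have hb2 : b.2 = x.2 + H * (l ^ p * r ^ p - s ^ p) := by simp only [hb]; rw [hlr]; ring
  have hb3 : 0 ≤ H * (l ^ p * r ^ p - s ^ p) := mul_nonneg hH0 (by linarith)
  have hb4 : H * (l ^ p * r ^ p - s ^ p) ≤ 1 / 2 * r ^ p := by nlinarith
  have hT : r ^ p / 2 / 2 ≤ x.2 + r ^ p - 3 * s ^ p - b.2 := by rw [hb2]; linarith
  refine ⟨s, hs, hJ.trans_le (min_le_left _ _), ?_⟩
  refine (fitDist_travel hp.le hκ R' hs (c := b) (c' := (x.1, x.2 + r ^ p - 3 * s ^ p))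
    ?_ ?_ ?_).trans_lt (ENNReal.add_lt_top.2 ⟨step1.trans_lt (ENNReal.add_lt_top.2
      ⟨hbase.trans_lt ENNReal.one_lt_top, ENNReal.natCast_lt_top _⟩), ENNReal.natCast_lt_top _⟩)
  · simp only
    exact e2.le.trans (mul_le_mul_of_nonneg_left hT (by linarith))
  · simp only [hb, sub_self, norm_zero, mul_zero, zero_mul]
    rw [← hb] at *
    refine mul_nonneg (mul_nonneg (by linarith) ?_) hs.le
    have : x.2 + H * (l * r) ^ p + -H * s ^ p = b.2 := rfl
    rw [this]; linarith
  · intro y hy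
    have hseg := segment_near (X := x) (a := 0) (b := r ^ p) hy (by simp [hb]) (by simp)
      (by rw [hb2, add_sub_cancel_left, abs_of_nonneg hb3]; linarith)
      (by rw [abs_le]; simp only; constructor <;> linarith)
    refine Subset.trans (box_subset_box (c := x) ?_ ?_) hfit
    · nlinarith [hseg.1]
    · have : 4 * (A.A₃ ^ p * s ^ p) ≤ 4 * A.A₃ ^ p * l ^ p * r ^ p := by
        calc 4 * (A.A₃ ^ p * s ^ p) ≤ 4 * (A.A₃ ^ p * (l ^ p * r ^ p)) := by gcongr
          _ = _ := by ring
      nlinarith [hseg.2]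

theorem exists_chain_of_fitDist_lt_top {A' : Param} {Q : Cylinder n}
    (h : fitDist p Ω A' R Q < ∞) : ∃ C, (R :: C).IsChain (IsLink p A') ∧
      (R :: C).getLast? = some Q ∧ ∀ S ∈ R :: C, Fits p Ω A' S := by
  rw [fitDist, iInf_lt_iff] at h
  obtain ⟨C, h⟩ := h
  rw [iInf_lt_iff] at h
  obtain ⟨⟨h1, h2, h3, h4⟩, -⟩ := h
  cases C with
  | nil => simp at h2
  | cons P C =>
    simp only [List.head?_cons, Option.some.injEq] at h2
    subst h2
    exact ⟨C, h1, h3, h4⟩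

/-- The first cylinder of any chain has its hull in `Ω`. This gives room to start from a small
concentric cylinder, after which the corridor of the chain is followed. -/
theorem reaches_of_isConnectedWith (hp : 1 < p) {κ : ℝ} (hκ : Slack n p A κ) {H : ℝ}
    (hH0 : 0 ≤ H) (hH : H * (1 - κ ^ p) = 3 * (1 + κ ^ p)) {l : ℝ} (hl : 0 < l)
    (hl1 : A.A₃ * l ≤ 1) (hl2 : (H + 4 * A.A₃ ^ p) * l ^ p ≤ 1 / 2) (hΩ : IsOpen Ω) {t : ℝ}
    (hconn : IsConnectedWith p Ω t R) : Reaches p Ω A (R.dilate l hl) (future Ω t) := by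
  have hp0 : 0 < p := by linarith
  intro z hz ρ hρ
  obtain ⟨Q, A', -, hzQ, -, hk⟩ := hconn.2 z hz
  obtain ⟨C, hC, hQ, hfit⟩ := exists_chain_of_fitDist_lt_top hk
  have hR := (hfit R (by simp)).hull_subset hp0
  have hacc := accessible_of_dilate hp hκ hH0 hH hl hl1 hl2 hR
  have hrp := Real.rpow_pos_of_pos R.radius_pos p
  refine (hacc.of_chain hp hκ hΩ C R hC hQ hfit ?_ ?_ hzQ).exists_cylinder hp0 hρ
  · rw [Cylinder.hull_eq hp0, mem_box]
    simp only [sub_self, norm_zero, add_sub_cancel_left, abs_of_pos hrp]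
    exact ⟨R.radius_pos, by linarith⟩
  · simp only; linarith

end FIT

/-! ### Continuing a chain through a hull: adjustment, cones and crossing. -/

namespace FIT

variable {n : ℕ} {p : ℝ} {A : Param} {Ω U : Set (SpaceTime n)} {R : Cylinder n}
  {κ H θ G c Λ : ℝ} {J : ℕ}

/-- The point `z` lies above the cylinder `Q`, at a distance comparable to its radius, and a large
dilate of `Q` lies in `U`. -/
def Above (p : ℝ) (A : Param) (G Λ : ℝ) (U : Set (SpaceTime n)) (Q : Cylinder n)
    (z : SpaceTime n) : Prop :=
  ‖z.1 - Q.center.1‖ < (A.A₃ + 1) * Q.radius ∧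
  |z.2 - Q.center.2 - G * Q.radius ^ p| < Q.radius ^ p ∧
  box Q.center (Λ * Q.radius) (Λ * Q.radius ^ p) ⊆ U

theorem natCast_le_of_le_pow (hθ0 : 0 < θ) (hθ1 : θ < 1) {x : ℝ} (hx : 0 < x) {m : ℕ}
    (h : x ≤ θ ^ m) : (m : ℝ) ≤ (-Real.log θ)⁻¹ * (-Real.log x) := by
  have h1 := Real.log_le_log hx h
  rw [Real.log_pow] at h1
  have h2 := Real.log_neg hθ0 hθ1
  rw [inv_mul_eq_div, le_div_iff₀ (by linarith)]
  linarith

/-- The points of a cylinder move towards its center along the cones of spatial opening `A₃`. -/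
theorem norm_cone_sub_le {x y : EuclideanSpace ℝ (Fin n)} {r s a : ℝ} (hr : 0 < r)
    (h : ‖y - x‖ ≤ r) (hsr : a * s ≤ r) :
    ‖y + s • (a / r) • (x - y) - x‖ ≤ (1 - a * s / r) * ‖y - x‖ ∧
      ‖y + s • (a / r) • (x - y) - x‖ + a * s ≤ r := by
  have h1 : y + s • (a / r) • (x - y) - x = (1 - a * s / r) • (y - x) := by
    rw [show a * s / r = s * (a / r) by ring]; module
  have h2 : 0 ≤ 1 - a * s / r := by
    rw [sub_nonneg, div_le_one hr]; exact hsr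
  rw [h1, norm_smul, Real.norm_of_nonneg h2]
  refine ⟨le_rfl, ?_⟩
  have h3 : (1 - a * s / r) * ‖y - x‖ ≤ (1 - a * s / r) * r := by gcongr
  have h4 : (1 - a * s / r) * r = r - a * s := by field_simp
  linarith

theorem norm_slope_le {x y : EuclideanSpace ℝ (Fin n)} {r a : ℝ} (hr : 0 < r) (ha : 0 ≤ a)
    (h : ‖y - x‖ ≤ r) : ‖(a / r) • (x - y)‖ ≤ a := by
  rw [norm_smul, Real.norm_of_nonneg (by positivity), norm_sub_rev, div_mul_eq_mul_div,
    div_le_iff₀ hr]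
  gcongr

/-- The logarithm of the relative distance from a point of `P^+` to the boundary of the hull. -/
noncomputable def logDepth (p : ℝ) (P : Cylinder n) (z : SpaceTime n) : ℝ :=
  -Real.log (1 - ‖z.1 - P.center.1‖ / P.radius)
    - Real.log ((4 - (z.2 - P.center.2) / P.radius ^ p) / 2)

/-- The number of links between large cylinders of a hull. -/
noncomputable def crossing (p θ c : ℝ) : ℕ := ⌈8 / (6 * (θ * c) ^ p)⌉₊

/-- The number of links in an adjustment. -/
noncomputable def adjusting (p κ G : ℝ) (J : ℕ) : ℕ := J + ⌈(G + 2) / (6 * (κ ^ J) ^ p)⌉₊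

/-- The constant in the comparison of the lengths of chains to the two halves of a hull. -/
noncomputable def comparing (p κ θ G c Λ : ℝ) (J : ℕ) : ℝ :=
  adjusting p κ G J + crossing p θ c + 1 + (-Real.log θ)⁻¹ *
    (-Real.log (κ ^ J) + Real.log c + (Real.log c - Real.log (θ * c / Λ))
      - Real.log (θ * (θ * c / Λ)))

theorem mem_lag_pos (hp : 0 < p) {P : Cylinder n} {z : SpaceTime n} :
    z ∈ (P.lag p 3).toSet p ↔ ‖z.1 - P.center.1‖ < P.radius ∧
      P.center.2 + 2 * P.radius ^ p < z.2 ∧ z.2 < P.center.2 + 4 * P.radius ^ p := by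
  rw [Cylinder.lag_toSet_eq hp, mem_box, abs_lt]
  simp only
  refine and_congr_right fun _ => ⟨fun h => ⟨by linarith, by linarith⟩,
    fun h => ⟨by linarith, by linarith⟩⟩

theorem mem_lag_neg (hp : 0 < p) {P : Cylinder n} {z : SpaceTime n} :
    z ∈ (P.lag p (-3)).toSet p ↔ ‖z.1 - P.center.1‖ < P.radius ∧
      P.center.2 - 4 * P.radius ^ p < z.2 ∧ z.2 < P.center.2 - 2 * P.radius ^ p := by
  rw [Cylinder.lag_toSet_eq hp, mem_box, abs_lt]
  simp only
  refine and_congr_right fun _ => ⟨fun h => ⟨by linarith, by linarith⟩,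
    fun h => ⟨by linarith, by linarith⟩⟩

namespace Scales

variable (h : Scales n p A κ H θ G c Λ J)
include h

theorem p_pos : 0 < p := by linarith [h.one_lt]

theorem θ_pos : 0 < θ := h.slack.pos.trans_le h.le_θ

theorem G_ge : 3 ≤ G := by linarith [h.H_add_le, h.H_nonneg]

theorem eight_le_Λ : 8 ≤ Λ := by linarith [h.le_Λ, A.two_le_A₃]

theorem c_le : c ≤ 1 / 4 := by nlinarith [h.c_space, A.two_le_A₃, h.c_pos]

theorem σ_pos : 0 < κ ^ J := pow_pos h.slack.pos J

theorem σ_rpow_le : (κ ^ J) ^ p ≤ κ ^ J := by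
  simpa using Real.rpow_le_rpow_of_exponent_ge h.σ_pos (by linarith [h.σ_le, h.c_le])
    h.one_lt.le

theorem inv_log_pos : 0 < (-Real.log θ)⁻¹ := by
  have := Real.log_neg h.θ_pos h.θ_lt_one
  exact inv_pos.2 (by linarith)

theorem slope {x y : EuclideanSpace ℝ (Fin n)} {r : ℝ} (hr : 0 < r) (hxy : ‖y - x‖ ≤ r) :
    (1 - θ) * ‖(A.A₃ / r) • (x - y)‖ ≤ 1 - κ := by
  have := norm_slope_le hr A.A₃_pos.le hxy
  refine le_trans ?_ h.θ_slope
  have := h.θ_lt_one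
  gcongr

/-- A cylinder that is large with respect to a hull which it lies below. -/
theorem exists_above_of_large (R : Cylinder n) (hUΩ : U ⊆ Ω) {P Q : Cylinder n}
    {w z : SpaceTime n} (hw : w ∈ (P.lag p (-3)).toSet p) (hz : z ∈ (P.lag p 3).toSet p)
    (hQ : Above p A G Λ U Q w) (hlarge : c * P.radius < κ ^ J * Q.radius) :
    ∃ Q' : Cylinder n, Above p A G Λ U Q' z ∧ Q'.radius = κ ^ J * Q.radius ∧
      fitDist p Ω A R Q' ≤ fitDist p Ω A R Q + (adjusting p κ G J : ℕ) := by
  have hp0 := h.p_pos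
  obtain ⟨x, r, hr⟩ := P
  obtain ⟨y, q, hq⟩ := Q
  obtain ⟨hQ1, hQ2, hQ3⟩ := hQ
  rw [mem_lag_pos hp0] at hz
  rw [mem_lag_neg hp0] at hw
  simp only at *
  have hqp := Real.rpow_pos_of_pos hq p
  have hrp := Real.rpow_pos_of_pos hr p
  have hσ0 := h.σ_pos
  have hc := h.c_pos
  have hs : 0 < κ ^ J * q := by positivity
  have hσle := h.σ_le
  have hσp := h.σ_rpow_le
  have hσt := h.σ_time
  have hG := h.G_ge
  have hcle := h.c_le
  have hΛ1 := h.le_Λ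
  have hΛ2 := h.le_Λ'
  have hA3 := A.two_le_A₃
  have hA3p := one_le_rpow_A₃ hp0.le A
  have hσp0 := Real.rpow_pos_of_pos hσ0 p
  have hsp : (κ ^ J * q) ^ p = (κ ^ J) ^ p * q ^ p := Real.mul_rpow hσ0.le hq.le
  -- Combine `c r < κ^J q` with `16 κ^J ≤ c`. As `P` is much smaller than `Q`, the points `w` and
  -- `z` are nearly the same at the scale of `Q`, and one adjustment suffices.
  have hrq : 16 * r ≤ q := by
    have : c * (16 * r) ≤ c * q := by nlinarith
    exact le_of_mul_le_mul_left this hc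
  have hrqp : 16 * r ^ p ≤ q ^ p := by
    have h1 := Real.rpow_le_rpow (by positivity) hrq hp0.le
    rw [Real.mul_rpow (by norm_num) hr.le] at h1
    have h2 : (16 : ℝ) ≤ 16 ^ p := by
      simpa using Real.rpow_le_rpow_of_exponent_le (x := 16) (by norm_num) h.one_lt.le
    nlinarith
  have hx1 : ‖z.1 - y.1‖ ≤ (A.A₃ + 2) * q := by
    have e1 := norm_sub_le_norm_sub_add_norm_sub z.1 x.1 y.1
    have e2 := norm_sub_le_norm_sub_add_norm_sub x.1 w.1 y.1
    rw [norm_sub_rev x.1 w.1] at e2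
    linarith
  rw [abs_lt] at hQ2
  have hGs : G * (κ ^ J * q) ^ p ≤ q ^ p := by rw [hsp]; nlinarith
  have hGs0 : 0 ≤ G * (κ ^ J * q) ^ p := by rw [hsp]; positivity
  refine ⟨⟨(z.1, z.2 - G * (κ ^ J * q) ^ p), κ ^ J * q, hs⟩, ⟨?_, ?_, ?_⟩, rfl, ?_⟩
  · simp only [sub_self, norm_zero]; positivity
  · simp only [sub_sub_cancel, sub_self, abs_zero]; rw [hsp]; positivity
  · refine Subset.trans (box_subset_box ?_ ?_) hQ3
    · simp only
      have : Λ * (κ ^ J * q) ≤ Λ * (q / 2) := by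
        refine mul_le_mul_of_nonneg_left ?_ (by linarith)
        nlinarith
      nlinarith
    · simp only
      have e : Λ * (κ ^ J * q) ^ p ≤ Λ * (q ^ p / 2) := by
        refine mul_le_mul_of_nonneg_left ?_ (by linarith)
        rw [hsp]; nlinarith
      have e2 : |z.2 - G * (κ ^ J * q) ^ p - y.2| ≤ (G + 2) * q ^ p := by
        have : 0 ≤ G * q ^ p := by positivity
        rw [abs_le]; constructor <;> linarith
      have : 2 * (G + 2 + 4 * A.A₃ ^ p) * q ^ p ≤ Λ * q ^ p := by gcongr
      nlinarith
  · refine h.fitDist_adjust R ⟨y, q, hq⟩ (hQ3.trans hUΩ)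
      (c' := (z.1, z.2 - G * (κ ^ J * q) ^ p)) hx1 ?_ hs rfl
    simp only
    rw [abs_le]; constructor <;> linarith

/-- A chain below a hull is continued to the lower cone of the hull. -/
theorem fitDist_cone_le (R : Cylinder n) (hUΩ : U ⊆ Ω) {P Q : Cylinder n}
    {w : SpaceTime n} (hw : w ∈ (P.lag p (-3)).toSet p) (hQ : Above p A G Λ U Q w) {s : ℝ}
    (hs : 0 < s) (hsQ : s = κ ^ J * Q.radius) :
    fitDist p Ω A R (cone p w ((A.A₃ / P.radius) • (P.center.1 - w.1)) G s hs)
      ≤ fitDist p Ω A R Q + (adjusting p κ G J : ℕ) := by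
  have hp0 := h.p_pos
  obtain ⟨x, r, hr⟩ := P
  obtain ⟨y, q, hq⟩ := Q
  obtain ⟨hQ1, hQ2, hQ3⟩ := hQ
  rw [mem_lag_neg hp0] at hw
  simp only at *
  have hqp := Real.rpow_pos_of_pos hq p
  have hσ0 := h.σ_pos
  have hσp0 := Real.rpow_pos_of_pos hσ0 p
  have hsp : s ^ p = (κ ^ J) ^ p * q ^ p := by rw [hsQ]; exact Real.mul_rpow hσ0.le hq.le
  have hσt := h.σ_time
  have hG := h.G_ge
  refine h.fitDist_adjust R ⟨y, q, hq⟩ (hQ3.trans hUΩ) ?_ ?_ hs hsQ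
  · simp only
    have e1 : w.1 + s • (A.A₃ / r) • (x.1 - w.1) - y.1
      = s • (A.A₃ / r) • (x.1 - w.1) + (w.1 - y.1) := by abel
    have e2 : ‖s • (A.A₃ / r) • (x.1 - w.1)‖ ≤ q := by
      rw [norm_smul, Real.norm_of_nonneg hs.le]
      calc s * ‖(A.A₃ / r) • (x.1 - w.1)‖ ≤ s * A.A₃ := by
            gcongr; exact norm_slope_le hr A.A₃_pos.le hw.1.le
        _ = (A.A₃ * κ ^ J) * q := by rw [hsQ]; ring
        _ ≤ 1 * q := by
            gcongr
            have := h.c_space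
            have : A.A₃ * (16 * κ ^ J) ≤ A.A₃ * c := by
              have := A.A₃_pos
              gcongr; exact h.σ_le
            have : 0 < A.A₃ * κ ^ J := mul_pos A.A₃_pos hσ0
            linarith
        _ = q := one_mul q
    rw [e1]
    refine (norm_add_le _ _).trans ?_
    linarith
  · simp only
    have e1 : G * s ^ p ≤ q ^ p := by rw [hsp]; nlinarith
    have e2 : 0 ≤ G * s ^ p := by rw [hsp]; positivity
    rw [abs_lt] at hQ2
    rw [abs_le]; constructor <;> linarith

theorem rpow_le_of_le {s r : ℝ} (hs : 0 < s) (hr : 0 < r) (hsr : s ≤ c * r) :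
    (2 * G + 8 * A.A₃ ^ p) * s ^ p ≤ r ^ p := by
  have h1 := Real.rpow_le_rpow hs.le hsr h.p_pos.le
  rw [Real.mul_rpow h.c_pos.le hr.le] at h1
  have h2 := one_le_rpow_A₃ h.p_pos.le A
  have h3 := h.G_ge
  have h4 := Real.rpow_pos_of_pos hr p
  calc (2 * G + 8 * A.A₃ ^ p) * s ^ p ≤ (2 * G + 8 * A.A₃ ^ p) * (c ^ p * r ^ p) := by gcongr
    _ = ((2 * G + 8 * A.A₃ ^ p) * c ^ p) * r ^ p := by ring
    _ ≤ 1 * r ^ p := by gcongr; exact h.c_time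
    _ = r ^ p := one_mul _

/-- The slope points to the axis of `P` with speed `A₃ / r`, so at radius `s` the distance to the
lateral boundary is at least `A₃ s`. The bound `4 A₃^p ≤ G` keeps the dilated hull from passing
below the vertex `w`. The cone below `z` is the mirror image. -/
theorem fits_cone_up {P : Cylinder n} (hP : P.hull p 3 ⊆ Ω) {w : SpaceTime n}
    (hw : w ∈ (P.lag p (-3)).toSet p) {s : ℝ} (hs : 0 < s) (hsr : s ≤ c * P.radius) :
    ‖(cone p w ((A.A₃ / P.radius) • (P.center.1 - w.1)) G s hs).center.1 - P.center.1‖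
        ≤ P.radius - A.A₃ * s ∧
    |(cone p w ((A.A₃ / P.radius) • (P.center.1 - w.1)) G s hs).center.2 - P.center.2|
        ≤ 4 * P.radius ^ p - 4 * (A.A₃ ^ p * s ^ p) ∧
    Fits p Ω A (cone p w ((A.A₃ / P.radius) • (P.center.1 - w.1)) G s hs) := by
  have hp0 := h.p_pos
  rw [mem_lag_neg hp0] at hw
  have hr := P.radius_pos
  have hsp := Real.rpow_pos_of_pos hs p
  have hA3p := one_le_rpow_A₃ hp0.le A
  have h1 := h.rpow_le_of_le hs hr hsr
  have h2 : A.A₃ * s ≤ P.radius := by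
    have := h.c_space
    have : A.A₃ * s ≤ A.A₃ * (c * P.radius) := by
      have := A.A₃_pos
      gcongr
    nlinarith
  have h3 := (norm_cone_sub_le hr hw.1.le h2).2
  have h4 : |w.2 + G * s ^ p - P.center.2| ≤ 4 * P.radius ^ p - 4 * (A.A₃ ^ p * s ^ p) := by
    have := mul_le_mul_of_nonneg_right h.A₃_le_G hsp.le
    have : 0 < A.A₃ ^ p * s ^ p := by positivity
    have := h.G_ge
    have : 0 < G * s ^ p := by positivity
    rw [abs_le]; constructor <;> nlinarith
  refine ⟨by simp only [cone]; linarith, by simp only [cone]; exact h4, ?_⟩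
  rw [fits_iff hp0]
  rw [Cylinder.hull_eq hp0] at hP
  exact (box_subset_box (by simpa only [cone] using h3) (by simp only [cone]; linarith)).trans hP

theorem fits_cone_down {P : Cylinder n} (hP : P.hull p 3 ⊆ Ω) {z : SpaceTime n}
    (hz : z ∈ (P.lag p 3).toSet p) {s : ℝ} (hs : 0 < s) (hsr : s ≤ c * P.radius) :
    ‖(cone p z ((A.A₃ / P.radius) • (P.center.1 - z.1)) (-G) s hs).center.1 - P.center.1‖
        ≤ P.radius - A.A₃ * s ∧
    |(cone p z ((A.A₃ / P.radius) • (P.center.1 - z.1)) (-G) s hs).center.2 - P.center.2|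
        ≤ 4 * P.radius ^ p - 4 * (A.A₃ ^ p * s ^ p) ∧
    Fits p Ω A (cone p z ((A.A₃ / P.radius) • (P.center.1 - z.1)) (-G) s hs) := by
  have hp0 := h.p_pos
  rw [mem_lag_pos hp0] at hz
  have hr := P.radius_pos
  have hsp := Real.rpow_pos_of_pos hs p
  have hA3p := one_le_rpow_A₃ hp0.le A
  have h1 := h.rpow_le_of_le hs hr hsr
  have h2 : A.A₃ * s ≤ P.radius := by
    have := h.c_space
    have : A.A₃ * s ≤ A.A₃ * (c * P.radius) := by
      have := A.A₃_pos
      gcongr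
    nlinarith
  have h3 := (norm_cone_sub_le hr hz.1.le h2).2
  have h4 : |z.2 + -G * s ^ p - P.center.2| ≤ 4 * P.radius ^ p - 4 * (A.A₃ ^ p * s ^ p) := by
    have := mul_le_mul_of_nonneg_right h.A₃_le_G hsp.le
    have : 0 < A.A₃ ^ p * s ^ p := by positivity
    have := h.G_ge
    have : 0 < G * s ^ p := by positivity
    rw [abs_le]; constructor <;> nlinarith
  refine ⟨by simp only [cone]; linarith, by simp only [cone]; exact h4, ?_⟩
  rw [fits_iff hp0]
  rw [Cylinder.hull_eq hp0] at hP
  exact (box_subset_box (by simpa only [cone] using h3) (by simp only [cone]; linarith)).trans hP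

/-- Crossing a hull by cylinders of comparable radius. -/
theorem fitDist_cross (R : Cylinder n) {P : Cylinder n} (hP : P.hull p 3 ⊆ Ω)
    {w z : SpaceTime n} (hw : w ∈ (P.lag p (-3)).toSet p) (hz : z ∈ (P.lag p 3).toSet p) {s : ℝ}
    (hs : 0 < s) (hsr : s ≤ c * P.radius) (hsr' : θ * c * P.radius ≤ s) :
    fitDist p Ω A R (cone p z ((A.A₃ / P.radius) • (P.center.1 - z.1)) (-G) s hs)
      ≤ fitDist p Ω A R (cone p w ((A.A₃ / P.radius) • (P.center.1 - w.1)) G s hs)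
        + (crossing p θ c : ℕ) := by
  have hp0 := h.p_pos
  obtain ⟨u1, u2, -⟩ := h.fits_cone_up hP hw hs hsr
  obtain ⟨d1, d2, -⟩ := h.fits_cone_down hP hz hs hsr
  rw [mem_lag_neg hp0] at hw
  rw [mem_lag_pos hp0] at hz
  have hr := P.radius_pos
  have hrp := Real.rpow_pos_of_pos hr p
  have hsp := Real.rpow_pos_of_pos hs p
  have hA3p := one_le_rpow_A₃ hp0.le A
  have hA3 := A.A₃_pos
  have hG := h.G_ge
  have hc := h.c_pos
  have hθ := h.θ_pos
  have h1 := h.rpow_le_of_le hs hr hsr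
  have h1' : 2 * G * s ^ p ≤ P.radius ^ p := by
    have : 0 < 8 * A.A₃ ^ p * s ^ p := by positivity
    nlinarith
  have hκ1 := h.slack.lt_one
  rw [Cylinder.hull_eq hp0] at hP
  simp only [cone] at u1 u2 d1 d2
  have hGs : 0 < G * s ^ p := by positivity
  refine (fitDist_travel (Ω := Ω) h.one_lt.le h.slack R hs
    (c := (w.1 + s • (A.A₃ / P.radius) • (P.center.1 - w.1), w.2 + G * s ^ p))
    (c' := (z.1 + s • (A.A₃ / P.radius) • (P.center.1 - z.1), z.2 + -G * s ^ p))
    ?_ ?_ ?_).trans ?_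
  · simp only
    have h2 := Real.rpow_le_rpow hs.le hsr hp0.le
    rw [Real.mul_rpow hc.le hr.le] at h2
    calc 36 * s ^ p ≤ (36 * c ^ p) * P.radius ^ p := by linarith
      _ ≤ (1 - κ) * P.radius ^ p := by gcongr; exact h.c_fine
      _ ≤ _ := by
        refine mul_le_mul_of_nonneg_left ?_ (by linarith)
        linarith
  · simp only
    rw [rpow_eq_rpow_sub_one_mul hs p, ← mul_assoc]
    refine mul_le_mul_of_nonneg_right ?_ hs.le
    have h2 := Real.rpow_le_rpow hs.le hsr (sub_pos.2 h.one_lt).le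
    rw [Real.mul_rpow hc.le hr.le] at h2
    have h3 := norm_sub_le_norm_sub_add_norm_sub
      (z.1 + s • (A.A₃ / P.radius) • (P.center.1 - z.1)) P.center.1
      (w.1 + s • (A.A₃ / P.radius) • (P.center.1 - w.1))
    rw [norm_sub_rev P.center.1] at h3
    have h4 : 0 < A.A₃ * s := by positivity
    have hr1 := Real.rpow_pos_of_pos hr (p - 1)
    have hc1 := Real.rpow_pos_of_pos hc (p - 1)
    rw [← rpow_eq_rpow_sub_one_mul hs p]
    calc _ ≤ 6 * (2 * P.radius) * (c ^ (p - 1) * P.radius ^ (p - 1)) := by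
          gcongr
          linarith
      _ = (12 * c ^ (p - 1)) * (P.radius ^ (p - 1) * P.radius) := by ring
      _ ≤ (1 - κ) * P.radius ^ p := by
          rw [← rpow_eq_rpow_sub_one_mul hr p]; gcongr; exact h.c_speed
      _ ≤ _ := by
        refine mul_le_mul_of_nonneg_left ?_ (by linarith)
        linarith
  · intro y hy
    -- The hull of `P` is a box: since the dilated hulls at both ends of the segment fit into it, so
    -- do all those in between.
    have := segment_near (X := P.center) hy u1 d1 u2 d2
    refine (box_subset_box ?_ ?_).trans hP <;> linarith
  · refine add_le_add le_rfl ?_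
    norm_cast
    refine Nat.ceil_le_ceil ?_
    simp only
    have h2 := Real.rpow_le_rpow (by positivity) hsr' hp0.le
    rw [Real.mul_rpow (by positivity) hr.le] at h2
    have h3 : 0 < (θ * c) ^ p := by positivity
    rw [div_le_div_iff₀ (by positivity) (by positivity)]
    have : z.2 + -G * s ^ p - (w.2 + G * s ^ p) ≤ 8 * P.radius ^ p := by linarith
    calc _ ≤ 8 * P.radius ^ p * (6 * (θ * c) ^ p) := by gcongr
      _ = 8 * (6 * ((θ * c) ^ p * P.radius ^ p)) := by ring
      _ ≤ _ := by gcongr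

end Scales

end FIT

/-! ### Comparison of penalized lengths on the two halves of a hull. -/

namespace FIT

variable {n : ℕ} {p : ℝ} {A : Param} {Ω U : Set (SpaceTime n)} {R : Cylinder n}
  {κ H θ G c Λ : ℝ} {J : ℕ}

theorem depth_pos {P : Cylinder n} (hp : 0 < p) {z : SpaceTime n}
    (hz : z ∈ (P.lag p 3).toSet p) :
    (0 < 1 - ‖z.1 - P.center.1‖ / P.radius ∧ 1 - ‖z.1 - P.center.1‖ / P.radius ≤ 1) ∧
    0 < (4 - (z.2 - P.center.2) / P.radius ^ p) / 2 ∧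
      (4 - (z.2 - P.center.2) / P.radius ^ p) / 2 < 1 := by
  rw [mem_lag_pos hp] at hz
  have hr := P.radius_pos
  have hrp := Real.rpow_pos_of_pos hr p
  refine ⟨⟨?_, ?_⟩, ?_, ?_⟩
  · rw [sub_pos, div_lt_one hr]; exact hz.1
  · rw [sub_le_self_iff]; positivity
  · have : (z.2 - P.center.2) / P.radius ^ p < 4 := by rw [div_lt_iff₀ hrp]; linarith
    linarith
  · have : 2 < (z.2 - P.center.2) / P.radius ^ p := by rw [lt_div_iff₀ hrp]; linarith
    linarith

theorem logDepth_nonneg {P : Cylinder n} (hp : 0 < p) {z : SpaceTime n}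
    (hz : z ∈ (P.lag p 3).toSet p) : 0 ≤ logDepth p P z := by
  obtain ⟨⟨h1, h2⟩, h3, h4⟩ := depth_pos hp hz
  have := Real.log_nonpos h1.le h2
  have := Real.log_nonpos h3.le h4.le
  rw [logDepth]; linarith

namespace Scales

variable (h : Scales n p A κ H θ G c Λ J)
include h

/-- Here `a` and `b` are the relative spatial and temporal depths of `z` in `P^+`. A radius below a
multiple of `r a b` keeps the `Λ`-dilate inside the hull in both directions; in time, `(b / Λ)^p ≤ b
/ Λ` suffices. -/
theorem above_cone_down {P : Cylinder n} (hP : P.hull p 3 ⊆ U) {z : SpaceTime n}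
    (hz : z ∈ (P.lag p 3).toSet p) {s : ℝ} (hs : 0 < s)
    (hsr : s ≤ θ * c / Λ * (P.radius * ((1 - ‖z.1 - P.center.1‖ / P.radius) *
      ((4 - (z.2 - P.center.2) / P.radius ^ p) / 2)))) :
    Above p A G Λ U (cone p z ((A.A₃ / P.radius) • (P.center.1 - z.1)) (-G) s hs) z := by
  have hp0 := h.p_pos
  have hr := P.radius_pos
  have hrp := Real.rpow_pos_of_pos hr p
  have hsp := Real.rpow_pos_of_pos hs p
  obtain ⟨⟨ha0, ha1⟩, hb0, hb1⟩ := depth_pos hp0 hz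
  set a := 1 - ‖z.1 - P.center.1‖ / P.radius with ha
  set b := (4 - (z.2 - P.center.2) / P.radius ^ p) / 2 with hb
  rw [mem_lag_pos hp0] at hz
  have hΛ := h.eight_le_Λ
  have hc := h.c_pos
  have hcle := h.c_le
  have hθ := h.θ_pos
  have hθ1 := h.θ_lt_one
  have hG := h.G_ge
  have hA3 := A.two_le_A₃
  have hA3p := one_le_rpow_A₃ hp0.le A
  have hθc : θ * c ≤ c := by nlinarith
  have hab : a * b ≤ 1 := by nlinarith
  have hΛs : Λ * s ≤ θ * c * (P.radius * (a * b)) := by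
    calc Λ * s ≤ Λ * (θ * c / Λ * (P.radius * (a * b))) := by gcongr
      _ = _ := by field_simp
  have hsc : s ≤ c * P.radius := by
    calc s ≤ θ * c / Λ * (P.radius * (a * b)) := hsr
      _ ≤ c / 1 * (P.radius * 1) := by gcongr; linarith
      _ = c * P.radius := by ring
  have hΛsa : Λ * s ≤ P.radius * a := by
    calc Λ * s ≤ θ * c * (P.radius * (a * b)) := hΛs
      _ ≤ 1 * (P.radius * (a * 1)) := by gcongr; linarith
      _ = _ := by ring
  have hxa : ‖z.1 - P.center.1‖ = P.radius - P.radius * a := by rw [ha]; field_simp; ring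
  have htb : z.2 - P.center.2 = 4 * P.radius ^ p - 2 * b * P.radius ^ p := by
    rw [hb]; field_simp; ring
  have hsb : Λ * s ^ p ≤ b * P.radius ^ p := by
    have e0 : s ≤ (b / Λ) * P.radius := by
      calc s ≤ θ * c / Λ * (P.radius * (a * b)) := hsr
        _ ≤ 1 / Λ * (P.radius * (1 * b)) := by gcongr; linarith
        _ = _ := by ring
    have e1 := Real.rpow_le_rpow hs.le e0 hp0.le
    rw [Real.mul_rpow (by positivity) hr.le] at e1
    have e2 : (b / Λ) ^ p ≤ b / Λ := by
      have : b / Λ ≤ 1 := by rw [div_le_one (by linarith)]; linarith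
      simpa using Real.rpow_le_rpow_of_exponent_ge (by positivity) this h.one_lt.le
    calc Λ * s ^ p ≤ Λ * (b / Λ * P.radius ^ p) := by
          gcongr; exact e1.trans (by gcongr)
      _ = _ := by field_simp
  have h1 := h.rpow_le_of_le hs hr hsc
  have hGs : 0 < G * s ^ p := by positivity
  have h1' : 2 * G * s ^ p ≤ P.radius ^ p := by
    have : 0 < 8 * A.A₃ ^ p * s ^ p := by positivity
    nlinarith
  have h2 : A.A₃ * s ≤ P.radius := by
    have := h.c_space
    have : A.A₃ * s ≤ A.A₃ * (c * P.radius) := by gcongr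
    nlinarith
  rw [Cylinder.hull_eq hp0] at hP
  refine ⟨?_, ?_, ?_⟩ <;> simp only [cone]
  · rw [sub_add_cancel_left, norm_neg, norm_smul, Real.norm_of_nonneg hs.le]
    have := norm_slope_le hr A.A₃_pos.le hz.1.le
    nlinarith
  · have : z.2 - (z.2 + -G * s ^ p) - G * s ^ p = 0 := by ring
    rw [this, abs_zero]; exact hsp
  · refine (box_subset_box ?_ ?_).trans hP
    · have e1 := (norm_cone_sub_le hr hz.1.le h2).1
      have e2 : (1 - A.A₃ * s / P.radius) * ‖z.1 - P.center.1‖ ≤ 1 * ‖z.1 - P.center.1‖ := by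
        gcongr
        rw [sub_le_self_iff]; positivity
      simp only
      linarith
    · have : b * P.radius ^ p ≤ 1 * P.radius ^ p := by gcongr
      have : |z.2 + -G * s ^ p - P.center.2| ≤ 4 * P.radius ^ p - b * P.radius ^ p := by
        have : 0 < b * P.radius ^ p := by positivity
        rw [abs_le]; constructor <;> linarith
      linarith

/-- A cylinder that is small with respect to a hull which it lies below. -/
theorem exists_above_of_small (R : Cylinder n) (hUΩ : U ⊆ Ω) {P Q : Cylinder n}
    (hP : P.hull p 3 ⊆ U) {w z : SpaceTime n} (hw : w ∈ (P.lag p (-3)).toSet p)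
    (hz : z ∈ (P.lag p 3).toSet p) (hQ : Above p A G Λ U Q w)
    (hsmall : κ ^ J * Q.radius ≤ c * P.radius) :
    ∃ (Q' : Cylinder n) (N : ℕ), Above p A G Λ U Q' z ∧
      fitDist p Ω A R Q' ≤ fitDist p Ω A R Q + N ∧ ∀ ρ : ℝ, 0 < ρ →
      N + (-Real.log θ)⁻¹ * Real.log (ρ / Q'.radius) ≤ (-Real.log θ)⁻¹ * Real.log (ρ / Q.radius)
        + comparing p κ θ G c Λ J + 2 * (-Real.log θ)⁻¹ * logDepth p P z := by
  have hp0 := h.p_pos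
  have hr := P.radius_pos
  have hq := Q.radius_pos
  have hθ := h.θ_pos
  have hθ1 := h.θ_lt_one
  have hc := h.c_pos
  have hΛ := h.eight_le_Λ
  have hσ0 := h.σ_pos
  have hB := h.inv_log_pos
  obtain ⟨⟨ha0, ha1⟩, hb0, hb1⟩ := depth_pos hp0 hz
  have hs0 : 0 < κ ^ J * Q.radius := by positivity
  have hcr : 0 < c * P.radius := by positivity
  -- `m` is such that `m` growth steps bring the radius from `κ^J q` into `[θ c r, c r]`, the range
  -- in which the hull can be crossed.
  obtain ⟨m, hm1, hm2⟩ := exists_nat_pow_near_of_lt_one (div_pos hs0 hcr)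
    ((div_le_one hcr).2 hsmall) hθ hθ1
  have hmB := natCast_le_of_le_pow hθ hθ1 (div_pos hs0 hcr) hm2
  have hs1 : 0 < κ ^ J * Q.radius / θ ^ m := by positivity
  rw [div_le_iff₀ hcr] at hm2
  rw [lt_div_iff₀ hcr] at hm1
  set s₁ := κ ^ J * Q.radius / θ ^ m with hs₁
  have hs1c : s₁ ≤ c * P.radius := by rw [hs₁, div_le_iff₀ (by positivity)]; linarith
  have hs1c' : θ * c * P.radius ≤ s₁ := by
    rw [hs₁, le_div_iff₀ (by positivity)]; rw [pow_succ] at hm1; linarith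
  have hab : (1 - ‖z.1 - P.center.1‖ / P.radius) *
      ((4 - (z.2 - P.center.2) / P.radius ^ p) / 2) ≤ 1 := by nlinarith
  set τ := θ * c / Λ * (P.radius * ((1 - ‖z.1 - P.center.1‖ / P.radius) *
      ((4 - (z.2 - P.center.2) / P.radius ^ p) / 2))) with hτ
  have hτ0 : 0 < τ := by positivity
  have hτs : τ ≤ s₁ := by
    refine le_trans ?_ hs1c'
    calc τ ≤ θ * c / 1 * (P.radius * 1) := by rw [hτ]; gcongr; linarith
      _ = _ := by ring
  -- The choice satisfies `θ^(k+1) s₁ < τ ≤ θ^k s₁`, hence `k + 1` shrinking steps are taken: the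
  -- final radius is below `τ` but at least `θ τ`.
  obtain ⟨k, hk1, hk2⟩ := exists_nat_pow_near_of_lt_one (div_pos hτ0 hs1)
    ((div_le_one hs1).2 hτs) hθ hθ1
  have hkB := natCast_le_of_le_pow hθ hθ1 (div_pos hτ0 hs1) hk2
  rw [div_le_iff₀ hs1] at hk2
  rw [lt_div_iff₀ hs1] at hk1
  have hs2 : 0 < θ ^ (k + 1) * s₁ := by positivity
  have hs2τ : θ * τ ≤ θ ^ (k + 1) * s₁ := by rw [pow_succ]; nlinarith
  have step1 := h.fitDist_cone_le R hUΩ hw hQ hs0 rfl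
  have hwP := (mem_lag_neg hp0).1 hw
  have hzP := (mem_lag_pos hp0).1 hz
  have step2 := fitDist_grow (Ω := Ω) h.one_lt.le h.slack h.le_θ hθ1 h.G_eq
    (h.slope hr hwP.1.le) w R hs0 hs1 m (by rw [hs₁]; field_simp)
    (fun s hs hss => (h.fits_cone_up (hP.trans hUΩ) hw hs (hss.trans hs1c)).2.2)
  have step3 := h.fitDist_cross R (hP.trans hUΩ) hw hz hs1 hs1c hs1c'
  have step4 := fitDist_shrink (Ω := Ω) h.one_lt.le h.slack h.le_θ hθ1 h.G_eq
    (h.slope hr hzP.1.le) z R hs1 hs2 (k + 1) rfl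
    (fun s hs hss => (h.fits_cone_down (hP.trans hUΩ) hz hs (hss.trans hs1c)).2.2)
  refine ⟨_, adjusting p κ G J + m + crossing p θ c + (k + 1),
    h.above_cone_down hP hz hs2 hk1.le, ?_, ?_⟩
  · refine step4.trans ?_
    push_cast
    rw [← add_assoc (fitDist p Ω A R Q), ← add_assoc (fitDist p Ω A R Q),
      ← add_assoc (fitDist p Ω A R Q)]
    gcongr
    refine step3.trans ?_
    gcongr
    refine step2.trans ?_
    gcongr
  -- Up to constants, growth costs `B log (r/q)`, shrinking costs `B log (r/τ)` and the new penalty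
  -- is `B log (ρ/τ)`. The sum is `B log (ρ/q) + 2 B log (r/τ)`, where `log (r/τ)` is the
  -- logarithmic depth plus a constant.
  · intro ρ hρ
    simp only [cone]
    have l1 : Real.log (κ ^ J * Q.radius / (c * P.radius))
        = Real.log (κ ^ J) + Real.log Q.radius - (Real.log c + Real.log P.radius) := by
      rw [Real.log_div hs0.ne' hcr.ne', Real.log_mul hσ0.ne' hq.ne', Real.log_mul hc.ne' hr.ne']
    have l2 : Real.log τ = Real.log (θ * c / Λ) + (Real.log P.radius - logDepth p P z) := by
      rw [hτ, Real.log_mul (by positivity) (by positivity), Real.log_mul hr.ne' (by positivity),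
        Real.log_mul ha0.ne' hb0.ne', logDepth]
      ring
    have l3 : Real.log s₁ ≤ Real.log c + Real.log P.radius := by
      rw [← Real.log_mul hc.ne' hr.ne']; exact Real.log_le_log hs1 hs1c
    have l4 : Real.log (τ / s₁) = Real.log τ - Real.log s₁ := Real.log_div hτ0.ne' hs1.ne'
    have l5 : Real.log θ + Real.log τ ≤ Real.log (θ ^ (k + 1) * s₁) := by
      rw [← Real.log_mul hθ.ne' hτ0.ne']; exact Real.log_le_log (by positivity) hs2τ
    have l6 : Real.log (θ * (θ * c / Λ)) = Real.log θ + Real.log (θ * c / Λ) :=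
      Real.log_mul hθ.ne' (by positivity)
    rw [l1] at hmB
    rw [l4] at hkB
    rw [Real.log_div hρ.ne' hs2.ne', Real.log_div hρ.ne' hq.ne', comparing, l6]
    push_cast
    set B := (-Real.log θ)⁻¹
    have m1 : B * Real.log s₁ ≤ B * (Real.log c + Real.log P.radius) := by gcongr
    have m2 : B * (Real.log θ + Real.log τ) ≤ B * Real.log (θ ^ (k + 1) * s₁) := by gcongr
    rw [l2] at hkB m2
    linarith

/-- This lets one constant serve large and small cylinders alike. In `comparing` the terms `log c`
cancel, and what remains besides the left side is nonnegative because `log θ < 0 ≤ log Λ`. -/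
theorem comparing_large_le : adjusting p κ G J + (-Real.log θ)⁻¹ * (-Real.log (κ ^ J))
    ≤ comparing p κ θ G c Λ J := by
  have hθ := h.θ_pos
  have hc := h.c_pos
  have hΛ := h.eight_le_Λ
  have l0 : Real.log (θ * c / Λ) = Real.log θ + Real.log c - Real.log Λ := by
    rw [Real.log_div (by positivity) (by positivity), Real.log_mul hθ.ne' hc.ne']
  have l6 : Real.log (θ * (θ * c / Λ)) = Real.log θ + Real.log (θ * c / Λ) :=
      Real.log_mul hθ.ne' (by positivity)
  have l1 := Real.log_neg hθ h.θ_lt_one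
  have l2 : 0 ≤ Real.log Λ := Real.log_nonneg (by linarith)
  have hB := h.inv_log_pos
  have hcr : (0 : ℝ) ≤ crossing p θ c := Nat.cast_nonneg _
  rw [comparing, l6, l0]
  have : (-Real.log θ)⁻¹ * (-Real.log (κ ^ J)) ≤ (-Real.log θ)⁻¹ *
    (-Real.log (κ ^ J) + Real.log c + (Real.log c - (Real.log θ + Real.log c - Real.log Λ))
      - (Real.log θ + (Real.log θ + Real.log c - Real.log Λ))) := by
    gcongr; linarith
  linarith

theorem comparing_nonneg : 0 ≤ comparing p κ θ G c Λ J := by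
  have h1 := h.comparing_large_le
  have h2 : Real.log (κ ^ J) ≤ 0 :=
    Real.log_nonpos h.σ_pos.le (by linarith [h.σ_le, h.c_le])
  have h3 : 0 ≤ (-Real.log θ)⁻¹ * (-Real.log (κ ^ J)) :=
    mul_nonneg h.inv_log_pos.le (by linarith)
  have h4 : (0 : ℝ) ≤ adjusting p κ G J := Nat.cast_nonneg _
  linarith

/-- Chains to the lower part of a hull are continued to its upper part. -/
theorem exists_above (R : Cylinder n) (hUΩ : U ⊆ Ω) {P Q : Cylinder n}
    (hP : P.hull p 3 ⊆ U) {w z : SpaceTime n} (hw : w ∈ (P.lag p (-3)).toSet p)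
    (hz : z ∈ (P.lag p 3).toSet p) (hQ : Above p A G Λ U Q w) :
    ∃ (Q' : Cylinder n) (N : ℕ), Above p A G Λ U Q' z ∧
      fitDist p Ω A R Q' ≤ fitDist p Ω A R Q + N ∧ ∀ ρ : ℝ, 0 < ρ →
      N + (-Real.log θ)⁻¹ * Real.log (ρ / Q'.radius) ≤ (-Real.log θ)⁻¹ * Real.log (ρ / Q.radius)
        + comparing p κ θ G c Λ J + 2 * (-Real.log θ)⁻¹ * logDepth p P z := by
  by_cases hlarge : c * P.radius < κ ^ J * Q.radius
  · obtain ⟨Q', h1, h2, h3⟩ := h.exists_above_of_large R hUΩ hw hz hQ hlarge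
    refine ⟨Q', _, h1, h3, fun ρ hρ => ?_⟩
    rw [h2, Real.log_div hρ.ne' (mul_pos h.σ_pos Q.radius_pos).ne',
      Real.log_mul h.σ_pos.ne' Q.radius_pos.ne', Real.log_div hρ.ne' Q.radius_pos.ne']
    have h4 := h.comparing_large_le
    have h5 : 0 ≤ 2 * (-Real.log θ)⁻¹ * logDepth p P z :=
      mul_nonneg (mul_nonneg two_pos.le h.inv_log_pos.le) (logDepth_nonneg h.p_pos hz)
    linarith
  · exact h.exists_above_of_small R hUΩ hP hw hz hQ (not_lt.1 hlarge)

end Scales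

end FIT

/-! ### Averages of the logarithmic depth. -/

namespace FIT

variable {n : ℕ} {p : ℝ}

/-- A discrete layer-cake bound: exactly `⌈y⌉₊` natural numbers `j` satisfy `j < y`. -/
theorem ofReal_le_tsum_indicator {α : Type*} (y : ℝ) (z : α) (T : ℕ → Set α)
    (h : ∀ j : ℕ, (j : ℝ) < y → z ∈ T j) :
    ENNReal.ofReal y ≤ ∑' j, (T j).indicator (1 : α → ℝ≥0∞) z := by
  calc ENNReal.ofReal y ≤ (⌈y⌉₊ : ℝ≥0∞) := by
        rw [← ENNReal.ofReal_natCast]; exact ENNReal.ofReal_le_ofReal (Nat.le_ceil y)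
    _ = ∑ j ∈ Finset.range ⌈y⌉₊, (T j).indicator (1 : α → ℝ≥0∞) z := by
        rw [Finset.sum_congr rfl (g := fun _ => (1 : ℝ≥0∞))]
        · simp
        · intro j hj
          rw [indicator_of_mem (h j (Nat.lt_ceil.1 (Finset.mem_range.1 hj)))]; rfl
    _ ≤ _ := ENNReal.sum_le_tsum _

theorem setLIntegral_ofReal_le_tsum {α : Type*} [MeasurableSpace α] {μ : Measure α} {S : Set α}
    (hS : MeasurableSet S) (y : α → ℝ) (T : ℕ → Set α) (hT : ∀ j, MeasurableSet (T j))
    (h : ∀ z ∈ S, ∀ j : ℕ, (j : ℝ) < y z → z ∈ T j) :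
    ∫⁻ z in S, ENNReal.ofReal (y z) ∂μ ≤ ∑' j, μ (T j) := by
  calc ∫⁻ z in S, ENNReal.ofReal (y z) ∂μ
      ≤ ∫⁻ z in S, ∑' j, (T j).indicator (1 : α → ℝ≥0∞) z ∂μ :=
        setLIntegral_mono' hS fun z hz => ofReal_le_tsum_indicator _ _ _ (h z hz)
    _ = ∑' j, ∫⁻ z in S, (T j).indicator (1 : α → ℝ≥0∞) z ∂μ :=
        lintegral_tsum fun j => (measurable_one.indicator (hT j)).aemeasurable
    _ ≤ ∑' j, μ (T j) := by
        refine ENNReal.tsum_le_tsum fun j => ?_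
        rw [lintegral_indicator_one (hT j)]
        exact Measure.restrict_apply_le _ _

/-- A bound for the averages of `logDepth`. -/
noncomputable def logAverage (n : ℕ) : ℝ≥0∞ :=
  ENNReal.ofReal (n + 2) * (1 - ENNReal.ofReal (Real.exp (-1)))⁻¹

theorem logAverage_lt_top (n : ℕ) : logAverage n < ∞ := by
  refine ENNReal.mul_lt_top ENNReal.ofReal_lt_top (ENNReal.inv_lt_top.2 ?_)
  rw [tsub_pos_iff_lt, ENNReal.ofReal_lt_one]
  rw [Real.exp_lt_one_iff]; norm_num

theorem tsum_ofReal_exp (K v : ℝ) (hK : 0 ≤ K) :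
    ∑' j : ℕ, ENNReal.ofReal (K * Real.exp (-(j : ℝ)) * v)
      = ENNReal.ofReal K * (1 - ENNReal.ofReal (Real.exp (-1)))⁻¹ * ENNReal.ofReal v := by
  have : ∀ j : ℕ, ENNReal.ofReal (K * Real.exp (-(j : ℝ)) * v)
      = ENNReal.ofReal K * ENNReal.ofReal (Real.exp (-1)) ^ j * ENNReal.ofReal v := by
    intro j
    rw [ENNReal.ofReal_mul (by positivity), ENNReal.ofReal_mul hK,
      ← ENNReal.ofReal_pow (by positivity), ← Real.exp_nat_mul]
    simp
  simp_rw [this]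
  rw [ENNReal.tsum_mul_right, ENNReal.tsum_mul_left, ENNReal.tsum_geometric]

/-- The spatial and the temporal logarithm exceed `j` only in a lateral shell and in a slab under
the top of `P^+`, both of relative volume `O(e^(-j))`. Summing over `j` gives a bound independent of
`P`. -/
theorem lintegral_logDepth_le (hp : 0 < p) (P : Cylinder n) :
    ∫⁻ z in (P.lag p 3).toSet p, ENNReal.ofReal (logDepth p P z)
      ≤ logAverage n * volume ((P.lag p 3).toSet p) := by
  obtain ⟨x, r, hr⟩ := P
  have hrp := Real.rpow_pos_of_pos hr p
  have hω := unitVol_pos n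
  set P : Cylinder n := ⟨x, r, hr⟩
  set S := (P.lag p 3).toSet p with hS
  have hSbox : S = box (x.1, x.2 + 3 * r ^ p) r (r ^ p) := Cylinder.lag_toSet_eq hp P 3
  have hSm : MeasurableSet S := by rw [hSbox]; exact measurableSet_box _ _ _
  set v := r ^ n * unitVol n * (2 * r ^ p) with hv
  have hv0 : 0 < v := by positivity
  have hSv : volume S = ENNReal.ofReal v := by rw [hSbox, volume_box _ _ hr]
  set y₁ : SpaceTime n → ℝ := fun z => -Real.log (1 - ‖z.1 - x.1‖ / r)
  set y₂ : SpaceTime n → ℝ := fun z => -Real.log ((4 - (z.2 - x.2) / r ^ p) / 2)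
  have hsplit : ∀ z, ENNReal.ofReal (logDepth p P z) ≤
      ENNReal.ofReal (y₁ z) + ENNReal.ofReal (y₂ z) := fun z => ENNReal.ofReal_add_le
  have hy₁ : Measurable fun z => ENNReal.ofReal (y₁ z) := by
    refine ENNReal.measurable_ofReal.comp (Real.measurable_log.comp ?_).neg
    fun_prop
  have b1 : ∫⁻ z in S, ENNReal.ofReal (y₁ z) ≤
      ∑' j : ℕ, ENNReal.ofReal ((n + 1) * Real.exp (-(j : ℝ)) * v) := by
    set I : ℕ → Set (SpaceTime n) := fun j =>
      box (x.1, x.2 + 3 * r ^ p) ((1 - Real.exp (-(j : ℝ))) * r) (r ^ p) with hI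
    refine (setLIntegral_ofReal_le_tsum hSm y₁ (fun j => S \ I j)
      (fun j => hSm.diff (measurableSet_box _ _ _)) ?_).trans ?_
    · intro z hz j hj
      refine ⟨hz, fun hzI => ?_⟩
      have hz' := (mem_lag_pos hp).1 hz
      rw [mem_box] at hzI
      have h1 : 0 < 1 - ‖z.1 - x.1‖ / r := (depth_pos hp hz).1.1
      have h2 : Real.log (1 - ‖z.1 - x.1‖ / r) < -(j : ℝ) := by linarith
      rw [Real.log_lt_iff_lt_exp h1] at h2
      have h3 : ‖z.1 - x.1‖ / r < 1 - Real.exp (-(j : ℝ)) := by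
        rw [div_lt_iff₀ hr]; exact hzI.1
      linarith
    · refine ENNReal.tsum_le_tsum fun j => ?_
      rcases Nat.eq_zero_or_pos j with rfl | hj
      · refine (measure_mono sdiff_subset).trans ?_
        rw [hSv]
        refine ENNReal.ofReal_le_ofReal ?_
        simp only [Nat.cast_zero, neg_zero, Real.exp_zero, mul_one]
        nlinarith [(Nat.cast_nonneg n : (0 : ℝ) ≤ n)]
      · have he : 0 < Real.exp (-(j : ℝ)) := Real.exp_pos _
        have he1 : Real.exp (-(j : ℝ)) < 1 :=
          Real.exp_lt_one_iff.2 (neg_lt_zero.2 (by exact_mod_cast hj))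
        have hsub : I j ⊆ S := by
          rw [hSbox]
          exact box_subset_box (by simp only [sub_self, norm_zero, zero_add]; nlinarith) (by simp)
        have hIv : volume (I j) = ENNReal.ofReal ((1 - Real.exp (-(j : ℝ))) ^ n * v) := by
          rw [hI]
          simp only
          rw [volume_box _ _ (mul_pos (by linarith) hr), mul_pow, hv]
          congr 1; ring
        rw [measure_sdiff hsub (measurableSet_box _ _ _).nullMeasurableSet
          (by rw [hIv]; exact ENNReal.ofReal_ne_top), hSv, hIv, ← ENNReal.ofReal_sub _ (by
            have : 0 ≤ 1 - Real.exp (-(j : ℝ)) := by linarith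
            positivity)]
        refine ENNReal.ofReal_le_ofReal ?_
        -- Bernoulli's inequality bounds the shell: `1 - (1 - u)^n ≤ n u`. The constant `n + 1` also
        -- covers `j = 0`, where the shell is bounded by all of `S`.
        have hb := one_add_mul_le_pow (a := -Real.exp (-(j : ℝ))) (by linarith) n
        rw [← sub_eq_add_neg] at hb
        nlinarith
  have b2 : ∫⁻ z in S, ENNReal.ofReal (y₂ z) ≤
      ∑' j : ℕ, ENNReal.ofReal (1 * Real.exp (-(j : ℝ)) * v) := by
    refine (setLIntegral_ofReal_le_tsum hSm y₂ (fun j : ℕ => box (x.1, x.2 +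
      (4 - Real.exp (-(j : ℝ))) * r ^ p) r (Real.exp (-(j : ℝ)) * r ^ p))
      (fun j => measurableSet_box _ _ _) ?_).trans ?_
    · intro z hz j hj
      have hz' := (mem_lag_pos hp).1 hz
      have h1 : 0 < (4 - (z.2 - x.2) / r ^ p) / 2 := (depth_pos hp hz).2.1
      have h2 : Real.log ((4 - (z.2 - x.2) / r ^ p) / 2) < -(j : ℝ) := by linarith
      rw [Real.log_lt_iff_lt_exp h1] at h2
      have h3 : 4 - 2 * Real.exp (-(j : ℝ)) < (z.2 - x.2) / r ^ p := by linarith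
      rw [lt_div_iff₀ hrp] at h3
      rw [mem_box]
      refine ⟨hz'.1, ?_⟩
      have h4 := hz'.2.2
      simp only [P] at h4
      rw [abs_lt]
      constructor <;> simp only <;> linarith
    · refine ENNReal.tsum_le_tsum fun j => ?_
      rw [volume_box _ _ hr]
      refine ENNReal.ofReal_le_ofReal (le_of_eq ?_)
      rw [hv]; ring
  calc ∫⁻ z in S, ENNReal.ofReal (logDepth p P z)
      ≤ ∫⁻ z in S, (ENNReal.ofReal (y₁ z) + ENNReal.ofReal (y₂ z)) := lintegral_mono hsplit
    _ = (∫⁻ z in S, ENNReal.ofReal (y₁ z)) + ∫⁻ z in S, ENNReal.ofReal (y₂ z) :=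
        lintegral_add_left hy₁ _
    _ ≤ _ := add_le_add b1 b2
    _ = logAverage n * volume S := by
        rw [tsum_ofReal_exp _ _ (by positivity), tsum_ofReal_exp _ _ zero_le_one, hSv, logAverage,
          ← add_mul, ← add_mul, ← ENNReal.ofReal_add (by positivity) zero_le_one]
        congr 3; ring_nf

end FIT

/-! ### The penalized chain distance and its `PBMO^+` norm. -/

namespace FIT

variable {n : ℕ} {p : ℝ} {A : Param} {Ω U : Set (SpaceTime n)} {R : Cylinder n}
  {κ H θ G c Λ ρ : ℝ} {J : ℕ}

/-- The penalized FIT distance from `R` to a point of `U`. -/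
noncomputable def pot (p : ℝ) (Ω : Set (SpaceTime n)) (A : Param) (R : Cylinder n)
    (θ G Λ ρ : ℝ) (U : Set (SpaceTime n)) (z : SpaceTime n) : ℝ≥0∞ :=
  ⨅ (Q : Cylinder n) (_ : Above p A G Λ U Q z),
    (fitDist p Ω A R Q + ENNReal.ofReal ((-Real.log θ)⁻¹ * Real.log (ρ / Q.radius)))

theorem isOpen_setOf_above (Q : Cylinder n) : IsOpen {z | Above p A G Λ U Q z} := by
  have h1 : IsOpen {z : SpaceTime n | ‖z.1 - Q.center.1‖ < (A.A₃ + 1) * Q.radius} :=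
    isOpen_lt (by fun_prop) continuous_const
  have h2 : IsOpen {z : SpaceTime n | |z.2 - Q.center.2 - G * Q.radius ^ p| < Q.radius ^ p} :=
    isOpen_lt (by fun_prop) continuous_const
  exact h1.inter (h2.inter isOpen_const)

/-- For fixed `Q` the condition on `z` is open and the value does not depend on `z`, so `pot` is
upper semicontinuous without any regularity of the chain distance. This yields measurability and
local boundedness. -/
theorem isOpen_pot_lt (a : ℝ≥0∞) : IsOpen {z | pot p Ω A R θ G Λ ρ U z < a} := by
  have : {z | pot p Ω A R θ G Λ ρ U z < a} = ⋃ Q : Cylinder n, {z | Above p A G Λ U Q z ∧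
      fitDist p Ω A R Q + ENNReal.ofReal ((-Real.log θ)⁻¹ * Real.log (ρ / Q.radius)) < a} := by
    ext z
    simp [pot, iInf_lt_iff]
  rw [this]
  exact isOpen_iUnion fun Q => (isOpen_setOf_above Q).inter isOpen_const

theorem measurable_pot : Measurable (pot p Ω A R θ G Λ ρ U) :=
  measurable_of_Iio fun a => (isOpen_pot_lt a).measurableSet

namespace Scales

variable (h : Scales n p A κ H θ G c Λ J)
include h

/-- A tiny cylinder is reached near a point somewhat earlier than `z`; the time gained allows a
travel to a position exactly below `z`, with the whole dilate still in a neighborhood of `z`. -/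
theorem pot_lt_top (hU : IsOpen U) (hUΩ : U ⊆ Ω) (hR : Reaches p Ω A R U) {z : SpaceTime n}
    (hz : z ∈ U) : pot p Ω A R θ G Λ ρ U z < ∞ := by
  have hp0 := h.p_pos
  have hκ1 : 0 < 1 - κ := by linarith [h.slack.lt_one]
  have hA3 := A.two_le_A₃
  have hA3p := one_le_rpow_A₃ hp0.le A
  have hG := h.G_ge
  obtain ⟨e, he, heU⟩ := Metric.isOpen_iff.1 hU z hz
  have hbox : box z e e ⊆ U := by
    refine Subset.trans (fun y hy => ?_) heU
    rw [mem_box] at hy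
    rw [Metric.mem_ball, Prod.dist_eq, max_lt_iff, dist_eq_norm, Real.dist_eq]
    exact hy
  obtain ⟨ρ₀, hρ₀, hsmall⟩ := exists_pos_of_eventually
    ((((eventually_const_mul_rpow_lt G hp0 (show 0 < e / 4 by linarith)).and
    (eventually_const_mul_rpow_lt 36 hp0 (show 0 < (1 - κ) * (e / 4) by positivity))).and
    ((eventually_const_mul_rpow_lt (A.A₃ + 1) one_pos he).and
    (eventually_const_mul_rpow_lt (4 + 4 * A.A₃ ^ p) hp0 (half_pos he)))).and
    ((eventually_const_mul_rpow_lt Λ one_pos he).and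
    (eventually_const_mul_rpow_lt (G + Λ) hp0 he)))
  obtain ⟨⟨y, r, hr⟩, hrρ, hzQ, hk⟩ := hR (z.1, z.2 - e / 2)
    (hbox (mem_box.2 ⟨by simpa using he, by
      simp only [sub_sub_cancel_left, abs_neg]
      rw [abs_of_pos (by positivity)]; linarith⟩)) ρ₀ hρ₀
  obtain ⟨⟨⟨e1, e2⟩, e3, e4⟩, e5, e6⟩ := hsmall r hr hrρ
  rw [Real.rpow_one] at e3 e5
  have hrp := Real.rpow_pos_of_pos hr p
  rw [Cylinder.lag_toSet_eq hp0, mem_box, abs_lt] at hzQ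
  simp only at hzQ
  obtain ⟨z1, z2, z3⟩ := hzQ
  have hT : e / 4 ≤ z.2 - G * r ^ p - y.2 := by linarith
  have key : fitDist p Ω A R ⟨(z.1, z.2 - G * r ^ p), r, hr⟩ < ∞ := by
    refine (fitDist_travel h.one_lt.le h.slack R hr (c := y) ?_ ?_ ?_).trans_lt
      (ENNReal.add_lt_top.2 ⟨hk, ENNReal.natCast_lt_top _⟩)
    · simp only
      exact e2.le.trans (mul_le_mul_of_nonneg_left hT hκ1.le)
    · simp only
      calc 6 * ‖z.1 - y.1‖ * r ^ p ≤ 6 * r * r ^ p := by gcongr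
        _ = 6 * r ^ p * r := by ring
        _ ≤ (1 - κ) * (e / 4) * r := mul_le_mul_of_nonneg_right (by linarith) hr.le
        _ ≤ _ := by gcongr
    · intro u hu
      have := segment_near (X := z) (a := r) (b := e / 2 + 4 * r ^ p) hu
        (by rw [norm_sub_rev]; exact z1.le) (by simpa using hr.le)
        (by rw [abs_le]; constructor <;> linarith)
        (by
          simp only [sub_sub_cancel_left, abs_neg]
          rw [abs_of_nonneg (by positivity)]; linarith)
      refine (box_subset_box ?_ ?_).trans (hbox.trans hUΩ) <;> linarith
  refine (iInf₂_le _ ⟨?_, ?_, ?_⟩).trans_lt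
    (ENNReal.add_lt_top.2 ⟨key, ENNReal.ofReal_lt_top⟩)
  · simp only [sub_self, norm_zero]; positivity
  · simp only [sub_sub_cancel, sub_self, abs_zero]; exact hrp
  · refine (box_subset_box ?_ ?_).trans hbox
    · simpa using e5.le
    · simp only [sub_sub_cancel_left, abs_neg]
      rw [abs_of_nonneg (by positivity)]; linarith

theorem radius_le (hρ : ∀ Q : Cylinder n, Q.toSet p ⊆ U → Q.radius ≤ ρ) {Q : Cylinder n}
    {z : SpaceTime n} (hQ : Above p A G Λ U Q z) : Q.radius ≤ ρ := by
  refine hρ Q (Subset.trans ?_ hQ.2.2)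
  rw [Cylinder.toSet_eq h.p_pos]
  have := h.eight_le_Λ
  have := Q.radius_pos
  have := Real.rpow_pos_of_pos Q.radius_pos p
  refine box_subset_box ?_ ?_
  · simp only [sub_self, norm_zero]; nlinarith
  · simp only [sub_self, abs_zero]; nlinarith

/-- Each competitor for `w` is continued to one for `z`. The bound `ρ` on the radii makes the
penalty nonnegative, so that truncation by `ENNReal.ofReal` loses nothing for the new cylinder. -/
theorem pot_le (hUΩ : U ⊆ Ω) (hρ0 : 0 < ρ) (hρ : ∀ Q : Cylinder n, Q.toSet p ⊆ U → Q.radius ≤ ρ)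
    {P : Cylinder n} (hP : P.hull p 3 ⊆ U) {w z : SpaceTime n}
    (hw : w ∈ (P.lag p (-3)).toSet p) (hz : z ∈ (P.lag p 3).toSet p) :
    pot p Ω A R θ G Λ ρ U z ≤ pot p Ω A R θ G Λ ρ U w + ENNReal.ofReal
      (comparing p κ θ G c Λ J + 2 * (-Real.log θ)⁻¹ * logDepth p P z) := by
  conv_rhs => rw [pot]
  rw [ENNReal.iInf_add]
  refine le_iInf fun Q => ?_
  rw [ENNReal.iInf_add]
  refine le_iInf fun hQ => ?_
  obtain ⟨Q', N, hQ', hk, hN⟩ := h.exists_above R hUΩ hP hw hz hQ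
  refine (iInf₂_le Q' hQ').trans ?_
  have hB := h.inv_log_pos
  have hlog : 0 ≤ (-Real.log θ)⁻¹ * Real.log (ρ / Q'.radius) :=
    mul_nonneg hB.le (Real.log_nonneg ((one_le_div Q'.radius_pos).2 (h.radius_le hρ hQ')))
  calc _ ≤ fitDist p Ω A R Q + N + ENNReal.ofReal ((-Real.log θ)⁻¹ * Real.log (ρ / Q'.radius)) := by
        gcongr
    _ = fitDist p Ω A R Q
        + ENNReal.ofReal (N + (-Real.log θ)⁻¹ * Real.log (ρ / Q'.radius)) := by
        rw [ENNReal.ofReal_add (Nat.cast_nonneg _) hlog, ENNReal.ofReal_natCast, add_assoc]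
    _ ≤ fitDist p Ω A R Q + ENNReal.ofReal ((-Real.log θ)⁻¹ * Real.log (ρ / Q.radius)
        + (comparing p κ θ G c Λ J + 2 * (-Real.log θ)⁻¹ * logDepth p P z)) := by
        refine add_le_add le_rfl (ENNReal.ofReal_le_ofReal ?_)
        linarith [hN ρ hρ0]
    _ ≤ _ := by
        rw [add_assoc]
        gcongr
        exact ENNReal.ofReal_add_le

/-- The allowance `M` admits bounded perturbations of `pot`; one of them is needed to make the norm
non-zero. -/
theorem pbmoNorm_le (hUΩ : U ⊆ Ω) (hρ0 : 0 < ρ)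
    (hρ : ∀ Q : Cylinder n, Q.toSet p ⊆ U → Q.radius ≤ ρ)
    (hfin : ∀ z ∈ U, pot p Ω A R θ G Λ ρ U z < ∞) {M : ℝ} (hM : 0 ≤ M) {g : SpaceTime n → ℝ}
    (hg1 : ∀ z ∈ U, (pot p Ω A R θ G Λ ρ U z).toReal ≤ g z)
    (hg2 : ∀ z ∈ U, g z ≤ (pot p Ω A R θ G Λ ρ U z).toReal + M) :
    pbmoNorm p U g ≤ ENNReal.ofReal (comparing p κ θ G c Λ J + M)
      + ENNReal.ofReal (2 * (-Real.log θ)⁻¹) * logAverage n := by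
  have hp0 := h.p_pos
  have hB := h.inv_log_pos
  have hC := h.comparing_nonneg
  refine iSup₂_le fun P hP => ?_
  have hP1 : P.dilate 1 one_pos = P := Cylinder.ext_of rfl (one_mul _)
  rw [hP1] at hP
  have hneg := (P.lag_toSet_subset_hull hp0 (a := -3) (by norm_num)).trans hP
  have hpos := (P.lag_toSet_subset_hull hp0 (a := 3) (by norm_num)).trans hP
  set F := pot p Ω A R θ G Λ ρ U with hF
  set I : ℝ≥0∞ := ⨅ w ∈ (P.lag p (-3)).toSet p, F w with hI
  have hIle : ∀ w ∈ (P.lag p (-3)).toSet p, I ≤ F w := fun w hw => iInf₂_le w hw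
  have hrp := Real.rpow_pos_of_pos P.radius_pos p
  have hItop : I < ∞ := by
    have hmem : ((P.lag p (-3)).center) ∈ (P.lag p (-3)).toSet p := by
      rw [Cylinder.toSet_eq hp0, mem_box]
      simp [Cylinder.lag, P.radius_pos, hrp]
    exact (hIle _ hmem).trans_lt (hfin _ (hneg hmem))
  -- With the infimum of `pot` over `P^-` as the constant, the negative part vanishes on `P^-`, and
  -- on `P^+` the excess is at most a constant plus a multiple of the logarithmic depth.
  refine (iInf_le _ I.toReal).trans ?_
  simp only [ENNReal.rpow_one, one_div, inv_one]
  have hzero : ⨍⁻ z in (P.lag p (-3)).toSet p, ENNReal.ofReal (I.toReal - g z) ∂volume = 0 := by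
    rw [setLAverage_eq, setLIntegral_congr_fun (g := fun _ => 0), lintegral_zero, ENNReal.zero_div]
    · rw [Cylinder.toSet_eq hp0]; exact measurableSet_box _ _ _
    · intro w hw
      refine ENNReal.ofReal_of_nonpos ?_
      have h1 := ENNReal.toReal_mono (hfin w (hneg hw)).ne (hIle w hw)
      have h2 := hg1 w (hneg hw)
      linarith
  rw [hzero, add_zero, setLAverage_eq]
  refine ENNReal.div_le_of_le_mul ?_
  have hSm : MeasurableSet ((P.lag p 3).toSet p) := by
    rw [Cylinder.toSet_eq hp0]; exact measurableSet_box _ _ _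
  calc ∫⁻ z in (P.lag p 3).toSet p, ENNReal.ofReal (g z - I.toReal)
      ≤ ∫⁻ z in (P.lag p 3).toSet p, (ENNReal.ofReal (comparing p κ θ G c Λ J + M)
        + ENNReal.ofReal (2 * (-Real.log θ)⁻¹) * ENNReal.ofReal (logDepth p P z)) := by
        refine setLIntegral_mono' hSm fun z hz => ?_
        have hd := logDepth_nonneg hp0 hz
        have hF1 : F z ≤ I + ENNReal.ofReal (comparing p κ θ G c Λ J
            + 2 * (-Real.log θ)⁻¹ * logDepth p P z) := by
          rw [hI, ENNReal.iInf_add]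
          refine le_iInf fun w => ?_
          rw [ENNReal.iInf_add]
          exact le_iInf fun hw => h.pot_le hUΩ hρ0 hρ hP hw hz
        have hnn : 0 ≤ 2 * (-Real.log θ)⁻¹ * logDepth p P z := by positivity
        have hF2 := ENNReal.toReal_mono
          (ENNReal.add_lt_top.2 ⟨hItop, ENNReal.ofReal_lt_top⟩).ne hF1
        rw [ENNReal.toReal_add hItop.ne ENNReal.ofReal_ne_top,
          ENNReal.toReal_ofReal (by linarith)] at hF2
        rw [← ENNReal.ofReal_mul (by positivity), ← ENNReal.ofReal_add (by linarith) hnn]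
        refine ENNReal.ofReal_le_ofReal ?_
        have := hg2 z (hpos hz)
        linarith
    _ = ENNReal.ofReal (comparing p κ θ G c Λ J + M) * volume ((P.lag p 3).toSet p)
        + ENNReal.ofReal (2 * (-Real.log θ)⁻¹)
          * ∫⁻ z in (P.lag p 3).toSet p, ENNReal.ofReal (logDepth p P z) := by
        rw [lintegral_add_left measurable_const, setLIntegral_const,
          lintegral_const_mul' _ _ ENNReal.ofReal_ne_top]
    _ ≤ _ := by
        rw [add_mul, mul_assoc]
        gcongr
        exact lintegral_logDepth_le hp0 P

end Scales

end FIT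

/-! ### Test functions, finite volume, and descent to the scale of the boundary distance. -/

namespace FIT

variable {n : ℕ} {p : ℝ} {A : Param} {Ω U V : Set (SpaceTime n)} {R : Cylinder n}
  {κ H θ G c Λ ρ : ℝ} {J : ℕ}

theorem exists_hull_subset (hp : 0 < p) {W : Set (SpaceTime n)} (hW : IsOpen W) {z : SpaceTime n}
    (hz : z ∈ W) : ∃ P : Cylinder n, P.center = z ∧ P.hull p 3 ⊆ W := by
  obtain ⟨e, he, heW⟩ := Metric.isOpen_iff.1 hW z hz
  obtain ⟨ρ₀, hρ₀, hsmall⟩ := exists_pos_of_eventually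
    ((eventually_const_mul_rpow_lt 1 one_pos he).and (eventually_const_mul_rpow_lt 4 hp he))
  have hr : 0 < ρ₀ / 2 := half_pos hρ₀
  obtain ⟨e1, e2⟩ := hsmall _ hr (half_lt_self hρ₀)
  rw [Real.rpow_one, one_mul] at e1
  refine ⟨⟨z, ρ₀ / 2, hr⟩, rfl, Subset.trans (fun y hy => ?_) heW⟩
  rw [Cylinder.hull_eq hp, mem_box] at hy
  rw [Metric.mem_ball, Prod.dist_eq, max_lt_iff, dist_eq_norm, Real.dist_eq]
  exact ⟨hy.1.trans e1, hy.2.trans e2⟩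

theorem volume_toSet_ne_zero (hp : 0 < p) (P : Cylinder n) : volume (P.toSet p) ≠ 0 := by
  rw [Cylinder.toSet_eq hp, volume_box _ _ P.radius_pos]
  have := Real.rpow_pos_of_pos P.radius_pos p
  have := P.radius_pos
  have := unitVol_pos n
  exact (ENNReal.ofReal_pos.2 (by positivity)).ne'

theorem volume_toSet_ne_top (hp : 0 < p) (P : Cylinder n) : volume (P.toSet p) ≠ ∞ := by
  rw [Cylinder.toSet_eq hp, volume_box _ _ P.radius_pos]
  exact ENNReal.ofReal_ne_top

theorem measurableSet_toSet (hp : 0 < p) (P : Cylinder n) : MeasurableSet (P.toSet p) := by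
  rw [Cylinder.toSet_eq hp]; exact measurableSet_box _ _ _

theorem le_setLAverage (hp : 0 < p) (P : Cylinder n) {φ : SpaceTime n → ℝ≥0∞} {a : ℝ≥0∞}
    (h : ∀ z ∈ P.toSet p, a ≤ φ z) : a ≤ ⨍⁻ z in P.toSet p, φ z ∂volume := by
  rw [setLAverage_eq, ENNReal.le_div_iff_mul_le (Or.inl (volume_toSet_ne_zero hp P))
    (Or.inl (volume_toSet_ne_top hp P)), ← setLIntegral_const]
  exact setLIntegral_mono' (measurableSet_toSet hp P) h

theorem setLAverage_le (hp : 0 < p) (P : Cylinder n) {φ : SpaceTime n → ℝ≥0∞} {a : ℝ≥0∞}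
    (h : ∀ z ∈ P.toSet p, φ z ≤ a) : ⨍⁻ z in P.toSet p, φ z ∂volume ≤ a := by
  rw [setLAverage_eq]
  refine ENNReal.div_le_of_le_mul ?_
  rw [← setLIntegral_const]
  exact setLIntegral_mono' (measurableSet_toSet hp P) h

/-- A function that jumps by one between the two halves of a hull has norm at least one. -/
theorem one_le_pbmoNorm (hp : 0 < p) {P : Cylinder n} (hP : P.hull p 3 ⊆ U) {g : SpaceTime n → ℝ}
    {b : ℝ} (h1 : ∀ z ∈ (P.lag p (-3)).toSet p, g z ≤ b)
    (h2 : ∀ z ∈ (P.lag p 3).toSet p, b + 1 ≤ g z) : 1 ≤ pbmoNorm p U g := by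
  have hP1 : P.dilate 1 one_pos = P := Cylinder.ext_of rfl (one_mul _)
  refine le_trans ?_ (le_iSup₂ (α := ℝ≥0∞) P (by rw [hP1]; exact hP))
  refine le_iInf fun a => ?_
  simp only [ENNReal.rpow_one, one_div, inv_one]
  calc (1 : ℝ≥0∞) = ENNReal.ofReal ((b + 1 - a) + (a - b)) := by simp
    _ ≤ ENNReal.ofReal (b + 1 - a) + ENNReal.ofReal (a - b) := ENNReal.ofReal_add_le
    _ ≤ _ := by
      refine add_le_add (le_setLAverage hp _ fun z hz => ?_) (le_setLAverage hp _ fun z hz => ?_)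
      · exact ENNReal.ofReal_le_ofReal (by linarith [h2 z hz])
      · exact ENNReal.ofReal_le_ofReal (by linarith [h1 z hz])

theorem pbmoNorm_le_one (hp : 0 < p) {g : SpaceTime n → ℝ} (h0 : ∀ z, 0 ≤ g z)
    (h1 : ∀ z, g z ≤ 1) : pbmoNorm p U g ≤ 1 := by
  refine iSup₂_le fun P _ => (iInf_le _ 0).trans ?_
  simp only [ENNReal.rpow_one, one_div, inv_one]
  calc _ ≤ (1 : ℝ≥0∞) + 0 := by
        refine add_le_add (setLAverage_le hp _ fun z _ => ?_) (setLAverage_le hp _ fun z _ => ?_)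
        · exact ENNReal.ofReal_le_one.2 (by linarith [h1 z])
        · exact (ENNReal.ofReal_of_nonpos (by linarith [h0 z])).le
    _ = 1 := add_zero 1

/-- The indicator of the future of the time `t`. -/
noncomputable def timeStep (n : ℕ) (t : ℝ) : SpaceTime n → ℝ :=
  {z : SpaceTime n | t < z.2}.indicator 1

theorem timeStep_of_lt {t : ℝ} {z : SpaceTime n} (h : t < z.2) : timeStep n t z = 1 :=
  indicator_of_mem (s := {z : SpaceTime n | t < z.2}) h 1

theorem timeStep_of_le {t : ℝ} {z : SpaceTime n} (h : z.2 ≤ t) : timeStep n t z = 0 :=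
  indicator_of_notMem (s := {z : SpaceTime n | t < z.2}) (fun h' => absurd h' (not_lt.2 h)) 1

theorem timeStep_nonneg (t : ℝ) (z : SpaceTime n) : 0 ≤ timeStep n t z := by
  rcases lt_or_ge t z.2 with h | h
  · rw [timeStep_of_lt h]; exact zero_le_one
  · rw [timeStep_of_le h]

theorem timeStep_le_one (t : ℝ) (z : SpaceTime n) : timeStep n t z ≤ 1 := by
  rcases lt_or_ge t z.2 with h | h
  · rw [timeStep_of_lt h]
  · rw [timeStep_of_le h]; exact zero_le_one

theorem measurable_timeStep (t : ℝ) : Measurable (timeStep n t) :=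
  measurable_one.indicator (measurableSet_lt measurable_const measurable_snd)

theorem locallyIntegrableOn_of_bounded {g : SpaceTime n → ℝ} (hg : Measurable g)
    (h : ∀ z ∈ U, ∃ W ∈ nhds z, ∃ M, ∀ w ∈ W, ‖g w‖ ≤ M) :
    LocallyIntegrableOn g U volume := by
  intro z hz
  obtain ⟨W, hW, M, hM⟩ := h z hz
  obtain ⟨W', hW', hWo, hzW⟩ := mem_nhds_iff.1 (Filter.inter_mem hW (Metric.ball_mem_nhds z one_pos))
  refine ⟨W', mem_nhdsWithin_of_mem_nhds (hWo.mem_nhds hzW), ?_⟩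
  refine Measure.integrableOn_of_bounded (M := M) ?_ hg.aestronglyMeasurable ?_
  · exact ((measure_mono (hW'.trans inter_subset_right)).trans_lt measure_ball_lt_top).ne
  · exact (ae_restrict_iff' hWo.measurableSet).2 (Filter.Eventually.of_forall fun w hw =>
      hM w (hW' hw).1)

theorem isOpen_future (hΩ : IsOpen Ω) (t : ℝ) : IsOpen (future Ω t) :=
  hΩ.inter (isOpen_lt continuous_const continuous_snd)

/-- Exponential integrability forces a finite volume. -/
theorem ExpIntegrability.volume_le (hp : 0 < p) (hU : IsOpen U) (hne : U.Nonempty) {η D₀ : ℝ}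
    (hη : 0 < η) (h : ExpIntegrability p U V η D₀) : volume V ≤ ENNReal.ofReal D₀ := by
  obtain ⟨z, hz⟩ := hne
  obtain ⟨P, hPz, hP⟩ := exists_hull_subset hp hU hz
  have hrp := Real.rpow_pos_of_pos P.radius_pos p
  -- The jump between the halves of a hull makes the norm of the step function non-zero, so the
  -- hypothesis applies to it; the exponential is at least `1` whatever the constant `a`.
  have h1 : 1 ≤ pbmoNorm p U (timeStep n P.center.2) := by
    refine one_le_pbmoNorm hp hP (b := 0) (fun w hw => ?_) fun w hw => ?_
    · rw [timeStep_of_le]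
      have := ((mem_lag_neg hp).1 hw).2.2
      linarith
    · rw [timeStep_of_lt, zero_add]
      have := ((mem_lag_pos hp).1 hw).2.1
      linarith
  have h2 : pbmoNorm p U (timeStep n P.center.2) ≤ 1 :=
    pbmoNorm_le_one hp (timeStep_nonneg _) (timeStep_le_one _)
  refine le_trans ?_ (h (timeStep n P.center.2) ⟨?_, h2.trans_lt ENNReal.one_lt_top⟩
    (zero_lt_one.trans_le h1).ne')
  · refine le_iInf fun a => ?_
    calc volume V = ∫⁻ _ in V, 1 := by simp
      _ ≤ _ := by
        refine lintegral_mono fun z => ?_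
        rw [ENNReal.one_le_ofReal]
        refine Real.one_le_exp (div_nonneg (mul_nonneg hη.le (le_max_right _ _))
          ENNReal.toReal_nonneg)
  · refine locallyIntegrableOn_of_bounded (measurable_timeStep _) fun z _ =>
      ⟨univ, Filter.univ_mem, 1, fun w _ => ?_⟩
    rw [Real.norm_of_nonneg (timeStep_nonneg _ _)]
    exact timeStep_le_one _ _

/-- The radii of the cylinders in the future are bounded if a later future has finite volume. -/
theorem radius_le_of_volume_le (hp : 1 < p) {t ε D₀ : ℝ} (hε : 0 < ε) (hD : 0 < D₀)
    (hvol : volume (future Ω t) ≤ ENNReal.ofReal D₀) (Q : Cylinder n)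
    (hQ : Q.toSet p ⊆ future Ω (t - ε)) :
    Q.radius ≤ 1 + D₀ / unitVol n + ε ^ (1 / p) := by
  have hp0 : 0 < p := by linarith
  obtain ⟨x, r, hr⟩ := Q
  rw [Cylinder.toSet_eq hp0] at hQ
  simp only at *
  have hω := unitVol_pos n
  have hrp := Real.rpow_pos_of_pos hr p
  have hε' := Real.rpow_pos_of_pos hε (1 / p)
  have hdiv : 0 < D₀ / unitVol n := by positivity
  by_contra hcon
  push Not at hcon
  have hr1 : 1 < r := by linarith
  have hrε : ε < r ^ p := by
    rw [← rpow_one_div_lt_iff hp0 hε.le hr]; linarith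
  have hlow : t - ε ≤ x.2 - r ^ p := by
    by_contra hlt
    push Not at hlt
    set s := (x.2 - r ^ p + min (t - ε) x.2) / 2 with hs
    have h1 : x.2 - r ^ p < min (t - ε) x.2 := lt_min hlt (by linarith)
    have h2 := min_le_left (t - ε) x.2
    have h3 := min_le_right (t - ε) x.2
    have : (x.1, s) ∈ future Ω (t - ε) := hQ (mem_box.2 ⟨by simpa using hr, by
      simp only; rw [abs_lt]; constructor <;> linarith⟩)
    have := this.2
    simp only at this
    linarith
  -- The cylinder lies after `t - ε`, so its center has time at least `t - ε + r^p > t`. Its upper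
  -- half is therefore part of the later future, whose volume is finite.
  have hsub : box (x.1, x.2 + r ^ p / 2) r (r ^ p / 2) ⊆ future Ω t := by
    intro z hz
    have hz2 := (mem_box.1 hz).2
    rw [abs_lt] at hz2
    simp only at hz2
    refine ⟨(hQ (box_subset_box (by simp) ?_ hz)).1, by linarith⟩
    simp only [add_sub_cancel_left]
    rw [abs_of_pos (by positivity)]; linarith
  have hv := (measure_mono hsub).trans hvol
  rw [volume_box _ _ hr, ENNReal.ofReal_le_ofReal_iff hD.le] at hv
  have e1 : 1 ≤ r ^ n := one_le_pow₀ hr1.le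
  have e2 : r ≤ r ^ p := by
    simpa using Real.rpow_le_rpow_of_exponent_le hr1.le hp.le
  have e3 : r * unitVol n ≤ D₀ := by
    calc r * unitVol n ≤ r ^ p * unitVol n := by gcongr
      _ ≤ r ^ n * (r ^ p * unitVol n) := le_mul_of_one_le_left (by positivity) e1
      _ = r ^ n * unitVol n * (2 * (r ^ p / 2)) := by ring
      _ ≤ D₀ := hv
  rw [← le_div_iff₀ hω] at e3
  linarith

theorem pinfDist_spec (hp : 0 < p) (hV : IsOpen V) (hne : Vᶜ.Nonempty) {z : SpaceTime n}
    (hz : z ∈ V) : 0 < pinfDist p z Vᶜ ∧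
      box z (pinfDist p z Vᶜ) (pinfDist p z Vᶜ ^ p) ⊆ V := by
  have hbdd : BddBelow (pdist p z '' Vᶜ) :=
    ⟨0, by rintro _ ⟨w, -, rfl⟩; exact (norm_nonneg _).trans (le_max_left _ _)⟩
  have hpos : 0 < pinfDist p z Vᶜ := by
    obtain ⟨P, hPz, hP⟩ := exists_hull_subset hp hV hz
    refine P.radius_pos.trans_le (le_csInf (hne.image _) ?_)
    rintro _ ⟨w, hw, rfl⟩
    by_contra hlt
    rw [not_le, pdist_lt_iff hp P.radius_pos] at hlt
    refine hw (hP (P.toSet_subset_hull hp ?_))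
    rw [Cylinder.toSet_eq hp, mem_box, hPz, norm_sub_rev, abs_sub_comm]
    exact hlt
  refine ⟨hpos, fun w hw => ?_⟩
  by_contra hwV
  have h1 : pinfDist p z Vᶜ ≤ pdist p z w := csInf_le hbdd ⟨w, hwV, rfl⟩
  rw [← not_lt, pdist_lt_iff hp hpos] at h1
  rw [mem_box, norm_sub_rev, abs_sub_comm] at hw
  exact h1 hw

theorem mem_lag_of_center (hp : 0 < p) (z : SpaceTime n) {s : ℝ} (hs : 0 < s) :
    z ∈ ((⟨(z.1, z.2 - 3 * s ^ p), s, hs⟩ : Cylinder n).lag p 3).toSet p := by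
  rw [Cylinder.lag_toSet_eq hp, mem_box]
  simp [hs, Real.rpow_pos_of_pos hs p]

theorem toSet_subset_box_of_le (hp : 1 ≤ p) (z : SpaceTime n) {s d : ℝ} (hs : 0 < s) (hd : 0 < d)
    (hsd : s ≤ d / 8) :
    (⟨(z.1, z.2 - 3 * s ^ p), s, hs⟩ : Cylinder n).toSet p ⊆ box z d (d ^ p) := by
  rw [Cylinder.toSet_eq (by linarith)]
  have hsp := Real.rpow_pos_of_pos hs p
  refine box_subset_box ?_ ?_
  · simp only [sub_self, norm_zero]; linarith
  · simp only [sub_sub_cancel_left, abs_neg]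
    rw [abs_of_pos (by positivity)]
    have e5 := Real.rpow_le_rpow hs.le hsd (show 0 ≤ p by linarith)
    rw [Real.div_rpow hd.le (by norm_num)] at e5
    have e6 : (8 : ℝ) ≤ 8 ^ p := by
      simpa using Real.rpow_le_rpow_of_exponent_le (x := 8) (by norm_num) hp
    have hdp := Real.rpow_pos_of_pos hd p
    have e7 : d ^ p / 8 ^ p ≤ d ^ p / 8 := by gcongr
    linarith

theorem neg_log_min_div_le {s d : ℝ} (hs : 0 < s) (hsρ : s ≤ ρ) (hd : 0 < d) :
    -Real.log (min s (d / 8) / s) ≤ Real.log (1 + 8 * ρ / d) := by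
  have hρ0 : 0 < ρ := hs.trans_le hsρ
  have hτ0 : 0 < min s (d / 8) := lt_min hs (by positivity)
  rw [← Real.log_inv, inv_div]
  refine Real.log_le_log (by positivity) ?_
  rw [div_le_iff₀ hτ0]
  rcases min_cases s (d / 8) with ⟨hmin, -⟩ | ⟨hmin, -⟩ <;> rw [hmin]
  · have : 0 ≤ 8 * ρ / d * s := by positivity
    linarith
  · have : (1 + 8 * ρ / d) * (d / 8) = d / 8 + ρ := by field_simp
    linarith

namespace Scales

variable (h : Scales n p A κ H θ G c Λ J)
include h

/-- Chains that end below `z` are continued to a cylinder whose size is at most the distance from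
`z` to the complement of `V`. -/
theorem exists_descent (R : Cylinder n) (hUΩ : U ⊆ Ω) {Q : Cylinder n} {z : SpaceTime n}
    (hQ : Above p A G Λ U Q z) (hQρ : Q.radius ≤ ρ) {d : ℝ} (hd : 0 < d)
    (hdV : box z d (d ^ p) ⊆ V) : ∃ Q' : Cylinder n, z ∈ (Q'.lag p 3).toSet p ∧
      Q'.toSet p ⊆ V ∧ fitDist p Ω A R Q' ≤ fitDist p Ω A R Q + ENNReal.ofReal
        (2 * adjusting p κ G J + 1 + (-Real.log θ)⁻¹ * Real.log (1 + 8 * ρ / d)) := by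
  have hp0 := h.p_pos
  obtain ⟨y, q, hq⟩ := Q
  obtain ⟨hQ1, hQ2, hQ3⟩ := hQ
  simp only at *
  have hqp := Real.rpow_pos_of_pos hq p
  have hσ0 := h.σ_pos
  have hσp0 := Real.rpow_pos_of_pos hσ0 p
  have hσle := h.σ_le
  have hcle := h.c_le
  have hσp := h.σ_rpow_le
  have hσt := h.σ_time
  have hG := h.G_ge
  have hΛ1 := h.le_Λ
  have hΛ2 := h.le_Λ'
  have hA3 := A.two_le_A₃
  have hA3p := one_le_rpow_A₃ hp0.le A
  have hθ := h.θ_pos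
  have hθ1 := h.θ_lt_one
  have hκ1 := h.slack.lt_one
  have hκ0 := h.slack.pos
  have hσf := h.σ_fine
  have hB := h.inv_log_pos
  rw [abs_lt] at hQ2
  have hs0 : 0 < κ ^ J * q := by positivity
  set s₀ := κ ^ J * q with hs₀
  have hs0p : s₀ ^ p = (κ ^ J) ^ p * q ^ p := Real.mul_rpow hσ0.le hq.le
  have hΛq : 2 * (G + 2 + 4 * A.A₃ ^ p) * q ^ p ≤ Λ * q ^ p := by gcongr
  have hA3q : 0 < A.A₃ ^ p * q ^ p := by positivity
  have small : ∀ s, 0 < s → s ≤ s₀ → s ≤ q / 2 ∧ s ^ p ≤ q ^ p / 2 ∧ 0 < s ^ p ∧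
      |z.2 + -G * s ^ p - y.2| ≤ (G + 2) * q ^ p := by
    intro s hs hss
    have e1 : s ^ p ≤ (κ ^ J) ^ p * q ^ p := by
      rw [← hs0p]; exact Real.rpow_le_rpow hs.le hss hp0.le
    have hsp := Real.rpow_pos_of_pos hs p
    have e2 : G * s ^ p ≤ q ^ p := by
      calc G * s ^ p ≤ G * ((κ ^ J) ^ p * q ^ p) := by gcongr
        _ = G * (κ ^ J) ^ p * q ^ p := by ring
        _ ≤ 1 * q ^ p := by gcongr
        _ = q ^ p := one_mul _
    have e3 : 0 < G * s ^ p := by positivity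
    have e4 : 0 < G * q ^ p := by positivity
    refine ⟨by nlinarith, by nlinarith, hsp, ?_⟩
    rw [abs_le]; constructor <;> linarith
  have hfit : ∀ s (hs : 0 < s), s ≤ s₀ → Fits p Ω A (cone p z 0 (-G) s hs) := by
    intro s hs hss
    obtain ⟨e1, e2, e3, e4⟩ := small s hs hss
    rw [fits_iff hp0]
    refine (box_subset_box ?_ ?_).trans (hQ3.trans hUΩ)
    · simp only [cone, smul_zero, add_zero]
      have : A.A₃ * s ≤ A.A₃ * (q / 2) := by gcongr
      have : 2 * (A.A₃ + 2) * q ≤ Λ * q := by gcongr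
      have : 0 < A.A₃ * q := by positivity
      linarith
    · simp only [cone]
      have : A.A₃ ^ p * s ^ p ≤ A.A₃ ^ p * q ^ p := by gcongr; linarith
      have : 0 < (G + 2) * q ^ p := by positivity
      linarith
  have step1 : fitDist p Ω A R (cone p z 0 (-G) s₀ hs0)
      ≤ fitDist p Ω A R ⟨y, q, hq⟩ + (adjusting p κ G J : ℕ) := by
    refine h.fitDist_adjust R ⟨y, q, hq⟩ (hQ3.trans hUΩ) ?_ ?_ hs0 hs₀
    · simp only [smul_zero, add_zero]; linarith
    · have e1 : G * s₀ ^ p ≤ q ^ p := by rw [hs0p]; nlinarith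
      have e2 : 0 ≤ G * s₀ ^ p := by rw [hs0p]; positivity
      simp only
      rw [abs_le]; constructor <;> linarith
  -- The factor `8` leaves room for the cylinder whose positive translate is centered at `z`: it
  -- reaches down to `4 s^p ≤ d^p / 2` below `z`.
  set τ := min s₀ (d / 8) with hτ
  have hτ0 : 0 < τ := lt_min hs0 (by positivity)
  obtain ⟨m, hm1, hm2⟩ := exists_nat_pow_near_of_lt_one (div_pos hτ0 hs0)
    ((div_le_one hs0).2 (min_le_left _ _)) hθ hθ1
  have hmB := natCast_le_of_le_pow hθ hθ1 (div_pos hτ0 hs0) hm2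
  rw [lt_div_iff₀ hs0] at hm1
  have hs1 : 0 < θ ^ (m + 1) * s₀ := by positivity
  have step2 := fitDist_shrink (Ω := Ω) h.one_lt.le h.slack h.le_θ hθ1 h.G_eq (v := 0)
    (by rw [norm_zero, mul_zero]; linarith) z R hs0 hs1 (m + 1) rfl hfit
  set s₁ := θ ^ (m + 1) * s₀ with hs₁
  have hs1s0 : s₁ ≤ s₀ := hm1.le.trans (min_le_left _ _)
  have hs1d : s₁ ≤ d / 8 := hm1.le.trans (min_le_right _ _)
  obtain ⟨e1, e2, hs1p, e4⟩ := small s₁ hs1 hs1s0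
  have hs2 : 0 < κ ^ J * s₁ := by positivity
  have hs2p : (κ ^ J * s₁) ^ p = (κ ^ J) ^ p * s₁ ^ p := Real.mul_rpow hσ0.le hs1.le
  -- On the cone the time lag to `z` is `G s₁^p`; a final adjustment replaces it by the lag `3` that
  -- places `z` in the positive translate.
  have step3 := h.fitDist_adjust R (cone p z 0 (-G) s₁ hs1) (Ω := Ω)
    (c' := (z.1, z.2 - 3 * (κ ^ J * s₁) ^ p)) (by
      refine (box_subset_box ?_ ?_).trans (hQ3.trans hUΩ)
      · simp only [cone, smul_zero, add_zero]
        have : Λ * s₁ ≤ Λ * (q / 2) := by gcongr; linarith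
        nlinarith
      · simp only [cone]
        have : Λ * s₁ ^ p ≤ Λ * (q ^ p / 2) := by gcongr; linarith
        linarith)
    (by simp only [cone, smul_zero, add_zero, sub_self, norm_zero]; positivity)
    (by
      simp only [cone]
      have : z.2 - 3 * (κ ^ J * s₁) ^ p - (z.2 + -G * s₁ ^ p) - G * s₁ ^ p
        = -(3 * (κ ^ J) ^ p * s₁ ^ p) := by rw [hs2p]; ring
      rw [this, abs_neg, abs_of_pos (by positivity)]
      gcongr
      linarith) hs2 rfl
  have hs2p0 := Real.rpow_pos_of_pos hs2 p
  have hs2d : κ ^ J * s₁ ≤ d / 8 := by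
    refine le_trans ?_ hs1d
    exact mul_le_of_le_one_left hs1.le (by linarith)
  refine ⟨⟨(z.1, z.2 - 3 * (κ ^ J * s₁) ^ p), κ ^ J * s₁, hs2⟩, mem_lag_of_center hp0 z hs2,
    (toSet_subset_box_of_le h.one_lt.le z hs2 hd hs2d).trans hdV, step3.trans ?_⟩
  · have hlog : -Real.log (τ / s₀) ≤ Real.log (1 + 8 * ρ / d) :=
      neg_log_min_div_le hs0 ((mul_le_of_le_one_left hq.le (by linarith)).trans hQρ) hd
    have hmB' : (m : ℝ) ≤ (-Real.log θ)⁻¹ * Real.log (1 + 8 * ρ / d) :=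
      hmB.trans (by gcongr)
    calc _ ≤ (fitDist p Ω A R ⟨y, q, hq⟩ + (adjusting p κ G J : ℕ) + (m + 1 : ℕ))
          + (adjusting p κ G J : ℕ) := by
          refine add_le_add (step2.trans (add_le_add step1 le_rfl)) le_rfl
      _ = fitDist p Ω A R ⟨y, q, hq⟩ + ((2 * adjusting p κ G J + 1 + m : ℕ) : ℝ≥0∞) := by
          push_cast; ring
      _ ≤ _ := by
          refine add_le_add le_rfl ?_
          rw [← ENNReal.ofReal_natCast]
          refine ENNReal.ofReal_le_ofReal ?_
          push_cast
          linarith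

end Scales

end FIT

/-! ### Exponential integrability of the penalized distance and the logarithmic bound. -/

namespace FIT

variable {n : ℕ} {p : ℝ} {A : Param} {Ω U V : Set (SpaceTime n)} {R : Cylinder n}
  {κ H θ G c Λ ρ : ℝ} {J : ℕ}

theorem future_subset_future (Ω : Set (SpaceTime n)) {s t : ℝ} (h : s ≤ t) :
    future Ω t ⊆ future Ω s := fun _ hz => ⟨hz.1, h.trans_lt hz.2⟩

theorem Reaches.isConnectedWith (hp : 0 < p) (hΩ : IsOpen Ω) {s t : ℝ} (hst : s ≤ t)
    (hpast : R.toSet p ⊆ past Ω s) (hR : Reaches p Ω A R (future Ω s)) :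
    IsConnectedWith p Ω t R := by
  refine ⟨fun z hz => ⟨(hpast hz).1, (hpast hz).2.trans_le hst⟩, fun z hz => ?_⟩
  obtain ⟨e, he, heV⟩ := Metric.isOpen_iff.1 (isOpen_future hΩ t) z hz
  obtain ⟨ρ₀, hρ₀, hsmall⟩ := exists_pos_of_eventually
    ((eventually_const_mul_rpow_lt 2 one_pos he).and (eventually_const_mul_rpow_lt 2 hp he))
  obtain ⟨Q, hQρ, hzQ, hk⟩ := hR z (future_subset_future Ω hst hz) ρ₀ hρ₀
  obtain ⟨e1, e2⟩ := hsmall _ Q.radius_pos hQρ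
  rw [Real.rpow_one] at e1
  refine ⟨Q, A, (Q.toSet_subset_hull hp).trans ((fits_of_fitDist_lt_top hk).hull_subset hp),
    hzQ, ?_, hk⟩
  refine Subset.trans (fun y hy => ?_) heV
  rw [Cylinder.lag_toSet_eq hp, mem_box] at hzQ hy
  rw [Metric.mem_ball, Prod.dist_eq, max_lt_iff, dist_eq_norm, Real.dist_eq]
  have h1 := norm_sub_le_norm_sub_add_norm_sub y.1 Q.center.1 z.1
  have h2 := abs_sub_le y.2 (Q.center.2 + 3 * Q.radius ^ p) z.2
  rw [norm_sub_rev Q.center.1] at h1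
  rw [abs_sub_comm (Q.center.2 + 3 * Q.radius ^ p)] at h2
  simp only at hzQ hy
  constructor <;> linarith

/-- Where an exponential integral is small, its exponent is not large everywhere. -/
theorem exists_le_of_lintegral_exp_lt {α : Type*} [MeasurableSpace α] {μ : Measure α} {S V : Set α}
    (hS : MeasurableSet S) (hSV : S ⊆ V) {v E N η : ℝ} (hv : 0 < v) (hSv : μ S = ENNReal.ofReal v)
    (hE : 0 < E) (hN : 0 < N) (hη : 0 < η) {φ : α → ℝ}
    (h : ∫⁻ z in V, ENNReal.ofReal (Real.exp (η * φ z / N)) ∂μ < ENNReal.ofReal E) :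
    ∃ w ∈ S, φ w ≤ N / η * Real.log (E / v) := by
  by_contra! hcon
  refine absurd h (not_lt.2 ?_)
  calc ENNReal.ofReal E = ENNReal.ofReal (E / v) * μ S := by
        rw [hSv, ← ENNReal.ofReal_mul (by positivity), div_mul_cancel₀ _ hv.ne']
    _ = ∫⁻ _ in S, ENNReal.ofReal (E / v) ∂μ := by rw [setLIntegral_const]
    _ ≤ ∫⁻ z in S, ENNReal.ofReal (Real.exp (η * φ z / N)) ∂μ := by
        refine setLIntegral_mono' hS fun w hw => ENNReal.ofReal_le_ofReal ?_
        rw [← Real.log_le_iff_le_exp (by positivity)]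
        have := (hcon w hw).le
        rw [le_div_iff₀ hN]
        calc Real.log (E / v) * N = η * (N / η * Real.log (E / v)) := by field_simp
          _ ≤ η * φ w := by gcongr
    _ ≤ _ := lintegral_mono_set hSV

namespace Scales

variable (h : Scales n p A κ H θ G c Λ J)
include h

/-- Exponential integrability of a truncation of the penalized FIT distance. -/
theorem exists_lintegral_lt (hU : IsOpen U) (hne : U.Nonempty) (hUΩ : U ⊆ Ω) (hρ0 : 0 < ρ)
    (hρ : ∀ Q : Cylinder n, Q.toSet p ⊆ U → Q.radius ≤ ρ) (hR : Reaches p Ω A R U) {D₀ η : ℝ}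
    (hD : 0 < D₀) (hexp : ExpIntegrability p U V η D₀) :
    ∃ (N a : ℝ) (g : SpaceTime n → ℝ), 0 < N ∧
      (∀ z ∈ U, (pot p Ω A R θ G Λ ρ U z).toReal ≤ g z) ∧
      ∫⁻ z in V, ENNReal.ofReal (Real.exp (η * max (g z - a) 0 / N))
        < ENNReal.ofReal (D₀ + 1) := by
  have hp0 := h.p_pos
  have hfin : ∀ z ∈ U, pot p Ω A R θ G Λ ρ U z < ∞ := fun z hz => h.pot_lt_top hU hUΩ hR hz
  set F := pot p Ω A R θ G Λ ρ U with hF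
  have hFopen : ∀ z ∈ U, IsOpen ({w | F w < F z + 1} ∩ U) ∧ z ∈ {w | F w < F z + 1} ∩ U ∧
      ∀ w ∈ {w | F w < F z + 1} ∩ U, (F w).toReal ≤ (F z + 1).toReal := by
    intro z hz
    refine ⟨(isOpen_pot_lt _).inter hU, ⟨?_, hz⟩, fun w hw => ?_⟩
    · exact ENNReal.lt_add_right (hfin z hz).ne one_ne_zero
    · exact ENNReal.toReal_mono (ENNReal.add_ne_top.2 ⟨(hfin z hz).ne, ENNReal.one_ne_top⟩)
        (le_of_lt hw.1)
  obtain ⟨z₀, hz₀⟩ := hne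
  obtain ⟨o1, o2, o3⟩ := hFopen z₀ hz₀
  obtain ⟨P, hPz, hP⟩ := exists_hull_subset hp0 o1 o2
  have hrp := Real.rpow_pos_of_pos P.radius_pos p
  set M := (F z₀ + 1).toReal with hM
  have hM0 : 0 ≤ M := ENNReal.toReal_nonneg
  -- The norm of `pot` might vanish. Near `z₀` it is at most `M`, so a step of height `M + 1` in
  -- time forces a jump of at least `1` across a small hull there, while changing `pot` only by a
  -- bounded amount.
  set g : SpaceTime n → ℝ := fun z => (F z).toReal + (M + 1) * timeStep n P.center.2 z with hg
  have hg1 : ∀ z, (F z).toReal ≤ g z := fun z => by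
    have := mul_nonneg (by linarith : 0 ≤ M + 1) (timeStep_nonneg P.center.2 z)
    simp only [hg]; linarith
  have hg2 : ∀ z, g z ≤ (F z).toReal + (M + 1) := fun z => by
    have := mul_le_of_le_one_right (by linarith : 0 ≤ M + 1) (timeStep_le_one P.center.2 z)
    simp only [hg]; linarith
  have hnorm1 : 1 ≤ pbmoNorm p U g := by
    refine one_le_pbmoNorm hp0 (hP.trans inter_subset_right) (b := M) (fun w hw => ?_) fun w hw => ?_
    · have h1 := ((mem_lag_neg hp0).1 hw).2.2
      have h2 := o3 w (hP (P.lag_toSet_subset_hull hp0 (by norm_num) hw))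
      simp only [hg]
      rw [timeStep_of_le (by linarith), mul_zero, add_zero]
      exact h2
    · have h1 := ((mem_lag_pos hp0).1 hw).2.1
      have h2 : 0 ≤ (F w).toReal := ENNReal.toReal_nonneg
      simp only [hg]
      rw [timeStep_of_lt (by linarith), mul_one]
      linarith
  have hnorm2 : pbmoNorm p U g < ∞ := by
    refine (h.pbmoNorm_le hUΩ hρ0 hρ hfin (M := M + 1) (by linarith) (fun z _ => hg1 z)
      fun z _ => hg2 z).trans_lt ?_
    exact ENNReal.add_lt_top.2 ⟨ENNReal.ofReal_lt_top,
      ENNReal.mul_lt_top ENNReal.ofReal_lt_top (logAverage_lt_top n)⟩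
  have hmeas : Measurable g :=
    measurable_pot.ennreal_toReal.add ((measurable_timeStep _).const_mul _)
  have hloc : LocallyIntegrableOn g U volume := by
    refine locallyIntegrableOn_of_bounded hmeas fun z hz => ?_
    obtain ⟨q1, q2, q3⟩ := hFopen z hz
    refine ⟨_, q1.mem_nhds q2, (F z + 1).toReal + (M + 1), fun w hw => ?_⟩
    rw [Real.norm_of_nonneg (ENNReal.toReal_nonneg.trans (hg1 w))]
    linarith [hg2 w, q3 w hw]
  have hlt := (hexp g ⟨hloc, hnorm2⟩ (zero_lt_one.trans_le hnorm1).ne').trans_lt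
    ((ENNReal.ofReal_lt_ofReal_iff (by linarith)).2 (lt_add_one D₀))
  obtain ⟨a, ha⟩ := iInf_lt_iff.1 hlt
  exact ⟨(pbmoNorm p U g).toReal, a, g,
    ENNReal.toReal_pos (zero_lt_one.trans_le hnorm1).ne' hnorm2.ne, fun z _ => hg1 z, ha⟩

/-- The penalized FIT distance is bounded by its smallest values on the lower half of a hull. -/
theorem pot_le_of_exp (hUΩ : U ⊆ Ω) (hVU : V ⊆ U) (hρ0 : 0 < ρ)
    (hρ : ∀ Q : Cylinder n, Q.toSet p ⊆ U → Q.radius ≤ ρ)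
    (hfin : ∀ z ∈ U, pot p Ω A R θ G Λ ρ U z < ∞) {E η N a : ℝ} (hE : 0 < E) (hη : 0 < η)
    (hN : 0 < N) {g : SpaceTime n → ℝ}
    (hg : ∀ z ∈ U, (pot p Ω A R θ G Λ ρ U z).toReal ≤ g z)
    (hint : ∫⁻ z in V, ENNReal.ofReal (Real.exp (η * max (g z - a) 0 / N)) < ENNReal.ofReal E)
    {z : SpaceTime n} {d : ℝ} (hd : 0 < d) (hdV : box z d (d ^ p) ⊆ V) :
    pot p Ω A R θ G Λ ρ U z ≤ ENNReal.ofReal (|a|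
      + N / η * Real.log (E / ((d / 8) ^ n * unitVol n * (2 * (d / 8) ^ p))))
      + ENNReal.ofReal (comparing p κ θ G c Λ J + 2 * (-Real.log θ)⁻¹ * Real.log 2) := by
  have hp0 := h.p_pos
  have hr : 0 < d / 8 := by positivity
  have hrp := Real.rpow_pos_of_pos hr p
  have hω := unitVol_pos n
  set P : Cylinder n := ⟨(z.1, z.2 - 3 * (d / 8) ^ p), d / 8, hr⟩ with hPdef
  have hP : P.hull p 3 ⊆ V := by
    rw [Cylinder.hull_eq hp0]
    refine (box_subset_box ?_ ?_).trans hdV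
    · simp only [hPdef, sub_self, norm_zero]; linarith
    · simp only [hPdef, sub_sub_cancel_left, abs_neg]
      rw [abs_of_pos (by positivity), Real.div_rpow hd.le (by norm_num)]
      have e6 : (8 : ℝ) ≤ 8 ^ p := by
        simpa using Real.rpow_le_rpow_of_exponent_le (x := 8) (by norm_num) h.one_lt.le
      have hdp := Real.rpow_pos_of_pos hd p
      have e7 : d ^ p / 8 ^ p ≤ d ^ p / 8 := by gcongr
      linarith
  have hz : z ∈ (P.lag p 3).toSet p := mem_lag_of_center hp0 z hr
  have hneg := (P.lag_toSet_subset_hull hp0 (a := -3) (by norm_num)).trans hP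
  have hvol : volume ((P.lag p (-3)).toSet p)
      = ENNReal.ofReal ((d / 8) ^ n * unitVol n * (2 * (d / 8) ^ p)) := by
    rw [Cylinder.lag_toSet_eq hp0, volume_box _ _ hr]
  -- Chebyshev's inequality: were the exponent larger on all of `P^-`, the integral over `P^-` alone
  -- would reach `E`.
  obtain ⟨w, hw, hwle⟩ := exists_le_of_lintegral_exp_lt (measurableSet_toSet hp0 _) hneg
    (by positivity) hvol hE hN hη hint
  -- `z` is the center of `P^+`: its spatial depth is `1` and its temporal depth `(4 - 3) / 2`.
  have hlog : logDepth p P z = Real.log 2 := by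
    have : (4 - 3 : ℝ) / 2 = 2⁻¹ := by norm_num
    simp only [logDepth, hPdef, sub_self, norm_zero, zero_div, sub_zero, Real.log_one, neg_zero,
      sub_sub_cancel, mul_div_assoc, div_self hrp.ne', mul_one]
    rw [this, Real.log_inv]; simp
  have hpot := h.pot_le (R := R) hUΩ hρ0 hρ (hP.trans hVU) hw hz
  rw [hlog] at hpot
  refine hpot.trans (add_le_add ?_ le_rfl)
  have hwU := hVU (hneg hw)
  refine (ENNReal.le_ofReal_iff_toReal_le (hfin w hwU).ne ?_).2 ?_
  · exact add_nonneg (abs_nonneg a) ((le_max_right _ _).trans hwle)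
  · have h1 := hg w hwU
    have h2 := le_max_left (g w - a) 0
    have h3 := le_abs_self a
    linarith

/-- The volume is a constant times `d^(n+p)`; the positive part of `-log d` is absorbed by `log (1/d
+ 1)`, which is also positive for large `d`. -/
theorem log_volume_le {E d : ℝ} (hE : 0 < E) (hd : 0 < d) :
    Real.log (E / ((d / 8) ^ n * unitVol n * (2 * (d / 8) ^ p)))
      ≤ |Real.log E - Real.log (unitVol n) - Real.log 2 + (n + p) * Real.log 8|
        + (n + p) * Real.log (1 / d + 1) := by
  have hω := unitVol_pos n
  have hr : 0 < d / 8 := by positivity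
  have hrp := Real.rpow_pos_of_pos hr p
  have hp0 := h.p_pos
  rw [Real.log_div hE.ne' (by positivity), Real.log_mul (by positivity) (by positivity),
    Real.log_mul (by positivity) hω.ne', Real.log_mul two_ne_zero hrp.ne', Real.log_pow,
    Real.log_rpow hr, Real.log_div hd.ne' (by norm_num)]
  have h1 : -Real.log d ≤ Real.log (1 / d + 1) := by
    rw [← Real.log_inv, ← one_div]
    exact Real.log_le_log (by positivity) (by linarith)
  have h2 : (n + p) * (-Real.log d) ≤ (n + p) * Real.log (1 / d + 1) := by gcongr
  have h3 := le_abs_self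
    (Real.log E - Real.log (unitVol n) - Real.log 2 + (n + p) * Real.log 8)
  linarith

theorem exists_fitDistTo_le (hΩ : IsOpen Ω) {t ε D₀ η : ℝ} (hε : 0 < ε) (hD : 0 < D₀)
    (hη : 0 < η) (hR : Reaches p Ω A R (future Ω (t - ε)))
    (hexp : ExpIntegrability p (future Ω (t - ε)) (future Ω t) η D₀) :
    ∃ D : ℝ, 0 < D ∧ ∀ z ∈ future Ω t, fitDistTo p Ω t A R z
      ≤ ENNReal.ofReal (D * Real.log (1 / pinfDist p z (future Ω t)ᶜ + 1)) := by
  have hp0 := h.p_pos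
  rcases (future Ω t).eq_empty_or_nonempty with hemp | hne
  · exact ⟨1, one_pos, fun z hz => by simp [hemp] at hz⟩
  set V := future Ω t with hV
  set U := future Ω (t - ε) with hUdef
  have hVU : V ⊆ U := future_subset_future Ω (by linarith)
  have hUΩ : U ⊆ Ω := fun z hz => hz.1
  have hU : IsOpen U := isOpen_future hΩ _
  have hVo : IsOpen V := isOpen_future hΩ _
  have hVc : Vᶜ.Nonempty := ⟨(0, t), fun hz => lt_irrefl t hz.2⟩
  have hUne := hne.mono hVU
  have hvol := hexp.volume_le hp0 hU hUne hη
  have hω := unitVol_pos n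
  obtain ⟨ρ, hρ0, hρ⟩ : ∃ ρ : ℝ, 0 < ρ ∧ ∀ Q : Cylinder n, Q.toSet p ⊆ U → Q.radius ≤ ρ :=
    ⟨1 + D₀ / unitVol n + ε ^ (1 / p), by positivity,
      radius_le_of_volume_le h.one_lt hε hD hvol⟩
  have hfin : ∀ z ∈ U, pot p Ω A R θ G Λ ρ U z < ∞ := fun z hz => h.pot_lt_top hU hUΩ hR hz
  obtain ⟨N, a, g, hN, hg, hint⟩ := h.exists_lintegral_lt hU hUne hUΩ hρ0 hρ hR hD hexp
  have hB := h.inv_log_pos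
  have hC := h.comparing_nonneg
  set B := (-Real.log θ)⁻¹ with hBdef
  have hNη : 0 < N / η := by positivity
  set k₁ := |Real.log (D₀ + 1) - Real.log (unitVol n) - Real.log 2 + (n + p) * Real.log 8|
  have hk₁ : 0 ≤ k₁ := abs_nonneg _
  have hl2 : 0 < Real.log 2 := Real.log_pos one_lt_two
  set C₁ := |a| + N / η * k₁ + (comparing p κ θ G c Λ J + 2 * B * Real.log 2) + 1
    + (2 * adjusting p κ G J + 1 + B * Real.log (1 + 8 * ρ)) with hC₁
  set C₂ := N / η * (n + p) + B with hC₂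
  have hl8 : 0 ≤ Real.log (1 + 8 * ρ) := Real.log_nonneg (by linarith)
  have hC₁0 : 0 ≤ C₁ := by positivity
  have hC₂0 : 0 < C₂ := by positivity
  have hL0 : 0 < Real.log (1 / ρ + 1) := Real.log_pos (by linarith [one_div_pos.2 hρ0])
  -- The estimate obtained is `C₁ + C₂ L` with `L = log (1/d + 1)`. Since `d ≤ ρ`, `L` is bounded
  -- below by `log (1/ρ + 1) > 0`, and the additive constant becomes a multiple of `L`.
  refine ⟨C₁ / Real.log (1 / ρ + 1) + C₂, by positivity, fun z hz => ?_⟩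
  obtain ⟨hd, hdV⟩ := pinfDist_spec hp0 hVo hVc hz
  set d := pinfDist p z Vᶜ with hddef
  have hdρ : d ≤ ρ := by
    refine hρ ⟨z, d, hd⟩ ?_
    rw [Cylinder.toSet_eq hp0]; exact hdV.trans hVU
  have hL : Real.log (1 / ρ + 1) ≤ Real.log (1 / d + 1) := by
    refine Real.log_le_log (by positivity) ?_
    have : 1 / ρ ≤ 1 / d := one_div_le_one_div_of_le hd hdρ
    linarith
  set L := Real.log (1 / d + 1) with hLdef
  have hLpos : 0 < L := hL0.trans_le hL
  set X := |a| + N / η * (k₁ + (n + p) * L) + (comparing p κ θ G c Λ J + 2 * B * Real.log 2)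
    with hX
  have hX0 : 0 ≤ X := by positivity
  -- The infimum need not be attained; the extra `1` yields an actual cylinder `Q` to descend from.
  have hpot : pot p Ω A R θ G Λ ρ U z < ENNReal.ofReal (X + 1) := by
    refine lt_of_le_of_lt ?_ ((ENNReal.ofReal_lt_ofReal_iff (by linarith)).2 (lt_add_one X))
    refine (h.pot_le_of_exp hUΩ hVU hρ0 hρ hfin (by linarith) hη hN hg hint hd hdV).trans ?_
    have hsum : ENNReal.ofReal X = ENNReal.ofReal (|a| + N / η * (k₁ + (n + p) * L))
        + ENNReal.ofReal (comparing p κ θ G c Λ J + 2 * B * Real.log 2) :=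
      ENNReal.ofReal_add (by positivity) (by positivity)
    rw [hsum]
    refine add_le_add (ENNReal.ofReal_le_ofReal ?_) le_rfl
    gcongr
    exact h.log_volume_le (by linarith) hd
  rw [pot, iInf_lt_iff] at hpot
  obtain ⟨Q, hpot⟩ := hpot
  rw [iInf_lt_iff] at hpot
  obtain ⟨hQ, hpot⟩ := hpot
  obtain ⟨Q', hzQ', hQ'V, hk⟩ := h.exists_descent R hUΩ hQ (h.radius_le hρ hQ) hd hdV
  refine (iInf₂_le Q' ⟨hzQ', hQ'V⟩).trans (hk.trans ?_)
  have hlog : Real.log (1 + 8 * ρ / d) ≤ Real.log (1 + 8 * ρ) + L := by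
    rw [hLdef, ← Real.log_mul (by positivity) (by positivity)]
    refine Real.log_le_log (by positivity) ?_
    have h1 : (1 + 8 * ρ) * (1 / d + 1) = 1 + 8 * ρ / d + (1 / d + 8 * ρ) := by ring
    rw [h1]
    have : 0 < 1 / d := by positivity
    linarith
  calc _ ≤ ENNReal.ofReal (X + 1) + ENNReal.ofReal
        (2 * adjusting p κ G J + 1 + B * Real.log (1 + 8 * ρ / d)) :=
        add_le_add (le_self_add.trans hpot.le) le_rfl
    _ = ENNReal.ofReal (X + 1 + (2 * adjusting p κ G J + 1 + B * Real.log (1 + 8 * ρ / d))) := by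
        have : 0 ≤ Real.log (1 + 8 * ρ / d) :=
          Real.log_nonneg (by linarith [show 0 < 8 * ρ / d by positivity])
        exact (ENNReal.ofReal_add (by linarith) (by positivity)).symm
    _ ≤ _ := by
        refine ENNReal.ofReal_le_ofReal ?_
        have h1 : B * Real.log (1 + 8 * ρ / d) ≤ B * (Real.log (1 + 8 * ρ) + L) := by gcongr
        have h2 : C₁ ≤ C₁ / Real.log (1 / ρ + 1) * L := by
          rw [div_mul_eq_mul_div, le_div_iff₀ hL0]; gcongr
        have h3 : X + 1 + (2 * adjusting p κ G J + 1 + B * (Real.log (1 + 8 * ρ) + L))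
          = C₁ + C₂ * L := by rw [hX, hC₁, hC₂]; ring
        rw [add_mul]
        linarith

theorem holderConclusion (hΩ : IsOpen Ω) {t ε D₀ η : ℝ} (hε : 0 < ε) (hD : 0 < D₀)
    (hη : 0 < η) (hpast : R.toSet p ⊆ past Ω (t - ε)) (hR : Reaches p Ω A R (future Ω (t - ε)))
    (hexp : ExpIntegrability p (future Ω (t - ε)) (future Ω t) η D₀) :
    HolderConclusion p Ω t A R := by
  obtain ⟨D, hD0, hDle⟩ := h.exists_fitDistTo_le hΩ hε hD hη hR hexp
  refine ⟨⟨hΩ, hR.isConnectedWith h.p_pos hΩ (by linarith) hpast, D * Real.log 2,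
    mul_pos hD0 (Real.log_pos one_lt_two), fun z hz => ?_⟩, D, hD0, hDle⟩
  refine (hDle z hz).trans (le_of_eq ?_)
  have : Real.log 2 ≠ 0 := (Real.log_pos one_lt_two).ne'
  rw [Real.logb, add_comm 1]
  congr 1
  field_simp

end Scales

end FIT

theorem mainTheorem5 (n : ℕ) (hn : 1 ≤ n) (p : ℝ) (hp : 1 < p)
    (A : FIT.Param) (hA : 2 < A.A₂) :
    ∃ l₀ : ℝ, 0 < l₀ ∧ l₀ ≤ 1 ∧
      ∀ (Ω : Set (FIT.SpaceTime n)) (t₀ ε : ℝ) (R : FIT.Cylinder n) (D₀ η : ℝ),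
        IsOpen Ω → 0 < ε → 0 < D₀ → 0 < η →
        FIT.IsConnectedWith p Ω (t₀ - ε) R →
        FIT.ExpIntegrability p (FIT.future Ω (t₀ - ε)) (FIT.future Ω t₀) η D₀ →
          (∀ (l : ℝ) (hl : 0 < l), l ≤ l₀ →
            FIT.HolderConclusion p Ω t₀ A (R.dilate l hl)) ∧
          ((∀ z ∈ FIT.future Ω (t₀ - ε), ∀ ρ : ℝ, 0 < ρ → ∃ Q : FIT.Cylinder n,
              Q.radius < ρ ∧ z ∈ (Q.lag p 3).toSet p ∧ FIT.fitDist p Ω A R Q < ⊤) →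
            FIT.HolderConclusion p Ω t₀ A R) := by
  have hp0 : 0 < p := by linarith
  obtain ⟨κ, hκ⟩ := FIT.exists_slack n p A hA
  obtain ⟨H, θ, G, c, Λ, J, h⟩ := hκ.exists_scales hp
  obtain ⟨ρ₀, hρ₀, hsmall⟩ := FIT.exists_pos_of_eventually
    ((FIT.eventually_const_mul_rpow_lt A.A₃ one_pos one_pos).and
    (FIT.eventually_const_mul_rpow_lt (H + 4 * A.A₃ ^ p) hp0 one_half_pos))
  -- `ρ₀` makes the dilated hulls of `l R` and of the cylinders shrunk from it fit into the hull of
  -- `R`; the bound `1` keeps `l R` inside `R`, hence in the past. Both depend only on `n`, `p` and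
  -- `A`.
  refine ⟨min (ρ₀ / 2) 1, lt_min (half_pos hρ₀) one_pos, min_le_right _ _, ?_⟩
  intro Ω t₀ ε R D₀ η hΩ hε hD hη hconn hexp
  refine ⟨fun l hl hl₀ => ?_, fun hR => h.holderConclusion hΩ hε hD hη hconn.1 hR hexp⟩
  have hl1 : l ≤ 1 := hl₀.trans (min_le_right _ _)
  obtain ⟨e1, e2⟩ := hsmall l hl
    ((hl₀.trans (min_le_left _ _)).trans_lt (half_lt_self hρ₀))
  rw [Real.rpow_one] at e1
  refine h.holderConclusion hΩ hε hD hη (Set.Subset.trans ?_ hconn.1)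
    (FIT.reaches_of_isConnectedWith hp hκ h.H_nonneg h.H_eq hl e1.le e2.le hΩ hconn) hexp
  rw [FIT.Cylinder.toSet_eq hp0, FIT.Cylinder.toSet_eq hp0]
  have hR := R.radius_pos
  have hlR : l * R.radius ≤ R.radius := mul_le_of_le_one_left hR.le hl1
  refine FIT.box_subset_box ?_ ?_
  · simpa [FIT.Cylinder.dilate] using hlR
  · simpa [FIT.Cylinder.dilate] using Real.rpow_le_rpow (by positivity) hlR hp0.le
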